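/- Let $k\ge 0$ be an integer and let $P(z)=1+\sum_{n=1}^k p_n z^n$ and $Q(z)=1+\sum_{n=1}^k q_n z^n$ be coprime polynomials with real coefficients and constant term $1$, at least one of them of degree exactly $k$, all of whose complex zeros lie strictly outside the closed unit disc. Put $S_Z(e^{i\theta})=\left|P(e^{i\theta})/Q(e^{i\theta})\right|^2$ (an ARMA($k$) noise spectrum) and let $p\ge 0$ be a power constraint. A function on the unit circle is called strictly causal if its Fourier coefficients of index $\le 0$ vanish; $H_2$ and $H_\infty$ denote the $L_2$, resp. $L_\infty$, functions on the unit circle whose Fourier coefficients of negative index vanish. Consider the variational expression for the feedback capacity $$C_{FB}=\sup_{B}\int_{-\pi}^{\pi}\tfrac12\log|1+B(e^{i\theta})|^2\,\frac{d\theta}{2\pi},$$ where the supremum is over all strictly causal real polynomials $B(e^{i\theta})=\sum_{n=1}^m b_ne^{in\theta}$ with $\int_{-\pi}^{\pi}|B(e^{i\theta})|^2S_Z(e^{i\theta})\,\frac{d\theta}{2\pi}\le p$. Then this supremum is finite, and there is a strictly causal $B^\star\in H_\infty$ with real Fourier coefficients that satisfies the same power constraint, for which $\log|1+B^\star|^2$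 is integrable, and that attains it: $$\int_{-\pi}^{\pi}\tfrac12\log|1+B^\star(e^{i\theta})|^2\,\frac{d\theta}{2\pi}=C_{FB},$$ and no strictly causal $B\in H_2$ with real Fourier coefficients satisfying the power constraint gives a larger value. Moreover, the corresponding output spectrum $S_Y^\star=|1+B^\star|^2S_Z$ satisfies, for almost every $\theta$, $$S_Y^\star(e^{i\theta})=\sigma^2\left|\frac{R(e^{i\theta})}{Q(e^{i\theta})}\right|^2$$ for some $\sigma>0$ and some real polynomial $R(z)=1+\sum_{n=1}^k r_nz^n$ of degree at most $k$. -/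

import Mathlib

open MeasureTheory Polynomial

noncomputable section

namespace GaussianFeedback

instance factTwoPiPos : Fact (0 < 2 * Real.pi) := Fact.mk Real.two_pi_pos

/-- The circle `ℝ / 2πℤ` of angles `θ`. Its Haar probability measure
`AddCircle.haarAddCircle` is `dθ / 2π`. -/
abbrev AngleCircle : Type := AddCircle (2 * Real.pi)

/-- The point `e^{iθ}` of the unit circle, as a complex number. -/
def unitPoint (θ : AngleCircle) : ℂ := (AddCircle.toCircle θ : ℂ)

/-- A function on the circle is causal if its Fourier coefficients of negative index vanish. -/
def IsCausal (f : AngleCircle → ℂ) : Prop :=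
  ∀ n : ℤ, n < 0 → fourierCoeff f n = 0

/-- A function on the circle is strictly causal if its Fourier coefficients of nonpositive
index vanish. -/
def IsStrictlyCausal (f : AngleCircle → ℂ) : Prop :=
  ∀ n : ℤ, n ≤ 0 → fourierCoeff f n = 0

/-- All Fourier coefficients are real. -/
def HasRealCoeffs (f : AngleCircle → ℂ) : Prop :=
  ∀ n : ℤ, (fourierCoeff f n).im = 0

/-- The Hardy class `H_p` (`1 ≤ p ≤ ∞`), as the class of causal `L_p` functions on the circle. -/
def MemHardy (p : ENNReal) (f : AngleCircle → ℂ) : Prop :=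
  MemLp f p AddCircle.haarAddCircle ∧ IsCausal f

/-- A real polynomial as a function on the circle, `θ ↦ ∑ b_n e^{inθ}`. -/
def polyFilter (b : ℝ[X]) (θ : AngleCircle) : ℂ := aeval (unitPoint θ) b

/-- The spectrum `|P(e^{iθ}) / Q(e^{iθ})|²` of the rational transfer function `P / Q`. For real
`P`, `Q` it is `H(e^{iθ}) H(e^{-iθ})` with `H = P / Q`. -/
def rationalSpectrum (P Q : ℝ[X]) (θ : AngleCircle) : ℝ :=
  ‖aeval (unitPoint θ) P / aeval (unitPoint θ) Q‖ ^ 2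

/-- All complex zeros lie strictly outside the closed unit disc. -/
def IsStable (P : ℝ[X]) : Prop := ∀ z : ℂ, aeval z P = 0 → 1 < ‖z‖

/-- `P / Q` is the canonical spectral factor of an `ARMA(k)` noise spectrum. -/
structure IsARMAFactor (k : ℕ) (P Q : ℝ[X]) : Prop where
  coeff_zero_num : P.coeff 0 = 1
  coeff_zero_den : Q.coeff 0 = 1
  natDegree_num_le : P.natDegree ≤ k
  natDegree_den_le : Q.natDegree ≤ k
  degree_attained : P.natDegree = k ∨ Q.natDegree = k
  coprime : IsCoprime P Q
  stable_num : IsStable P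
  stable_den : IsStable Q

/-- The power `∫ |B(e^{iθ})|² S(e^{iθ}) dθ/2π` used by the feedback filter `B`. -/
def inputPower (S : AngleCircle → ℝ) (B : AngleCircle → ℂ) : ℝ :=
  ∫ θ, ‖B θ‖ ^ 2 * S θ ∂AddCircle.haarAddCircle

/-- The rate `∫ (1/2) log |1 + B(e^{iθ})|² dθ/2π` of the feedback filter `B`. -/
def feedbackRate (B : AngleCircle → ℂ) : ℝ :=
  ∫ θ, (1 / 2 : ℝ) * Real.log (‖1 + B θ‖ ^ 2) ∂AddCircle.haarAddCircle

/-- The rates of the strictly causal polynomial filters that meet the power constraint; the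
supremum of this set is the variational expression for the feedback capacity. -/
def polynomialRates (S : AngleCircle → ℝ) (power : ℝ) : Set ℝ :=
  {r | ∃ b : ℝ[X], b.coeff 0 = 0 ∧ inputPower S (polyFilter b) ≤ power ∧
    r = feedbackRate (polyFilter b)}

/-- Real strictly causal `H_p` filters that meet the power constraint. -/
structure IsFeasible (p : ENNReal) (S : AngleCircle → ℝ) (power : ℝ)
    (B : AngleCircle → ℂ) : Prop where
  memHardy : MemHardy p B
  strictlyCausal : IsStrictlyCausal B
  realCoeffs : HasRealCoeffs B
  power_le : inputPower S B ≤ power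

/-- The output spectrum `|1 + B(e^{iθ})|² S(e^{iθ})`. -/
def outputSpectrum (S : AngleCircle → ℝ) (B : AngleCircle → ℂ) (θ : AngleCircle) : ℝ :=
  ‖1 + B θ‖ ^ 2 * S θ

end GaussianFeedback

end

namespace GaussianFeedback

open Filter Topology
open scoped ENNReal NNReal ComplexConjugate

local notation "μ" => (AddCircle.haarAddCircle : Measure AngleCircle)

/-! ### Points of the circle and Fourier coefficients -/

/-! Write F = 1 + B. Maximising ∫ log|F| is not a concave problem, so |F| is replaced by an
independent envelope A ≥ |F|, and |B|² = |F|² − 2 Re F + 1 by A² − 2 Re F + 1. The rate ∫ log A is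
then concave, the power is convex in A and affine in F, and the relaxed value dominates every
feasible rate. A maximiser exists (`exists_relaxed_optimum`): near-optimal pairs form decreasing
convex sets in L², elements of almost minimal norm form a Cauchy sequence, and the mean of the
logarithm is upper semicontinuous along strong limits (`log_mean_upper_semicontinuous`).

With a multiplier λ > 0, pointwise maximisation in A gives A = max(|F|, (λS)^(-1/2))
(`waterfilling`), and variation of F shows that (λS − A⁻²)F − λS has no Fourier coefficient of
positive index (`stationarity`). Hence M = |Q|²(λS − A⁻²)F has no coefficient of index above k. If S
is not constant, M is not zero, and by Jensen's inequality a nonzero L² function with one-sided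
spectrum vanishes only on a null set. But M vanishes wherever A equals the water level, so A = |F|
almost everywhere: the relaxation is tight. Now λA²|P|² = conj(F)·M + |Q|² is a positive
trigonometric polynomial of degree at most k, and `fejer_riesz` yields the rational output spectrum
(`optimum_structure`).

The same identities give a nonzero polynomial v such that vF has no coefficient of index above 4k.
This forces geometric decay of the coefficients of F (`hasGeometricDecay_of_eval_mul`), so F is
continuous up to a null set, and it stays above the least water level. Truncations of F, rescaled to
meet the power constraint, then show that polynomial filters approach the optimum
(`feedbackRate_causalSeries_le`).

Two cases are separate. With zero power there is no Slater point, but only B = 0 is feasible. For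
white noise M may vanish, and the optimum is explicit: F is a constant times a Blaschke factor. -/

@[simp] lemma norm_unitPoint (θ : AngleCircle) : ‖unitPoint θ‖ = 1 :=
  Circle.norm_coe _

lemma unitPoint_ne_zero (θ : AngleCircle) : unitPoint θ ≠ 0 := by
  intro h
  have := norm_unitPoint θ
  simp [h] at this

lemma continuous_unitPoint : Continuous unitPoint :=
  continuous_subtype_val.comp AddCircle.continuous_toCircle

lemma conj_unitPoint (θ : AngleCircle) : conj (unitPoint θ) = (unitPoint θ)⁻¹ := by
  rw [Complex.inv_def, Complex.normSq_eq_norm_sq]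
  simp

lemma unitPoint_neg (θ : AngleCircle) : unitPoint (-θ) = conj (unitPoint θ) := by
  rw [conj_unitPoint]
  simp [unitPoint, AddCircle.toCircle_neg]

lemma fourier_eq_zpow (n : ℤ) (θ : AngleCircle) : fourier n θ = unitPoint θ ^ n := by
  simp [unitPoint, AddCircle.toCircle_zsmul]

lemma unitPoint_injective : Function.Injective unitPoint := by
  intro a b h
  exact AddCircle.injective_toCircle (two_ne_zero' ℝ |> fun h2 => mul_ne_zero h2 Real.pi_ne_zero)
    (Subtype.ext h)

lemma continuous_unitPoint_zpow (n : ℤ) : Continuous fun θ => unitPoint θ ^ n := by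
  simp_rw [← fourier_eq_zpow]
  exact (fourier n).continuous

lemma fourierCoeff_eq (f : AngleCircle → ℂ) (n : ℤ) :
    fourierCoeff f n = ∫ θ, unitPoint θ ^ (-n) * f θ ∂μ := by
  simp only [fourierCoeff, fourier_eq_zpow, smul_eq_mul]

lemma integrable_zpow_mul {f : AngleCircle → ℂ} (hf : Integrable f μ) (n : ℤ) :
    Integrable (fun θ => unitPoint θ ^ n * f θ) μ := by
  refine hf.bdd_mul (c := 1) (continuous_unitPoint_zpow n).aestronglyMeasurable ?_
  exact ae_of_all _ fun θ => by simp

lemma fourierCoeff_zpow_mul (f : AngleCircle → ℂ) (j n : ℤ) :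
    fourierCoeff (fun θ => unitPoint θ ^ j * f θ) n = fourierCoeff f (n - j) := by
  simp only [fourierCoeff_eq]
  congr 1 with θ
  rw [← mul_assoc, ← zpow_add₀ (unitPoint_ne_zero θ)]
  congr 2; ring

lemma fourierCoeff_add_fun {f g : AngleCircle → ℂ} (hf : Integrable f μ) (hg : Integrable g μ)
    (n : ℤ) : fourierCoeff (fun θ => f θ + g θ) n = fourierCoeff f n + fourierCoeff g n :=
  congrFun (fourierCoeff.add hf hg) n

lemma fourierCoeff_sub_fun {f g : AngleCircle → ℂ} (hf : Integrable f μ) (hg : Integrable g μ)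
    (n : ℤ) : fourierCoeff (fun θ => f θ - g θ) n = fourierCoeff f n - fourierCoeff g n := by
  simp only [fourierCoeff_eq, mul_sub]
  exact integral_sub (integrable_zpow_mul hf _) (integrable_zpow_mul hg _)

lemma fourierCoeff_zpow (j n : ℤ) :
    fourierCoeff (fun θ : AngleCircle => unitPoint θ ^ j) n = if n = j then 1 else 0 := by
  have : (fun θ : AngleCircle => unitPoint θ ^ j) = fourier j := by
    ext θ; rw [fourier_eq_zpow]
  rw [this, fourierCoeff_fourier]
  simp [Pi.single_apply]

lemma fourierCoeff_one (n : ℤ) :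
    fourierCoeff (fun _ : AngleCircle => (1 : ℂ)) n = if n = 0 then 1 else 0 := by
  simpa using fourierCoeff_zpow 0 n

lemma continuous_eval_unitPoint (p : ℂ[X]) : Continuous fun θ => p.eval (unitPoint θ) :=
  p.continuous.comp continuous_unitPoint

lemma _root_.Continuous.memLp_circle {E : Type*} [NormedAddCommGroup E]
    {f : AngleCircle → E} (hf : Continuous f) (p : ℝ≥0∞) : MemLp f p μ := by
  have : MemLp f ∞ μ := by
    obtain ⟨C, hC⟩ := isCompact_univ.exists_bound_of_continuousOn hf.continuousOn
    exact memLp_top_of_bound hf.aestronglyMeasurable_of_compactSpace C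
      (ae_of_all _ fun θ => hC θ trivial)
  exact this.mono_exponent le_top

lemma _root_.Continuous.integrable_circle {E : Type*} [NormedAddCommGroup E]
    {f : AngleCircle → E} (hf : Continuous f) : Integrable f μ :=
  memLp_one_iff_integrable.1 (hf.memLp_circle 1)

lemma integrable_continuous_mul {f g : AngleCircle → ℂ} (hg : Continuous g)
    (hf : Integrable f μ) : Integrable (fun θ => g θ * f θ) μ := by
  obtain ⟨C, hC⟩ := isCompact_univ.exists_bound_of_continuousOn hg.continuousOn
  exact hf.bdd_mul (c := C) hg.aestronglyMeasurable (ae_of_all _ fun θ => hC θ trivial)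

lemma memLp_continuous_mul {f g : AngleCircle → ℂ} {p : ℝ≥0∞} (hg : Continuous g)
    (hf : MemLp f p μ) : MemLp (fun θ => g θ * f θ) p μ :=
  hf.mul (hg.memLp_circle ∞)

lemma fourierCoeff_eval_mul (p : ℂ[X]) {f : AngleCircle → ℂ} (hf : Integrable f μ) (n : ℤ) :
    fourierCoeff (fun θ => p.eval (unitPoint θ) * f θ) n =
      ∑ i ∈ Finset.range (p.natDegree + 1), p.coeff i * fourierCoeff f (n - i) := by
  simp only [eval_eq_sum_range, Finset.sum_mul]
  have h := congrFun (fourierCoeff.sum (Finset.range (p.natDegree + 1))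
    (fun i θ => p.coeff i * unitPoint θ ^ i * f θ) (fun i _ => by
      simpa [mul_assoc] using (integrable_zpow_mul hf i).const_mul (p.coeff i))) n
  have h2 : (∑ i ∈ Finset.range (p.natDegree + 1),
      fun θ => p.coeff i * unitPoint θ ^ i * f θ) =
      fun θ => ∑ i ∈ Finset.range (p.natDegree + 1), p.coeff i * unitPoint θ ^ i * f θ := by
    ext θ; simp
  rw [h2] at h
  rw [h, Finset.sum_apply]
  refine Finset.sum_congr rfl fun i _ => ?_
  simp_rw [mul_assoc]
  rw [fourierCoeff.const_mul]
  congr 1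
  simpa using fourierCoeff_zpow_mul f i n

lemma fourierCoeff_eval (p : ℂ[X]) (n : ℤ) :
    fourierCoeff (fun θ => p.eval (unitPoint θ)) n =
      if 0 ≤ n then p.coeff n.toNat else 0 := by
  have h := fourierCoeff_eval_mul p (f := fun _ => 1) (integrable_const _) n
  simp only [mul_one] at h
  rw [h]
  simp only [fourierCoeff_one, sub_eq_zero, mul_ite, mul_one, mul_zero]
  split_ifs with hn
  · obtain ⟨m, rfl⟩ := Int.eq_ofNat_of_zero_le hn
    simp only [Int.toNat_natCast, Nat.cast_inj]
    rw [Finset.sum_ite_eq]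
    split_ifs with hm
    · rfl
    · rw [coeff_eq_zero_of_natDegree_lt]
      simpa [Nat.lt_succ_iff] using hm
  · refine Finset.sum_eq_zero fun i _ => if_neg ?_
    omega

/-- An integrable function on the circle whose Fourier coefficients vanish is zero. -/
lemma ae_eq_zero_of_fourierCoeff {f : AngleCircle → ℂ} (hf : Integrable f μ)
    (h : ∀ n, fourierCoeff f n = 0) : f =ᵐ[μ] 0 := by
  -- The pairing with f is continuous for the sup norm and vanishes on trigonometric polynomials,
  -- which are dense.
  have hcont : ∀ g : C(AngleCircle, ℂ), ∫ θ, g θ * f θ ∂μ = 0 := by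
    have hclosed : IsClosed {g : C(AngleCircle, ℂ) | ∫ θ, g θ * f θ ∂μ = 0} := by
      refine isClosed_eq ?_ continuous_const
      refine continuous_iff_continuousAt.2 fun g => ?_
      refine tendsto_integral_filter_of_dominated_convergence (fun θ => (‖g‖ + 1) * ‖f θ‖)
        ?_ ?_ (hf.norm.const_mul _) ?_
      · exact Eventually.of_forall fun g' =>
          (integrable_continuous_mul g'.continuous hf).aestronglyMeasurable
      · have : ∀ᶠ g' in 𝓝 g, ‖g'‖ < ‖g‖ + 1 :=
          (continuous_norm.tendsto g).eventually_lt_const (by linarith)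
        filter_upwards [this] with g' hg'
        refine ae_of_all _ fun θ => ?_
        rw [norm_mul]
        gcongr
        exact (g'.norm_coe_le_norm θ).trans hg'.le
      · refine ae_of_all _ fun θ => ?_
        exact ((ContinuousEvalConst.continuous_eval_const θ).tendsto g).mul_const _
    have hspan : ((Submodule.span ℂ (Set.range (@fourier (2 * Real.pi)))) : Set C(AngleCircle, ℂ))
        ⊆ {g : C(AngleCircle, ℂ) | ∫ θ, g θ * f θ ∂μ = 0} := by
      intro g hg
      refine Submodule.span_induction (p := fun g _ => ∫ θ, g θ * f θ ∂μ = 0) ?_ ?_ ?_ ?_ hg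
      · rintro _ ⟨n, rfl⟩
        have := h (-n)
        rw [fourierCoeff_eq, neg_neg] at this
        simpa only [fourier_eq_zpow] using this
      · simp
      · intro a b _ _ ha hb
        simp only [ContinuousMap.add_apply, add_mul]
        rw [integral_add (integrable_continuous_mul a.continuous hf)
          (integrable_continuous_mul b.continuous hf), ha, hb, add_zero]
      · intro c a _ ha
        simp only [ContinuousMap.smul_apply, smul_eq_mul, mul_assoc]
        rw [integral_const_mul, ha, mul_zero]
    intro g
    have : g ∈ (Submodule.span ℂ (Set.range (@fourier (2 * Real.pi)))).topologicalClosure := by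
      rw [span_fourier_closure_eq_top]; trivial
    exact closure_minimal hspan hclosed this
  -- The indicator of a closed set is a bounded pointwise limit of continuous functions, so the
  -- integral over the set vanishes too.
  refine ae_eq_zero_of_forall_setIntegral_isClosed_eq_zero hf fun s hs => ?_
  rw [← integral_indicator hs.measurableSet]
  have hlim : Tendsto (fun n => ∫ θ, ((hs.apprSeq n θ : ℝ) : ℂ) * f θ ∂μ) atTop
      (𝓝 (∫ θ, s.indicator f θ ∂μ)) := by
    refine tendsto_integral_of_dominated_convergence (fun θ => ‖f θ‖) ?_ hf.norm ?_ ?_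
    · intro n
      refine (integrable_continuous_mul ?_ hf).aestronglyMeasurable
      exact Complex.continuous_ofReal.comp
        (NNReal.continuous_coe.comp (hs.apprSeq n).continuous)
    · intro n
      refine ae_of_all _ fun θ => ?_
      rw [norm_mul]
      refine mul_le_of_le_one_left (norm_nonneg _) ?_
      rw [Complex.norm_real, Real.norm_of_nonneg (NNReal.coe_nonneg _)]
      exact_mod_cast HasOuterApproxClosed.apprSeq_apply_le_one hs n θ
    · refine ae_of_all _ fun θ => ?_
      have h1 := (tendsto_pi_nhds.1 (HasOuterApproxClosed.tendsto_apprSeq hs)) θ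
      have h2 := ((Complex.continuous_ofReal.comp NNReal.continuous_coe).tendsto _).comp h1
      have h3 := h2.mul_const (f θ)
      have h4 : s.indicator f θ = (Complex.ofReal ∘ NNReal.toReal)
          (s.indicator (fun _ => (1 : ℝ≥0)) θ) * f θ := by
        by_cases hθ : θ ∈ s <;> simp [hθ]
      rw [h4]
      exact h3
  have hzero : ∀ n, ∫ θ, ((hs.apprSeq n θ : ℝ) : ℂ) * f θ ∂μ = 0 := fun n =>
    hcont ⟨fun θ => ((hs.apprSeq n θ : ℝ) : ℂ), Complex.continuous_ofReal.comp
        (NNReal.continuous_coe.comp (hs.apprSeq n).continuous)⟩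
  simp only [hzero] at hlim
  exact (tendsto_nhds_unique hlim tendsto_const_nhds)

lemma ae_eq_of_fourierCoeff {f g : AngleCircle → ℂ} (hf : Integrable f μ) (hg : Integrable g μ)
    (h : ∀ n, fourierCoeff f n = fourierCoeff g n) : f =ᵐ[μ] g := by
  have h0 := ae_eq_zero_of_fourierCoeff (hf.sub hg) fun n => by
    have := fourierCoeff_sub_fun hf hg n
    rw [h n, sub_self] at this
    exact this
  filter_upwards [h0] with θ hθ
  exact sub_eq_zero.1 hθ

/-- A function with Fourier coefficients supported on `[0, N]` is a polynomial of degree `≤ N`. -/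
lemma ae_eq_eval_of_fourierCoeff {f : AngleCircle → ℂ} (hf : Integrable f μ) (N : ℕ)
    (hneg : ∀ n : ℤ, n < 0 → fourierCoeff f n = 0)
    (hpos : ∀ n : ℤ, (N : ℤ) < n → fourierCoeff f n = 0) :
    f =ᵐ[μ] fun θ =>
      (∑ i ∈ Finset.range (N + 1), C (fourierCoeff f i) * X ^ i : ℂ[X]).eval (unitPoint θ) := by
  refine ae_eq_of_fourierCoeff hf (continuous_eval_unitPoint _).integrable_circle fun n => ?_
  rw [fourierCoeff_eval]
  split_ifs with hn
  · obtain ⟨m, rfl⟩ := Int.eq_ofNat_of_zero_le hn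
    simp only [Int.toNat_natCast, finsetSum_coeff, coeff_C_mul, coeff_X_pow, mul_ite, mul_one,
      mul_zero]
    rw [Finset.sum_ite_eq]
    split_ifs with hm
    · rfl
    · refine hpos _ ?_
      simp at hm
      exact_mod_cast hm
  · exact hneg n (by omega)

/-- Square integrable functions with disjoint spectra are orthogonal. -/
lemma integral_conj_mul_eq_zero {f g : AngleCircle → ℂ} (hf : MemLp f 2 μ) (hg : MemLp g 2 μ)
    (h : ∀ n, fourierCoeff f n = 0 ∨ fourierCoeff g n = 0) :
    ∫ θ, conj (f θ) * g θ ∂μ = 0 := by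
  have h1 := (fourierBasis (T := 2 * Real.pi)).hasSum_inner_mul_inner hf.toLp hg.toLp
  have h2 : ∀ n, inner ℂ hf.toLp (fourierBasis n) * inner ℂ (fourierBasis n) hg.toLp = 0 := by
    intro n
    rw [← inner_conj_symm, ← HilbertBasis.repr_apply_apply, ← HilbertBasis.repr_apply_apply,
      fourierBasis_repr, fourierBasis_repr, fourierCoeff_congr_ae hf.coeFn_toLp,
      fourierCoeff_congr_ae hg.coeFn_toLp]
    rcases h n with h | h <;> simp [h]
  simp only [h2] at h1
  have h3 := h1.unique hasSum_zero
  rw [L2.inner_def] at h3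
  rw [← h3]
  refine integral_congr_ae ?_
  filter_upwards [hf.coeFn_toLp, hg.coeFn_toLp] with θ h4 h5
  rw [h4, h5]
  simp [mul_comm]

/-! ### Hermitian symmetry and real Fourier coefficients -/

/-- A function on the circle with the symmetry of a real filter. -/
def IsHermitianFun (f : AngleCircle → ℂ) : Prop := ∀ᵐ θ ∂μ, f (-θ) = conj (f θ)

lemma ae_neg {p : AngleCircle → Prop} (h : ∀ᵐ θ ∂μ, p θ) : ∀ᵐ θ ∂μ, p (-θ) :=
  (Measure.measurePreserving_neg μ).quasiMeasurePreserving.ae h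

lemma fourierCoeff_conj_neg (f : AngleCircle → ℂ) (n : ℤ) :
    fourierCoeff (fun θ => conj (f (-θ))) n = conj (fourierCoeff f n) := by
  rw [fourierCoeff_eq, fourierCoeff_eq, ← integral_conj, ← integral_neg_eq_self]
  congr 1 with θ
  simp [unitPoint_neg]

lemma IsHermitianFun.hasRealCoeffs {f : AngleCircle → ℂ} (h : IsHermitianFun f) :
    HasRealCoeffs f := by
  intro n
  rw [← Complex.conj_eq_iff_im, ← fourierCoeff_conj_neg]
  refine congrFun (fourierCoeff_congr_ae ?_) n
  filter_upwards [h] with θ hθ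
  simp [hθ]

lemma HasRealCoeffs.isHermitianFun {f : AngleCircle → ℂ} (hf : Integrable f μ)
    (h : HasRealCoeffs f) : IsHermitianFun f := by
  have h1 : Integrable (fun θ => conj (f (-θ))) μ := by
    have h2 := ((Measure.measurePreserving_neg μ).integrable_comp hf.aestronglyMeasurable).2 hf
    exact (LinearIsometryEquiv.integrable_comp_iff Complex.conjLIE).2 h2
  have h2 := ae_eq_of_fourierCoeff h1 hf fun n => by
    rw [fourierCoeff_conj_neg, Complex.conj_eq_iff_im, h n]
  filter_upwards [h2] with θ hθ
  rw [← hθ, Complex.conj_conj]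

/-- The partial sums of the Fourier series of a causal function converge in `L²`. -/
lemma tendsto_eLpNorm_partial_sum {f : AngleCircle → ℂ} (hf : MemLp f 2 μ)
    (h : ∀ n : ℤ, n < 0 → fourierCoeff f n = 0) :
    Tendsto (fun N : ℕ => eLpNorm (fun θ => (∑ i ∈ Finset.range N,
      C (fourierCoeff f i) * X ^ i : ℂ[X]).eval (unitPoint θ) - f θ) 2 μ) atTop (𝓝 0) := by
  have h1 := hasSum_fourier_series_L2 hf.toLp
  simp_rw [fourierCoeff_congr_ae hf.coeFn_toLp] at h1
  rw [← (Nat.cast_injective (R := ℤ)).hasSum_iff] at h1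
  swap
  · intro n hn
    rw [h n, zero_smul]
    by_contra h2
    exact hn ⟨n.toNat, by simp; omega⟩
  have h2 := h1.tendsto_sum_nat
  rw [Lp.tendsto_Lp_iff_tendsto_eLpNorm'] at h2
  refine h2.congr fun N => eLpNorm_congr_ae ?_
  have h3 : ∀ᵐ θ ∂μ, ∀ i : ℕ, (fourierLp (T := 2 * Real.pi) 2 i) θ = unitPoint θ ^ i := by
    rw [ae_all_iff]
    intro i
    filter_upwards [coeFn_fourierLp (T := 2 * Real.pi) 2 i] with θ hθ
    rw [hθ, fourier_eq_zpow, zpow_natCast]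
  have h4 : ∀ᵐ θ ∂μ, (∑ i ∈ Finset.range N, fourierCoeff f (i : ℤ) • fourierLp (T := 2 * Real.pi) 2 (i : ℤ) :
      Lp ℂ 2 μ) θ = ∑ i ∈ Finset.range N, fourierCoeff f (i : ℤ) * (fourierLp (T := 2 * Real.pi) 2 i) θ := by
    induction N with
    | zero =>
      filter_upwards [Lp.coeFn_zero ℂ 2 μ] with θ _
      simp
    | succ N ih =>
      rw [Finset.sum_range_succ]
      filter_upwards [ih, Lp.coeFn_add (∑ i ∈ Finset.range N, fourierCoeff f (i : ℤ) •
        fourierLp (T := 2 * Real.pi) 2 (i : ℤ) : Lp ℂ 2 μ)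
        (fourierCoeff f (N : ℤ) • fourierLp (T := 2 * Real.pi) 2 (N : ℤ)),
        Lp.coeFn_smul (fourierCoeff f (N : ℤ)) (fourierLp (T := 2 * Real.pi) 2 (N : ℤ))] with θ h5 h6 h7
      rw [h6, Pi.add_apply, h5, h7, Finset.sum_range_succ]
      simp
  filter_upwards [h3, h4, hf.coeFn_toLp, Lp.coeFn_sub (∑ i ∈ Finset.range N, fourierCoeff f (i : ℤ) •
        fourierLp (T := 2 * Real.pi) 2 (i : ℤ) : Lp ℂ 2 μ) hf.toLp] with θ h5 h6 h7 h8
  simp only [Function.comp] at h8 ⊢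
  rw [Pi.sub_apply]
  erw [h6]
  rw [h7]
  simp only [eval_finsetSum, eval_mul, eval_C, eval_pow, eval_X]
  congr 1
  exact Finset.sum_congr rfl fun i _ => by rw [h5 i]

/-! ### Upper semicontinuity of the mean of the logarithm, and Jensen's inequality -/

/-- Fatou's lemma for `f - log f`, which is nonnegative since log x ≤ x − 1. The means of f converge
by L² convergence, so the mean of the logarithm can only jump up in the limit. Finiteness of the
limiting integral also forces g > 0, because x − log x blows up at 0. -/
lemma log_mean_upper_semicontinuous {f : ℕ → AngleCircle → ℝ} {g : AngleCircle → ℝ}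
    {v : ℕ → ℝ} {V : ℝ} (hf : ∀ n, MemLp (f n) 2 μ) (hg : MemLp g 2 μ)
    (hfg : Tendsto (fun n => eLpNorm (f n - g) 2 μ) atTop (𝓝 0))
    (hpos : ∀ n, ∀ᵐ θ ∂μ, 0 < f n θ) (hint : ∀ n, Integrable (fun θ => Real.log (f n θ)) μ)
    (hv : ∀ n, v n ≤ ∫ θ, Real.log (f n θ) ∂μ) (hV : Tendsto v atTop (𝓝 V)) :
    (∀ᵐ θ ∂μ, 0 < g θ) ∧ Integrable (fun θ => Real.log (g θ)) μ ∧
      V ≤ ∫ θ, Real.log (g θ) ∂μ := by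
  have hfi : ∀ n, Integrable (f n) μ := fun n => (hf n).integrable (by norm_num)
  have hgi : Integrable g μ := hg.integrable (by norm_num)
  obtain ⟨ns, hns, hlim⟩ := (tendstoInMeasure_of_tendsto_eLpNorm (by norm_num)
    (fun n => (hf n).aestronglyMeasurable) hg.aestronglyMeasurable hfg).exists_seq_tendsto_ae
  have hnst := hns.tendsto_atTop
  have hmean : Tendsto (fun n => ∫ θ, f (ns n) θ ∂μ) atTop (𝓝 (∫ θ, g θ ∂μ)) := by
    refine tendsto_integral_of_L1 g hgi.aestronglyMeasurable
      (Eventually.of_forall fun n => hfi _) ?_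
    have h1 : Tendsto (fun n => eLpNorm (f n - g) 1 μ) atTop (𝓝 0) :=
      tendsto_of_tendsto_of_tendsto_of_le_of_le tendsto_const_nhds hfg (fun _ => zero_le)
        fun n => eLpNorm_le_eLpNorm_of_exponent_le (by norm_num)
          ((hf n).sub hg).aestronglyMeasurable
    simp only [eLpNorm_one_eq_lintegral_enorm] at h1
    exact h1.comp hnst
  set G : ℕ → AngleCircle → ℝ := fun n θ => f (ns n) θ - Real.log (f (ns n) θ) with hG
  have hGi : ∀ n, Integrable (G n) μ := fun n => (hfi _).sub (hint _)
  have hGpos : ∀ n, 0 ≤ᵐ[μ] G n := fun n => by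
    filter_upwards [hpos (ns n)] with θ hθ
    have := Real.log_le_sub_one_of_pos hθ
    simp only [hG, Pi.zero_apply]
    linarith
  have hGint : ∀ n, ∫ θ, G n θ ∂μ = ∫ θ, f (ns n) θ ∂μ - ∫ θ, Real.log (f (ns n) θ) ∂μ :=
    fun n => integral_sub (hfi _) (hint _)
  have hGle : ∀ n, ∫ θ, G n θ ∂μ ≤ ∫ θ, f (ns n) θ ∂μ - v (ns n) := fun n => by
    rw [hGint]; linarith [hv (ns n)]
  have hbound : Tendsto (fun n => ∫ θ, f (ns n) θ ∂μ - v (ns n)) atTop (𝓝 (∫ θ, g θ ∂μ - V)) :=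
    hmean.sub (hV.comp hnst)
  have hfatou : ∫⁻ θ, liminf (fun n => ENNReal.ofReal (G n θ)) atTop ∂μ ≤
      ENNReal.ofReal (∫ θ, g θ ∂μ - V) := by
    refine (lintegral_liminf_le' fun n => (hGi n).aemeasurable.ennreal_ofReal).trans ?_
    refine (liminf_le_liminf (v := fun n => ENNReal.ofReal (∫ θ, f (ns n) θ ∂μ - v (ns n)))
      (Eventually.of_forall fun n => ?_)).trans ?_
    · rw [← ofReal_integral_eq_lintegral_ofReal (hGi n) (hGpos n)]
      exact ENNReal.ofReal_le_ofReal (hGle n)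
    · exact (((ENNReal.continuous_ofReal.tendsto _).comp hbound).liminf_eq).le
  have hposall : ∀ᵐ θ ∂μ, ∀ n, 0 < f (ns n) θ := ae_all_iff.2 fun n => hpos _
  have hlm : AEMeasurable (fun θ => liminf (fun n => ENNReal.ofReal (G n θ)) atTop) μ := by
    simp only [liminf_eq_iSup_iInf_of_nat]
    exact .iSup fun n => .biInf _ (Set.to_countable _)
      fun i _ => (hGi i).aemeasurable.ennreal_ofReal
  have hfin : ∀ᵐ θ ∂μ, liminf (fun n => ENNReal.ofReal (G n θ)) atTop < ⊤ :=
    ae_lt_top' hlm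
      (hfatou.trans_lt ENNReal.ofReal_lt_top).ne
  have hgpos : ∀ᵐ θ ∂μ, 0 < g θ := by
    filter_upwards [hposall, hfin, hlim] with θ h1 h2 h3
    have h4 : 0 ≤ g θ := ge_of_tendsto' h3 fun n => (h1 n).le
    refine lt_of_le_of_ne h4 fun h5 => ?_
    rw [← h5] at h3
    have h6 : Tendsto (fun n => f (ns n) θ) atTop (𝓝[>] 0) :=
      tendsto_nhdsWithin_iff.2 ⟨h3, Eventually.of_forall h1⟩
    have h7 : Tendsto (fun n => G n θ) atTop atTop := by
      have h8 := tendsto_neg_atBot_atTop.comp (Real.tendsto_log_nhdsGT_zero.comp h6)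
      exact (h3.add_atTop h8).congr fun n => by simp [hG, sub_eq_add_neg]
    have h8 := (ENNReal.tendsto_ofReal_atTop.comp h7).liminf_eq
    simp only [Function.comp_def] at h8
    rw [h8] at h2
    exact lt_irrefl _ h2
  have hlimG : ∀ᵐ θ ∂μ, liminf (fun n => ENNReal.ofReal (G n θ)) atTop =
      ENNReal.ofReal (g θ - Real.log (g θ)) := by
    filter_upwards [hgpos, hlim] with θ h1 h2
    have h3 : Tendsto (fun n => G n θ) atTop (𝓝 (g θ - Real.log (g θ))) :=
      h2.sub ((Real.continuousAt_log h1.ne').tendsto.comp h2)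
    exact ((ENNReal.continuous_ofReal.tendsto _).comp h3).liminf_eq
  rw [lintegral_congr_ae hlimG] at hfatou
  have hnn : 0 ≤ᵐ[μ] fun θ => g θ - Real.log (g θ) := by
    filter_upwards [hgpos] with θ hθ
    have := Real.log_le_sub_one_of_pos hθ
    simp only [Pi.zero_apply]
    linarith
  have hmeas : AEStronglyMeasurable (fun θ => g θ - Real.log (g θ)) μ :=
    hg.aestronglyMeasurable.sub hg.aestronglyMeasurable.aemeasurable.log.aestronglyMeasurable
  have hdi : Integrable (fun θ => g θ - Real.log (g θ)) μ :=
    (lintegral_ofReal_ne_top_iff_integrable hmeas hnn).1 (hfatou.trans_lt ENNReal.ofReal_lt_top).ne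
  have hli : Integrable (fun θ => Real.log (g θ)) μ := by
    refine (hgi.sub hdi).congr (ae_of_all _ fun θ => ?_)
    simp
  refine ⟨hgpos, hli, ?_⟩
  have h0 : 0 ≤ ∫ θ, g θ ∂μ - V := ge_of_tendsto' hbound fun n =>
    (integral_nonneg_of_ae (hGpos n)).trans (hGle n)
  rw [← ofReal_integral_eq_lintegral_ofReal hdi hnn, ENNReal.ofReal_le_ofReal_iff h0,
    integral_sub hgi hli] at hfatou
  linarith

/-! ### Jensen's inequality, for polynomials and then for `H₂` -/

lemma measurePreserving_circle :
    MeasurePreserving ((↑) : ℝ → AngleCircle)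
      (volume.restrict (Set.Ioc 0 (2 * Real.pi))) (volume : Measure AngleCircle) := by
  simpa using AddCircle.measurePreserving_mk (2 * Real.pi) 0

lemma unitPoint_coe (x : ℝ) : unitPoint (x : AngleCircle) = circleMap 0 1 x := by
  have := fourier_eq_zpow 1 (x : AngleCircle)
  rw [fourier_coe_apply, zpow_one] at this
  rw [← this, circleMap]
  have hpi : (Real.pi : ℂ) ≠ 0 := by exact_mod_cast Real.pi_ne_zero
  simp only [zero_add, Complex.ofReal_one, one_mul]
  congr 1
  push_cast
  field_simp

lemma ae_eval_unitPoint_ne_zero {p : ℂ[X]} (hp : p ≠ 0) :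
    ∀ᵐ θ ∂μ, p.eval (unitPoint θ) ≠ 0 := by
  have hfin : ({θ : AngleCircle | p.eval (unitPoint θ) = 0}).Finite := by
    have : ({z : ℂ | p.eval z = 0}).Finite := by
      convert p.roots.toFinset.finite_toSet using 1
      ext z
      simp [hp]
    exact this.preimage unitPoint_injective.injOn
  have hvol : (volume : Measure AngleCircle) {θ : AngleCircle | p.eval (unitPoint θ) = 0} = 0 := by
    rw [← measurePreserving_circle.measure_preimage hfin.measurableSet.nullMeasurableSet,
      Measure.restrict_apply (measurePreserving_circle.measurable hfin.measurableSet)]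
    refine Set.Finite.measure_zero (Set.Finite.of_finite_image (f := ((↑) : ℝ → AngleCircle))
      (hfin.subset ?_) ?_) _
    · rintro _ ⟨x, hx, rfl⟩
      exact hx.1
    · intro x hx y hy hxy
      have h1 := AddCircle.equivIoc_coe_of_mem (p := 2 * Real.pi) (a := 0) (y := x) (by simpa using hx.2)
      have h2 := AddCircle.equivIoc_coe_of_mem (p := 2 * Real.pi) (a := 0) (y := y) (by simpa using hy.2)
      rw [hxy] at h1
      exact h1.symm.trans h2
  rw [AddCircle.volume_eq_smul_haarAddCircle, Measure.smul_apply, smul_eq_mul, mul_eq_zero] at hvol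
  refine measure_eq_zero_iff_ae_notMem.1 (hvol.resolve_left ?_) |>.mono fun θ hθ => hθ
  simp [Real.pi_pos]

/-- The mean of log|p| is the logarithm of the Mahler measure, which is at least |p(0)| = 1: this is
the coefficient bound at index 0, where the binomial factor is 1. -/
lemma jensen_polynomial {p : ℂ[X]} (hp : p.coeff 0 = 1) :
    Integrable (fun θ => Real.log ‖p.eval (unitPoint θ)‖) μ ∧
      0 ≤ ∫ θ, Real.log ‖p.eval (unitPoint θ)‖ ∂μ := by
  have hp0 : p ≠ 0 := by rintro rfl; simp at hp
  have hint := p.intervalIntegrable_mahlerMeasure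
  rw [intervalIntegrable_iff_integrableOn_Ioc_of_le Real.two_pi_pos.le] at hint
  have hmeas : Measurable fun θ : AngleCircle => Real.log ‖p.eval (unitPoint θ)‖ :=
    (continuous_eval_unitPoint p).norm.measurable.log
  have hcomp : (fun θ : AngleCircle => Real.log ‖p.eval (unitPoint θ)‖) ∘ ((↑) : ℝ → AngleCircle)
      = fun x => Real.log ‖p.eval (circleMap 0 1 x)‖ := by
    ext x; simp [unitPoint_coe]
  have hvol : Integrable (fun θ : AngleCircle => Real.log ‖p.eval (unitPoint θ)‖) volume := by
    rw [← measurePreserving_circle.integrable_comp hmeas.aestronglyMeasurable, hcomp]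
    exact hint
  constructor
  · rw [AddCircle.volume_eq_smul_haarAddCircle] at hvol
    exact (integrable_smul_measure (by simp [Real.pi_pos]) ENNReal.ofReal_ne_top).1 hvol
  · rw [AddCircle.integral_haarAddCircle]
    have h1 : ∫ θ : AngleCircle, Real.log ‖p.eval (unitPoint θ)‖ =
        ∫ x in (0)..(2 * Real.pi), Real.log ‖p.eval (circleMap 0 1 x)‖ := by
      have := AddCircle.intervalIntegral_preimage (2 * Real.pi) 0
        (fun θ : AngleCircle => Real.log ‖p.eval (unitPoint θ)‖)
      rw [← this]
      simp [unitPoint_coe]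
    rw [h1]
    have h2 : (2 * Real.pi)⁻¹ • ∫ x in (0)..(2 * Real.pi), Real.log ‖p.eval (circleMap 0 1 x)‖ =
        p.logMahlerMeasure := rfl
    rw [h2, logMahlerMeasure_eq_log_MahlerMeasure]
    refine Real.log_nonneg ?_
    have := p.norm_coeff_le_choose_mul_mahlerMeasure 0
    simpa [hp] using this

/-- **Jensen's inequality** for functions of class `H₂` with mean one. -/
lemma jensen_hardy {f : AngleCircle → ℂ} (hf : MemLp f 2 μ)
    (h : ∀ n : ℤ, n < 0 → fourierCoeff f n = 0) (h0 : fourierCoeff f 0 = 1) :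
    (∀ᵐ θ ∂μ, 0 < ‖f θ‖) ∧ Integrable (fun θ => Real.log ‖f θ‖) μ ∧
      0 ≤ ∫ θ, Real.log ‖f θ‖ ∂μ := by
  set p : ℕ → ℂ[X] := fun N => ∑ i ∈ Finset.range N, C (fourierCoeff f i) * X ^ i with hp
  -- The index is shifted by one because the empty partial sum lacks the constant term.
  have hp0 : ∀ N, (p (N + 1)).coeff 0 = 1 := fun N => by
    simp [hp, finsetSum_coeff, coeff_X_pow, h0]
  have hne : ∀ N, p (N + 1) ≠ 0 := fun N h1 => by
    have := hp0 N
    simp [h1] at this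
  refine log_mean_upper_semicontinuous (f := fun N θ => ‖(p (N + 1)).eval (unitPoint θ)‖)
    (v := fun _ => 0) (fun N => (continuous_eval_unitPoint _).norm.memLp_circle 2) hf.norm ?_
    (fun N => ?_) (fun N => (jensen_polynomial (hp0 N)).1)
    (fun N => (jensen_polynomial (hp0 N)).2) tendsto_const_nhds
  · have h1 := (tendsto_eLpNorm_partial_sum hf h).comp (tendsto_add_atTop_nat 1)
    refine tendsto_of_tendsto_of_tendsto_of_le_of_le tendsto_const_nhds h1 (fun _ => zero_le)
      fun N => eLpNorm_mono fun θ => ?_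
    exact abs_norm_sub_norm_le _ _
  · filter_upwards [ae_eval_unitPoint_ne_zero (hne N)] with θ hθ
    exact norm_pos_iff.2 hθ

/-- A square integrable function with spectrum bounded below that vanishes on a set of positive
measure vanishes almost everywhere. -/
lemma ae_ne_zero_of_spectrum_bddBelow {f : AngleCircle → ℂ} (hf : MemLp f 2 μ) (N : ℤ)
    (h : ∀ n : ℤ, n < N → fourierCoeff f n = 0) (hne : ¬ f =ᵐ[μ] 0) : ∀ᵐ θ ∂μ, f θ ≠ 0 := by
  have hfi : Integrable f μ := hf.integrable (by norm_num)
  have hex : ∃ n, fourierCoeff f n ≠ 0 := by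
    by_contra! h1
    exact hne (ae_eq_zero_of_fourierCoeff hfi h1)
  obtain ⟨m, hm, hmin⟩ := Int.exists_least_of_bdd (P := fun n => fourierCoeff f n ≠ 0)
    ⟨N, fun n hn => by by_contra h1; exact hn (h n (by omega))⟩ hex
  -- Shifting the lowest frequency m to 0 and dividing by its coefficient puts f in the scope of
  -- Jensen's inequality.
  set c := fourierCoeff f m
  have h1 := jensen_hardy (f := fun θ => c⁻¹ * (unitPoint θ ^ (-m) * f θ))
    ((memLp_continuous_mul (continuous_unitPoint_zpow (-m)) hf).const_mul _) (fun n hn => by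
      rw [fourierCoeff.const_mul, fourierCoeff_zpow_mul]
      have : fourierCoeff f (n - -m) = 0 := by
        by_contra h2
        have := hmin _ h2
        omega
      rw [this, mul_zero]) (by
      rw [fourierCoeff.const_mul, fourierCoeff_zpow_mul]
      simp only [sub_neg_eq_add, zero_add]
      exact inv_mul_cancel₀ hm)
  filter_upwards [h1.1] with θ hθ h2
  simp [h2] at hθ

/-! ### A convex relaxation of the feedback capacity problem -/

/-- The class of noise spectra considered: continuous, positive and even. -/
structure IsNoiseSpectrum (S : AngleCircle → ℝ) : Prop where
  continuous : Continuous S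
  pos : ∀ θ, 0 < S θ
  even : ∀ θ, S (-θ) = S θ

/-- The pairs `(A, F)` of the relaxed problem: `F = 1 + B` for a real strictly causal `B` of class
`H₂`, and `A ≥ |F|` is an even envelope with integrable logarithm. -/
structure IsAdmissible (A : AngleCircle → ℝ) (F : AngleCircle → ℂ) : Prop where
  memLp_env : MemLp A 2 μ
  memLp_fun : MemLp F 2 μ
  pos : ∀ᵐ θ ∂μ, 0 < A θ
  norm_le : ∀ᵐ θ ∂μ, ‖F θ‖ ≤ A θ
  log_integrable : Integrable (fun θ => Real.log (A θ)) μ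
  even : ∀ᵐ θ ∂μ, A (-θ) = A θ
  hermitian : IsHermitianFun F
  causal : ∀ n : ℤ, n < 0 → fourierCoeff F n = 0
  mean : fourierCoeff F 0 = 1

/-- The power used by a pair of the relaxed problem. -/
noncomputable def relaxedPower (S : AngleCircle → ℝ) (A : AngleCircle → ℝ) (F : AngleCircle → ℂ) : ℝ :=
  ∫ θ, (A θ ^ 2 - 2 * (F θ).re + 1) * S θ ∂μ

/-- The rate of a pair of the relaxed problem. -/
noncomputable def relaxedRate (A : AngleCircle → ℝ) : ℝ := ∫ θ, Real.log (A θ) ∂μ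

lemma IsNoiseSpectrum.exists_bounds {S : AngleCircle → ℝ} (hS : IsNoiseSpectrum S) :
    ∃ s₀ s₁ : ℝ, 0 < s₀ ∧ 0 < s₁ ∧ ∀ θ, s₀ ≤ S θ ∧ S θ ≤ s₁ := by
  obtain ⟨a, -, ha⟩ := isCompact_univ.exists_isMinOn Set.univ_nonempty hS.continuous.continuousOn
  obtain ⟨b, -, hb⟩ := isCompact_univ.exists_isMaxOn Set.univ_nonempty hS.continuous.continuousOn
  exact ⟨S a, S b, hS.pos a, hS.pos b, fun θ => ⟨ha (Set.mem_univ θ), hb (Set.mem_univ θ)⟩⟩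

lemma integrable_mul_continuous_real {f g : AngleCircle → ℝ} (hg : Continuous g)
    (hf : Integrable f μ) : Integrable (fun θ => f θ * g θ) μ := by
  obtain ⟨C, hC⟩ := isCompact_univ.exists_bound_of_continuousOn hg.continuousOn
  exact hf.mul_bdd (c := C) hg.aestronglyMeasurable_of_compactSpace
    (ae_of_all _ fun θ => hC θ trivial)

lemma integrable_relaxedPower {S A : AngleCircle → ℝ} {F : AngleCircle → ℂ} (hS : Continuous S)
    (hA : MemLp A 2 μ) (hF : MemLp F 2 μ) :
    Integrable (fun θ => (A θ ^ 2 - 2 * (F θ).re + 1) * S θ) μ := by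
  refine integrable_mul_continuous_real hS ?_
  exact (hA.integrable_sq.sub ((hF.integrable (by norm_num)).re.const_mul 2)).add
    (integrable_const 1)

/-- Since Re z ≤ ‖z‖ ≤ a. Besides nonnegativity this bound makes the relaxed power coercive in the
envelope. -/
lemma relaxedPower_integrand_nonneg {a s : ℝ} {z : ℂ} (hs : 0 ≤ s) (h : ‖z‖ ≤ a) :
    (a - 1) ^ 2 * s ≤ (a ^ 2 - 2 * z.re + 1) * s := by
  have := (Complex.re_le_norm z).trans h
  gcongr
  nlinarith

/-- The pair of the filter B = 0. Its power is zero, so it shows feasibility and serves as the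
Slater point when the power is positive. -/
lemma isAdmissible_one : IsAdmissible (fun _ => 1) (fun _ => 1) where
  memLp_env := memLp_const 1
  memLp_fun := memLp_const 1
  pos := by simp
  norm_le := by simp
  log_integrable := by simp
  even := by simp
  hermitian := by simp [IsHermitianFun]
  causal n hn := by rw [fourierCoeff_one, if_neg hn.ne]
  mean := by rw [fourierCoeff_one, if_pos rfl]

lemma relaxedPower_one (S : AngleCircle → ℝ) : relaxedPower S (fun _ => 1) (fun _ => 1) = 0 := by
  simp only [relaxedPower, Complex.one_re]
  norm_num

/-- Allows pairs to be treated as elements of L² × L². -/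
lemma IsAdmissible.congr {A A' : AngleCircle → ℝ} {F F' : AngleCircle → ℂ}
    (h : IsAdmissible A F) (hA : A =ᵐ[μ] A') (hF : F =ᵐ[μ] F') : IsAdmissible A' F' where
  memLp_env := h.memLp_env.ae_eq hA
  memLp_fun := h.memLp_fun.ae_eq hF
  pos := by filter_upwards [h.pos, hA] with θ h1 h2 using h2 ▸ h1
  norm_le := by filter_upwards [h.norm_le, hA, hF] with θ h1 h2 h3 using h3 ▸ h2 ▸ h1
  log_integrable := h.log_integrable.congr (by filter_upwards [hA] with θ hθ; rw [hθ])
  even := by filter_upwards [h.even, hA, ae_neg hA] with θ h1 h2 h3; rw [← h2, ← h3, h1]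
  hermitian := by
    filter_upwards [h.hermitian, hF, ae_neg hF] with θ h1 h2 h3; rw [← h2, ← h3, h1]
  causal := by rw [← fourierCoeff_congr_ae hF]; exact h.causal
  mean := by rw [← fourierCoeff_congr_ae hF]; exact h.mean

lemma relaxedPower_congr {S A A' : AngleCircle → ℝ} {F F' : AngleCircle → ℂ}
    (hA : A =ᵐ[μ] A') (hF : F =ᵐ[μ] F') : relaxedPower S A F = relaxedPower S A' F' := by
  refine integral_congr_ae ?_
  filter_upwards [hA, hF] with θ h1 h2
  rw [h1, h2]

lemma relaxedRate_congr {A A' : AngleCircle → ℝ} (hA : A =ᵐ[μ] A') :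
    relaxedRate A = relaxedRate A' := by
  refine integral_congr_ae ?_
  filter_upwards [hA] with θ h1
  rw [h1]

lemma log_combo_ge {a b t : ℝ} (ha : 0 < a) (hb : 0 < b) (h0 : 0 ≤ t) (h1 : t ≤ 1) :
    (1 - t) * Real.log a + t * Real.log b ≤ Real.log ((1 - t) * a + t * b) := by
  simpa using strictConcaveOn_log_Ioi.concaveOn.2 (Set.mem_Ioi.2 ha) (Set.mem_Ioi.2 hb)
    (sub_nonneg.2 h1) h0 (by ring)

lemma combo_pos {a b t : ℝ} (ha : 0 < a) (hb : 0 < b) (h0 : 0 ≤ t) (h1 : t ≤ 1) :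
    0 < (1 - t) * a + t * b := by
  rcases h0.eq_or_lt with rfl | h
  · simpa
  · have := mul_nonneg (sub_nonneg.2 h1) ha.le
    have := mul_pos h hb
    linarith

/-! ### Concavity of the relaxed problem -/

section Combination

variable {S A₀ A₁ : AngleCircle → ℝ} {F₀ F₁ : AngleCircle → ℂ} {t : ℝ}

/-- From above log f is controlled by f itself, so only an integrable lower bound is needed. -/
lemma integrable_log_of_le {f : AngleCircle → ℝ} {l : AngleCircle → ℝ} (hf : MemLp f 2 μ)
    (hpos : ∀ᵐ θ ∂μ, 0 < f θ) (hl : Integrable l μ) (hle : ∀ᵐ θ ∂μ, l θ ≤ Real.log (f θ)) :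
    Integrable (fun θ => Real.log (f θ)) μ := by
  refine (hl.norm.add (hf.integrable (by norm_num)).norm).mono'
    hf.aestronglyMeasurable.aemeasurable.log.aestronglyMeasurable ?_
  filter_upwards [hpos, hle] with θ h1 h2
  have h3 := Real.log_le_sub_one_of_pos h1
  have h4 := neg_abs_le (l θ)
  have h5 := le_abs_self (f θ)
  have h6 := abs_nonneg (l θ)
  simp only [Real.norm_eq_abs, Pi.add_apply]
  rw [abs_le]
  constructor <;> linarith

lemma IsAdmissible.combo (h₀ : IsAdmissible A₀ F₀) (h₁ : IsAdmissible A₁ F₁) (ht0 : 0 ≤ t)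
    (ht1 : t ≤ 1) : IsAdmissible (fun θ => (1 - t) * A₀ θ + t * A₁ θ)
      (fun θ => ((1 - t : ℝ) : ℂ) * F₀ θ + (t : ℂ) * F₁ θ) := by
  have hmem : MemLp (fun θ => (1 - t) * A₀ θ + t * A₁ θ) 2 μ :=
    (h₀.memLp_env.const_mul _).add (h₁.memLp_env.const_mul _)
  have hpos : ∀ᵐ θ ∂μ, 0 < (1 - t) * A₀ θ + t * A₁ θ := by
    filter_upwards [h₀.pos, h₁.pos] with θ a b using combo_pos a b ht0 ht1
  have hcoeff : ∀ n, fourierCoeff (fun θ => ((1 - t : ℝ) : ℂ) * F₀ θ + (t : ℂ) * F₁ θ) n =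
      ((1 - t : ℝ) : ℂ) * fourierCoeff F₀ n + (t : ℂ) * fourierCoeff F₁ n := fun n => by
    rw [fourierCoeff_add_fun ((h₀.memLp_fun.integrable (by norm_num)).const_mul _)
      ((h₁.memLp_fun.integrable (by norm_num)).const_mul _), fourierCoeff.const_mul,
      fourierCoeff.const_mul]
  refine ⟨hmem, (h₀.memLp_fun.const_mul _).add (h₁.memLp_fun.const_mul _), hpos, ?_, ?_, ?_, ?_,
    ?_, ?_⟩
  · filter_upwards [h₀.norm_le, h₁.norm_le] with θ a b
    refine (norm_add_le _ _).trans ?_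
    rw [norm_mul, norm_mul, Complex.norm_real, Complex.norm_real,
      Real.norm_of_nonneg (sub_nonneg.2 ht1), Real.norm_of_nonneg ht0]
    have := sub_nonneg.2 ht1
    gcongr
  · refine integrable_log_of_le hmem hpos
      ((h₀.log_integrable.const_mul (1 - t)).add (h₁.log_integrable.const_mul t)) ?_
    filter_upwards [h₀.pos, h₁.pos] with θ a b using log_combo_ge a b ht0 ht1
  · filter_upwards [h₀.even, h₁.even] with θ a b
    rw [a, b]
  · filter_upwards [h₀.hermitian, h₁.hermitian] with θ a b
    rw [a, b]
    simp
  · intro n hn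
    rw [hcoeff, h₀.causal n hn, h₁.causal n hn]
    simp
  · rw [hcoeff, h₀.mean, h₁.mean]
    push_cast
    ring

lemma relaxedRate_combo_ge (h₀ : IsAdmissible A₀ F₀) (h₁ : IsAdmissible A₁ F₁) (ht0 : 0 ≤ t)
    (ht1 : t ≤ 1) : (1 - t) * relaxedRate A₀ + t * relaxedRate A₁ ≤
      relaxedRate fun θ => (1 - t) * A₀ θ + t * A₁ θ := by
  have h := (h₀.combo h₁ ht0 ht1).log_integrable
  simp only [relaxedRate]
  rw [← integral_const_mul, ← integral_const_mul, ← integral_add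
    (h₀.log_integrable.const_mul _) (h₁.log_integrable.const_mul _)]
  refine integral_mono_ae ((h₀.log_integrable.const_mul _).add (h₁.log_integrable.const_mul _)) h ?_
  filter_upwards [h₀.pos, h₁.pos] with θ a b using log_combo_ge a b ht0 ht1

/-- The envelope enters through its square and F only linearly. This is the gain from separating A
from |F|. -/
lemma relaxedPower_combo_le (hS : IsNoiseSpectrum S) (h₀ : IsAdmissible A₀ F₀)
    (h₁ : IsAdmissible A₁ F₁) (ht0 : 0 ≤ t) (ht1 : t ≤ 1) :
    relaxedPower S (fun θ => (1 - t) * A₀ θ + t * A₁ θ)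
      (fun θ => ((1 - t : ℝ) : ℂ) * F₀ θ + (t : ℂ) * F₁ θ) ≤
      (1 - t) * relaxedPower S A₀ F₀ + t * relaxedPower S A₁ F₁ := by
  have i₀ := integrable_relaxedPower hS.continuous h₀.memLp_env h₀.memLp_fun
  have i₁ := integrable_relaxedPower hS.continuous h₁.memLp_env h₁.memLp_fun
  have h := h₀.combo h₁ ht0 ht1
  simp only [relaxedPower]
  rw [← integral_const_mul, ← integral_const_mul, ← integral_add
    (i₀.const_mul _) (i₁.const_mul _)]
  refine integral_mono (integrable_relaxedPower hS.continuous h.memLp_env h.memLp_fun)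
    ((i₀.const_mul _).add (i₁.const_mul _)) fun θ => ?_
  simp only [Complex.add_re, Complex.re_ofReal_mul]
  have h1 : ((1 - t) * A₀ θ + t * A₁ θ) ^ 2 ≤ (1 - t) * A₀ θ ^ 2 + t * A₁ θ ^ 2 := by
    have := mul_nonneg (mul_nonneg ht0 (sub_nonneg.2 ht1)) (sq_nonneg (A₀ θ - A₁ θ))
    nlinarith
  have h2 := mul_le_mul_of_nonneg_right h1 (hS.pos θ).le
  linarith

end Combination

/-! ### Existence of a relaxed optimum -/

/-- Decreasing bounded convex sets in Hilbert spaces contain a convergent selection. -/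
lemma exists_convergent_selection {E₁ E₂ : Type*} [NormedAddCommGroup E₁]
    [InnerProductSpace ℝ E₁] [CompleteSpace E₁] [NormedAddCommGroup E₂] [InnerProductSpace ℂ E₂]
    [CompleteSpace E₂] {K : ℕ → Set (E₁ × E₂)} (hanti : Antitone K)
    (hne : ∀ n, (K n).Nonempty) (hmid : ∀ n, ∀ x ∈ K n, ∀ y ∈ K n, ∃ z ∈ K n,
      z.1 + z.1 = x.1 + y.1 ∧ z.2 + z.2 = x.2 + y.2)
    {M : ℝ} (hM : ∀ x ∈ K 0, ‖x.1‖ ^ 2 + ‖x.2‖ ^ 2 ≤ M) :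
    ∃ (x : ℕ → E₁ × E₂) (y : E₁ × E₂), (∀ n, x n ∈ K n) ∧ Tendsto x atTop (𝓝 y) := by
  -- The Hilbert norm squared on the product; the product type itself carries the sup norm, which
  -- obeys no parallelogram law.
  set q : E₁ × E₂ → ℝ := fun z => ‖z.1‖ ^ 2 + ‖z.2‖ ^ 2 with hq
  have hq0 : ∀ z, 0 ≤ q z := fun z => by positivity
  have hbdd : ∀ n, BddBelow (q '' K n) := fun n => ⟨0, by rintro _ ⟨z, -, rfl⟩; exact hq0 z⟩
  set d : ℕ → ℝ := fun n => sInf (q '' K n) with hd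
  have hdle : ∀ n, ∀ z ∈ K n, d n ≤ q z := fun n z hz => csInf_le (hbdd n) ⟨z, hz, rfl⟩
  have hdmono : Monotone d := fun m n hmn =>
    csInf_le_csInf (hbdd m) ((hne n).image q) (Set.image_mono (hanti hmn))
  have hdM : BddAbove (Set.range d) := by
    refine ⟨M, ?_⟩
    rintro _ ⟨n, rfl⟩
    obtain ⟨z, hz⟩ := hne n
    exact (hdle n z hz).trans (hM z (hanti (zero_le) hz))
  obtain ⟨D, hD⟩ : ∃ D, Tendsto d atTop (𝓝 D) := ⟨_, tendsto_atTop_ciSup hdmono hdM⟩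
  have hdD : ∀ n, d n ≤ D := fun n => hdmono.ge_of_tendsto hD n
  have hsel : ∀ n : ℕ, ∃ z ∈ K n, q z < d n + 1 / ((n : ℝ) + 1) := fun n => by
    have hlt : sInf (q '' K n) < d n + 1 / ((n : ℝ) + 1) :=
      lt_add_of_pos_right _ (by positivity)
    obtain ⟨_, ⟨z, hz, rfl⟩, h⟩ := exists_lt_of_csInf_lt ((hne n).image q) hlt
    exact ⟨z, hz, h⟩
  choose x hxK hxq using hsel
  -- Parallelogram law: the midpoint z lies in `K n`, so q z ≥ d n, and two almost minimal elements
  -- must be close.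
  have hdist : ∀ n m, n ≤ m → q (x n - x m) ≤ 2 * (D - d n) + 4 / ((n : ℝ) + 1) := by
    intro n m hnm
    obtain ⟨z, hz, hz1, hz2⟩ := hmid n _ (hxK n) _ (hanti hnm (hxK m))
    have p1 := parallelogram_law_with_norm ℝ (x n).1 (x m).1
    have p2 := parallelogram_law_with_norm ℂ (x n).2 (x m).2
    rw [← hz1] at p1
    rw [← hz2] at p2
    have n1 : ‖z.1 + z.1‖ = 2 * ‖z.1‖ := by rw [← two_smul ℝ, norm_smul]; simp
    have n2 : ‖z.2 + z.2‖ = 2 * ‖z.2‖ := by rw [← two_smul ℂ, norm_smul]; simp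
    rw [n1] at p1
    rw [n2] at p2
    have h1 := hdle n z hz
    have h2 := hxq n
    have h3 := hxq m
    have h4 := hdD m
    have h5 : 1 / ((m : ℝ) + 1) ≤ 1 / ((n : ℝ) + 1) := by gcongr
    have h6 : 4 / ((n : ℝ) + 1) = 4 * (1 / ((n : ℝ) + 1)) := by ring
    simp only [hq, Prod.fst_sub, Prod.snd_sub] at *
    rw [h6]
    nlinarith
  have hlim : Tendsto (fun n : ℕ => √(2 * (D - d n) + 4 / ((n : ℝ) + 1))) atTop (𝓝 0) := by
    have h1 : Tendsto (fun n : ℕ => 2 * (D - d n) + 4 / ((n : ℝ) + 1)) atTop (𝓝 0) := by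
      have h2 := ((tendsto_const_nhds (x := D)).sub hD).const_mul 2
      have h3 := (tendsto_one_div_add_atTop_nhds_zero_nat (𝕜 := ℝ)).const_mul 4
      have h4 := h2.add h3
      simp only [sub_self, mul_zero, add_zero] at h4
      refine h4.congr fun n => ?_
      ring
    have h2 := (Real.continuous_sqrt.tendsto 0).comp h1
    rwa [Real.sqrt_zero] at h2
  have hcau : CauchySeq x := by
    refine cauchySeq_of_le_tendsto_0 (fun n => 2 * √(2 * (D - d n) + 4 / ((n : ℝ) + 1)))
      (fun n m N hn hm => ?_) (by simpa using hlim.const_mul 2)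
    have hN : ∀ m, N ≤ m → dist (x N) (x m) ≤ √(2 * (D - d N) + 4 / ((N : ℝ) + 1)) := by
      intro m hm
      rw [dist_eq_norm]
      refine (norm_prod_le_iff.2 ⟨?_, ?_⟩)
      · refine Real.le_sqrt_of_sq_le (le_trans ?_ (hdist N m hm))
        exact le_add_of_nonneg_right (sq_nonneg _)
      · refine Real.le_sqrt_of_sq_le (le_trans ?_ (hdist N m hm))
        exact le_add_of_nonneg_left (sq_nonneg _)
    have := dist_triangle_left (x n) (x m) (x N)
    linarith [hN n hn, hN m hm]
  obtain ⟨y, hy⟩ := cauchySeq_tendsto_of_complete hcau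
  exact ⟨x, y, hxK, hy⟩

/-- Fatou's lemma. It carries the power constraint to the limit of a maximising sequence. -/
lemma integral_le_of_ae_tendsto {g : ℕ → AngleCircle → ℝ} {f : AngleCircle → ℝ} {c : ℝ}
    (hg : ∀ n, Integrable (g n) μ) (hf : Integrable f μ) (hpos : ∀ n, 0 ≤ᵐ[μ] g n)
    (hlim : ∀ᵐ θ ∂μ, Tendsto (fun n => g n θ) atTop (𝓝 (f θ)))
    (hle : ∀ n, ∫ θ, g n θ ∂μ ≤ c) : ∫ θ, f θ ∂μ ≤ c := by
  have hc : 0 ≤ c := (integral_nonneg_of_ae (hpos 0)).trans (hle 0)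
  have hfpos : 0 ≤ᵐ[μ] f := by
    filter_upwards [ae_all_iff.2 hpos, hlim] with θ h1 h2
    exact ge_of_tendsto' h2 h1
  rw [← ENNReal.ofReal_le_ofReal_iff hc, ofReal_integral_eq_lintegral_ofReal hf hfpos]
  have h1 : ∫⁻ θ, ENNReal.ofReal (f θ) ∂μ =
      ∫⁻ θ, liminf (fun n => ENNReal.ofReal (g n θ)) atTop ∂μ := by
    refine lintegral_congr_ae ?_
    filter_upwards [hlim] with θ h
    exact (((ENNReal.continuous_ofReal.tendsto _).comp h).liminf_eq).symm
  rw [h1]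
  refine (lintegral_liminf_le' fun n => (hg n).aemeasurable.ennreal_ofReal).trans ?_
  refine (liminf_le_liminf (v := fun _ => ENNReal.ofReal c)
    (Eventually.of_forall fun n => ?_)).trans (by simp)
  rw [← ofReal_integral_eq_lintegral_ofReal (hg n) (hpos n)]
  exact ENNReal.ofReal_le_ofReal (hle n)

/-- The power constraint bounds the envelope. -/
lemma exists_sq_bound {S : AngleCircle → ℝ} (hS : IsNoiseSpectrum S) (power : ℝ) :
    ∃ M : ℝ, ∀ A F, IsAdmissible A F → relaxedPower S A F ≤ power →
      ∫ θ, A θ ^ 2 ∂μ ≤ M := by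
  obtain ⟨s₀, s₁, hs₀, -, hs⟩ := hS.exists_bounds
  -- From A² ≤ 2(A − 1)² + 2 and s₀ ∫ (A − 1)² ≤ power.
  refine ⟨2 * (power / s₀) + 2, fun A F h hp => ?_⟩
  have i2 : Integrable (fun θ => (A θ - 1) ^ 2) μ :=
    (h.memLp_env.sub (memLp_const 1)).integrable_sq
  have h1 : s₀ * ∫ θ, (A θ - 1) ^ 2 ∂μ ≤ power := by
    rw [← integral_const_mul]
    refine le_trans ?_ hp
    refine integral_mono_ae (i2.const_mul _)
      (integrable_relaxedPower hS.continuous h.memLp_env h.memLp_fun) ?_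
    filter_upwards [h.norm_le] with θ hθ
    refine le_trans ?_ (relaxedPower_integrand_nonneg (hS.pos θ).le hθ)
    rw [mul_comm]
    exact mul_le_mul_of_nonneg_left (hs θ).1 (sq_nonneg _)
  have h2 : ∫ θ, A θ ^ 2 ∂μ ≤ ∫ θ, (2 * (A θ - 1) ^ 2 + 2) ∂μ := by
    refine integral_mono h.memLp_env.integrable_sq ((i2.const_mul 2).add (integrable_const 2))
      fun θ => ?_
    simp only
    nlinarith [sq_nonneg (A θ - 2)]
  rw [integral_add (i2.const_mul 2) (integrable_const 2), integral_const_mul] at h2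
  simp only [integral_const, probReal_univ, smul_eq_mul, one_mul] at h2
  have h3 : ∫ θ, (A θ - 1) ^ 2 ∂μ ≤ power / s₀ := by
    rw [le_div_iff₀ hs₀]; linarith
  linarith

lemma IsAdmissible.relaxedRate_le {A : AngleCircle → ℝ} {F : AngleCircle → ℂ}
    (h : IsAdmissible A F) : relaxedRate A ≤ ∫ θ, A θ ^ 2 ∂μ := by
  refine integral_mono_ae h.log_integrable h.memLp_env.integrable_sq ?_
  filter_upwards [h.pos] with θ hθ
  have := Real.log_le_sub_one_of_pos hθ
  nlinarith [sq_nonneg (A θ - 1)]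

lemma IsAdmissible.integral_norm_sq_le {A : AngleCircle → ℝ} {F : AngleCircle → ℂ}
    (h : IsAdmissible A F) : ∫ θ, ‖F θ‖ ^ 2 ∂μ ≤ ∫ θ, A θ ^ 2 ∂μ := by
  refine integral_mono_ae h.memLp_fun.norm.integrable_sq h.memLp_env.integrable_sq ?_
  filter_upwards [h.norm_le] with θ hθ
  gcongr

lemma Lp_norm_sq_eq {E : Type*} [NormedAddCommGroup E] (f : Lp E 2 μ) :
    ‖f‖ ^ 2 = ∫ θ, ‖f θ‖ ^ 2 ∂μ := by
  rw [Lp.norm_def, eLpNorm_eq_lintegral_rpow_enorm_toReal (by norm_num) (by norm_num)]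
  have h := Lp.memLp f
  rw [integral_eq_lintegral_of_nonneg_ae (ae_of_all _ fun θ => by positivity)
    h.norm.integrable_sq.aestronglyMeasurable]
  simp only [ENNReal.toReal_ofNat, ENNReal.rpow_ofNat, one_div]
  rw [← ENNReal.toReal_rpow]
  have : ∀ θ, ENNReal.ofReal (‖f θ‖ ^ 2) = ‖f θ‖ₑ ^ 2 := fun θ => by
    rw [ENNReal.ofReal_pow (norm_nonneg _), ofReal_norm]
  simp only [this]
  rw [← Real.rpow_natCast, ← Real.rpow_mul ENNReal.toReal_nonneg]
  norm_num

/-- The relaxed problem has a solution. -/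
theorem exists_relaxed_optimum {S : AngleCircle → ℝ} (hS : IsNoiseSpectrum S) {power : ℝ}
    (hp : 0 ≤ power) : ∃ A F, IsAdmissible A F ∧ relaxedPower S A F ≤ power ∧
      ∀ A' F', IsAdmissible A' F' → relaxedPower S A' F' ≤ power →
        relaxedRate A' ≤ relaxedRate A := by
  obtain ⟨M, hM⟩ := exists_sq_bound hS power
  set R : Set ℝ := {r | ∃ A F, IsAdmissible A F ∧ relaxedPower S A F ≤ power ∧
    r = relaxedRate A} with hR
  have hRne : R.Nonempty := ⟨_, _, _, isAdmissible_one, by rw [relaxedPower_one]; exact hp, rfl⟩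
  have hRbdd : BddAbove R := by
    refine ⟨M, ?_⟩
    rintro _ ⟨A, F, h1, h2, rfl⟩
    exact h1.relaxedRate_le.trans (hM A F h1 h2)
  set V := sSup R with hV
  -- Feasible pairs within 1/(n + 1) of the supremum. Concavity makes these sets closed under
  -- midpoints, and the selection gives strong convergence without weak compactness.
  let K : ℕ → Set (Lp ℝ 2 μ × Lp ℂ 2 μ) := fun n => {z | IsAdmissible z.1 z.2 ∧
    relaxedPower S z.1 z.2 ≤ power ∧ V - 1 / ((n : ℝ) + 1) ≤ relaxedRate z.1}
  have hanti : Antitone K := by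
    rintro m n hmn z ⟨h1, h2, h3⟩
    refine ⟨h1, h2, le_trans ?_ h3⟩
    gcongr
  have hne : ∀ n, (K n).Nonempty := by
    intro n
    have hlt : V - 1 / ((n : ℝ) + 1) < V := sub_lt_self _ (by positivity)
    obtain ⟨_, ⟨A, F, h1, h2, rfl⟩, h3⟩ := exists_lt_of_lt_csSup hRne hlt
    have hA := h1.memLp_env.coeFn_toLp.symm
    have hF := h1.memLp_fun.coeFn_toLp.symm
    exact ⟨(h1.memLp_env.toLp, h1.memLp_fun.toLp), h1.congr hA hF,
      (relaxedPower_congr hA hF).symm.le.trans h2, h3.le.trans (relaxedRate_congr hA).le⟩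
  have hmid : ∀ n, ∀ x ∈ K n, ∀ y ∈ K n, ∃ z ∈ K n,
      z.1 + z.1 = x.1 + y.1 ∧ z.2 + z.2 = x.2 + y.2 := by
    rintro n x ⟨x1, x2, x3⟩ y ⟨y1, y2, y3⟩
    have ht0 : (0 : ℝ) ≤ 1 / 2 := by norm_num
    have ht1 : (1 / 2 : ℝ) ≤ 1 := by norm_num
    have hc := x1.combo y1 ht0 ht1
    have hr := relaxedRate_combo_ge x1 y1 ht0 ht1
    have hpw := relaxedPower_combo_le hS x1 y1 ht0 ht1
    have hA := hc.memLp_env.coeFn_toLp.symm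
    have hF := hc.memLp_fun.coeFn_toLp.symm
    refine ⟨(hc.memLp_env.toLp, hc.memLp_fun.toLp), ⟨hc.congr hA hF,
      (relaxedPower_congr hA hF).symm.le.trans (by linarith),
      le_trans (by linarith) (relaxedRate_congr hA).le⟩, ?_, ?_⟩
    · ext1
      filter_upwards [hA, Lp.coeFn_add x.1 y.1,
        Lp.coeFn_add (hc.memLp_env.toLp) (hc.memLp_env.toLp)] with θ h1 h2 h3
      rw [h3, h2, Pi.add_apply, Pi.add_apply, ← h1]
      ring
    · ext1
      filter_upwards [hF, Lp.coeFn_add x.2 y.2,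
        Lp.coeFn_add (hc.memLp_fun.toLp) (hc.memLp_fun.toLp)] with θ h1 h2 h3
      rw [h3, h2, Pi.add_apply, Pi.add_apply, ← h1]
      push_cast
      ring
  have hbound : ∀ x ∈ K 0, ‖x.1‖ ^ 2 + ‖x.2‖ ^ 2 ≤ M + M := by
    rintro x ⟨x1, x2, -⟩
    rw [Lp_norm_sq_eq, Lp_norm_sq_eq]
    have h1 := hM _ _ x1 x2
    have h2 := x1.integral_norm_sq_le
    simp only [Real.norm_eq_abs, sq_abs]
    linarith
  obtain ⟨x, y, hxK, hxy⟩ := exists_convergent_selection hanti hne hmid hbound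
  have hx1 : Tendsto (fun n => (x n).1) atTop (𝓝 y.1) := (continuous_fst.tendsto _).comp hxy
  have hx2 : Tendsto (fun n => (x n).2) atTop (𝓝 y.2) := (continuous_snd.tendsto _).comp hxy
  have hL1 := (Lp.tendsto_Lp_iff_tendsto_eLpNorm' _ _).1 hx1
  have hL2 := (Lp.tendsto_Lp_iff_tendsto_eLpNorm' _ _).1 hx2
  obtain ⟨hpos, hlog, hrate⟩ := log_mean_upper_semicontinuous
    (f := fun n => ((x n).1 : AngleCircle → ℝ)) (v := fun n : ℕ => V - 1 / ((n : ℝ) + 1))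
    (V := V) (fun n => (hxK n).1.memLp_env) (Lp.memLp y.1) hL1 (fun n => (hxK n).1.pos)
    (fun n => (hxK n).1.log_integrable) (fun n => (hxK n).2.2)
    (by simpa using (tendsto_const_nhds (x := V)).sub tendsto_one_div_add_atTop_nhds_zero_nat)
  obtain ⟨ns, hns, hlimA⟩ := (tendstoInMeasure_of_tendsto_eLpNorm (by norm_num)
    (fun n => (hxK n).1.memLp_env.aestronglyMeasurable)
    (Lp.memLp y.1).aestronglyMeasurable hL1).exists_seq_tendsto_ae
  -- A further subsequence, so that envelopes and functions converge almost everywhere along the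
  -- same indices.
  obtain ⟨ms, hms, hlimF⟩ := (tendstoInMeasure_of_tendsto_eLpNorm (by norm_num)
    (fun n => (hxK (ns n)).1.memLp_fun.aestronglyMeasurable)
    (Lp.memLp y.2).aestronglyMeasurable (hL2.comp hns.tendsto_atTop)).exists_seq_tendsto_ae
  have hlimA' : ∀ᵐ θ ∂μ, Tendsto (fun n => (x (ns (ms n))).1 θ) atTop (𝓝 (y.1 θ)) := by
    filter_upwards [hlimA] with θ h using h.comp hms.tendsto_atTop
  have hcoeff : ∀ k : ℤ, Tendsto (fun n => fourierCoeff ((x n).2 : AngleCircle → ℂ) k) atTop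
      (𝓝 (fourierCoeff (y.2 : AngleCircle → ℂ) k)) := by
    intro k
    have hc : Continuous fun f : Lp ℂ 2 μ => inner ℂ (fourierBasis (T := 2 * Real.pi) k) f :=
      continuous_const.inner continuous_id
    have h := (hc.tendsto y.2).comp hx2
    simp only [← HilbertBasis.repr_apply_apply, fourierBasis_repr, Function.comp_def] at h
    exact h
  have hadm : IsAdmissible y.1 y.2 := by
    refine ⟨Lp.memLp _, Lp.memLp _, hpos, ?_, hlog, ?_, ?_, ?_, ?_⟩
    · filter_upwards [hlimA', hlimF, ae_all_iff.2 fun n => (hxK n).1.norm_le] with θ h1 h2 h3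
      exact le_of_tendsto_of_tendsto' h2.norm h1 fun n => h3 _
    · filter_upwards [hlimA', ae_neg hlimA', ae_all_iff.2 fun n => (hxK n).1.even] with θ h1 h2 h3
      simp only [h3] at h2
      exact tendsto_nhds_unique h2 h1
    · filter_upwards [hlimF, ae_neg hlimF, ae_all_iff.2 fun n => (hxK n).1.hermitian]
        with θ h1 h2 h3
      simp only [h3] at h2
      exact tendsto_nhds_unique h2 ((Complex.continuous_conj.tendsto _).comp h1)
    · intro k hk
      have h := hcoeff k
      simp only [fun n => (hxK n).1.causal k hk] at h
      exact tendsto_nhds_unique h tendsto_const_nhds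
    · have h := hcoeff 0
      simp only [fun n => (hxK n).1.mean] at h
      exact tendsto_nhds_unique h tendsto_const_nhds
  refine ⟨y.1, y.2, hadm, ?_, fun A' F' h1 h2 => ?_⟩
  · refine integral_le_of_ae_tendsto
      (g := fun n θ => ((x (ns (ms n))).1 θ ^ 2 - 2 * ((x (ns (ms n))).2 θ).re + 1) * S θ)
      (fun n => integrable_relaxedPower hS.continuous (Lp.memLp _) (Lp.memLp _))
      (integrable_relaxedPower hS.continuous (Lp.memLp _) (Lp.memLp _)) (fun n => ?_) ?_
      (fun n => (hxK _).2.1)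
    · filter_upwards [(hxK (ns (ms n))).1.norm_le] with θ hθ
      exact (mul_nonneg (sq_nonneg _) (hS.pos θ).le).trans
        (relaxedPower_integrand_nonneg (hS.pos θ).le hθ)
    · filter_upwards [hlimA', hlimF] with θ h1 h2
      exact ((((h1.pow 2).sub (((Complex.continuous_re.tendsto _).comp h2).const_mul 2)).add
        tendsto_const_nhds).mul_const _)
  · exact (le_csSup hRbdd ⟨A', F', h1, h2, rfl⟩).trans hrate

/-! ### Optimality conditions for the relaxed problem -/

/-- A Lagrange multiplier for a concave problem with one constraint satisfying Slater's condition. -/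
lemma exists_multiplier {K : Set (ℝ × ℝ)} (hmix : ∀ a ∈ K, ∀ b ∈ K, ∀ t : ℝ, 0 ≤ t → t ≤ 1 →
      ∃ c ∈ K, (1 - t) * a.1 + t * b.1 ≤ c.1 ∧ c.2 ≤ (1 - t) * a.2 + t * b.2)
    (hneg : ∀ a ∈ K, a.2 ≤ 0 → a.1 ≤ 0) (hslater : ∃ a ∈ K, a.2 < 0) :
    ∃ l : ℝ, 0 ≤ l ∧ ∀ a ∈ K, a.1 ≤ l * a.2 := by
  have key : ∀ a ∈ K, ∀ b ∈ K, a.2 < 0 → 0 < b.2 → b.1 / b.2 ≤ a.1 / a.2 := by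
    intro a ha b hb ha2 hb2
    have hd : 0 < b.2 - a.2 := by linarith
    -- This weight makes the mixed constraint value exactly 0, so the mixture is feasible and its
    -- gain is at most 0.
    obtain ⟨c, hc, h1, h2⟩ := hmix a ha b hb (-a.2 / (b.2 - a.2))
      (div_nonneg (by linarith) hd.le) ((div_le_one hd).2 (by linarith))
    have h3 : (1 - -a.2 / (b.2 - a.2)) * a.2 + -a.2 / (b.2 - a.2) * b.2 = 0 := by
      field_simp; ring
    have h4 := hneg c hc (h2.trans h3.le)
    have h5 : (1 - -a.2 / (b.2 - a.2)) * a.1 + -a.2 / (b.2 - a.2) * b.1 =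
        (b.2 * a.1 - a.2 * b.1) / (b.2 - a.2) := by
      field_simp; ring
    rw [h5] at h1
    have h6 : b.2 * a.1 - a.2 * b.1 ≤ 0 := by
      have := (div_le_iff₀ hd).1 (h1.trans h4)
      linarith
    rw [div_le_iff₀ hb2, div_mul_eq_mul_div, le_div_iff_of_neg ha2]
    linarith
  obtain ⟨s, hs, hs2⟩ := hslater
  have hnn : ∀ a ∈ K, a.2 < 0 → 0 ≤ a.1 / a.2 := fun a ha h =>
    div_nonneg_of_nonpos (hneg a ha h.le) h.le
  -- The multiplier is the largest gain per unit of violation. Inserting 0 keeps it nonnegative, and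
  -- keeps the supremum meaningful if nothing violates the constraint.
  set L : Set ℝ := insert 0 {r | ∃ b ∈ K, 0 < b.2 ∧ r = b.1 / b.2} with hL
  have hle : ∀ a ∈ K, a.2 < 0 → ∀ r ∈ L, r ≤ a.1 / a.2 := by
    rintro a ha h r (rfl | ⟨b, hb, hb2, rfl⟩)
    · exact hnn a ha h
    · exact key a ha b hb h hb2
  have hbdd : BddAbove L := ⟨_, hle s hs hs2⟩
  refine ⟨sSup L, le_csSup hbdd (Set.mem_insert _ _), fun a ha => ?_⟩
  rcases lt_trichotomy a.2 0 with h | h | h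
  · have := csSup_le (Set.insert_nonempty _ _) (hle a ha h)
    rwa [le_div_iff_of_neg h] at this
  · rw [h, mul_zero]; exact hneg a ha h.le
  · exact (div_le_iff₀ h).1 (le_csSup hbdd (Or.inr ⟨a, ha, h, rfl⟩))

/-- The Lagrangian of the relaxed problem. -/
noncomputable def relaxedLagrangian (lam : ℝ) (S A : AngleCircle → ℝ) (F : AngleCircle → ℂ) : ℝ :=
  2 * relaxedRate A - lam * relaxedPower S A F

/-- Only a lower bound ties A to F, so the envelope may be enlarged freely. The rate is thus
unbounded without the constraint, which makes the multiplier nonzero. -/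
lemma IsAdmissible.scale {A : AngleCircle → ℝ} {F : AngleCircle → ℂ} (h : IsAdmissible A F)
    {c : ℝ} (hc : 1 ≤ c) : IsAdmissible (fun θ => c * A θ) F where
  memLp_env := h.memLp_env.const_mul c
  memLp_fun := h.memLp_fun
  pos := by filter_upwards [h.pos] with θ hθ; positivity
  norm_le := by
    filter_upwards [h.pos, h.norm_le] with θ h1 h2
    nlinarith
  log_integrable := by
    refine ((integrable_const (Real.log c)).add h.log_integrable).congr ?_
    filter_upwards [h.pos] with θ hθ
    rw [Real.log_mul (by positivity) hθ.ne', Pi.add_apply]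
  even := by filter_upwards [h.even] with θ hθ; rw [hθ]
  hermitian := h.hermitian
  causal := h.causal
  mean := h.mean

lemma relaxedRate_scale {A : AngleCircle → ℝ} {F : AngleCircle → ℂ} (h : IsAdmissible A F)
    {c : ℝ} (hc : 0 < c) : relaxedRate (fun θ => c * A θ) = Real.log c + relaxedRate A := by
  have h1 : relaxedRate (fun θ => c * A θ) = ∫ θ, (Real.log c + Real.log (A θ)) ∂μ := by
    refine integral_congr_ae ?_
    filter_upwards [h.pos] with θ hθ
    rw [Real.log_mul hc.ne' hθ.ne']
  rw [h1, integral_add (integrable_const _) h.log_integrable]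
  simp [relaxedRate]

/-! ### Multiplier, water-filling and stationarity -/

section Optimum

variable {S A : AngleCircle → ℝ} {F : AngleCircle → ℂ} {power : ℝ}

lemma exists_lagrange_multiplier (hS : IsNoiseSpectrum S) (hp : 0 < power)
    (h : IsAdmissible A F) (hpow : relaxedPower S A F ≤ power)
    (hopt : ∀ A' F', IsAdmissible A' F' → relaxedPower S A' F' ≤ power →
        relaxedRate A' ≤ relaxedRate A) :
    ∃ lam : ℝ, 0 < lam ∧ ∀ A' F', IsAdmissible A' F' →
      relaxedLagrangian lam S A' F' ≤ relaxedLagrangian lam S A F := by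
  obtain ⟨l, hl, hle⟩ := exists_multiplier (K := {a | ∃ A' F', IsAdmissible A' F' ∧
      a = (relaxedRate A' - relaxedRate A, relaxedPower S A' F' - power)}) (by
    rintro _ ⟨A₀, F₀, h₀, rfl⟩ _ ⟨A₁, F₁, h₁, rfl⟩ t ht0 ht1
    refine ⟨_, ⟨_, _, h₀.combo h₁ ht0 ht1, rfl⟩, ?_, ?_⟩
    · have := relaxedRate_combo_ge h₀ h₁ ht0 ht1
      simp only
      linarith
    · have := relaxedPower_combo_le hS h₀ h₁ ht0 ht1
      simp only
      linarith) (by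
    rintro _ ⟨A', F', h', rfl⟩ h2
    simp only [sub_nonpos] at h2 ⊢
    exact hopt A' F' h' h2)
    ⟨_, ⟨_, _, isAdmissible_one, rfl⟩, by simp only [relaxedPower_one]; linarith⟩
  have hle' : ∀ A' F', IsAdmissible A' F' →
      relaxedRate A' - relaxedRate A ≤ l * (relaxedPower S A' F' - power) :=
    fun A' F' h' => hle _ ⟨A', F', h', rfl⟩
  -- A zero multiplier would bound all rates by the optimal one, but scaling A by e raises the rate
  -- by 1.
  have hl0 : 0 < l := by
    refine lt_of_le_of_ne hl fun h0 => ?_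
    have h1 := hle' _ _ (h.scale (c := Real.exp 1) (by simp))
    rw [relaxedRate_scale h (Real.exp_pos 1), Real.log_exp, ← h0] at h1
    linarith
  -- The factor 2 matches the doubled rate in `relaxedLagrangian`.
  refine ⟨2 * l, by positivity, fun A' F' h' => ?_⟩
  have h1 := hle' A' F' h'
  have h2 := mul_le_mul_of_nonneg_left hpow hl
  simp only [relaxedLagrangian]
  nlinarith

/-- In the variable x² the function log x² − s x² is strictly concave, and the hypothesis is the
first-order condition for a maximum at b, tested in the direction of a. -/
lemma log_sq_gap {a b s : ℝ} (ha : 0 < a) (hb : 0 < b)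
    (h : 0 ≤ (b ^ 2 - a ^ 2) * (1 / b ^ 2 - s)) :
    0 ≤ (2 * Real.log b - s * b ^ 2) - (2 * Real.log a - s * a ^ 2) ∧
      ((2 * Real.log b - s * b ^ 2) - (2 * Real.log a - s * a ^ 2) = 0 → a = b) := by
  have hx : 0 < a ^ 2 / b ^ 2 := by positivity
  have h1 : Real.log (a ^ 2 / b ^ 2) = 2 * Real.log a - 2 * Real.log b := by
    rw [Real.log_div (by positivity) (by positivity), Real.log_pow, Real.log_pow]
    norm_num
  have h2 : (b ^ 2 - a ^ 2) * (1 / b ^ 2 - s) =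
      1 - a ^ 2 / b ^ 2 - s * (b ^ 2 - a ^ 2) := by
    field_simp
  have h3 := Real.log_le_sub_one_of_pos hx
  refine ⟨by linarith, fun h0 => ?_⟩
  by_contra hne
  have hx1 : a ^ 2 / b ^ 2 ≠ 1 := by
    rw [Ne, div_eq_one_iff_eq (by positivity)]
    intro h4
    exact hne ((pow_left_inj₀ ha.le hb.le two_ne_zero).1 h4)
  have h4 := Real.log_lt_sub_one_of_pos hx hx1
  linarith

lemma integrable_lagrangian (hS : Continuous S) (lam : ℝ) (h : IsAdmissible A F) :
    Integrable (fun θ => 2 * Real.log (A θ) - lam * ((A θ ^ 2 - 2 * (F θ).re + 1) * S θ)) μ :=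
  (h.log_integrable.const_mul 2).sub
    ((integrable_relaxedPower hS h.memLp_env h.memLp_fun).const_mul lam)

lemma relaxedLagrangian_eq (hS : Continuous S) (lam : ℝ) (h : IsAdmissible A F) :
    relaxedLagrangian lam S A F =
      ∫ θ, (2 * Real.log (A θ) - lam * ((A θ ^ 2 - 2 * (F θ).re + 1) * S θ)) ∂μ := by
  rw [integral_sub (h.log_integrable.const_mul 2)
    ((integrable_relaxedPower hS h.memLp_env h.memLp_fun).const_mul lam), integral_const_mul,
    integral_const_mul]
  rfl

lemma waterlevel_pos {lam s : ℝ} (hlam : 0 < lam) (hs : 0 < s) : 0 < 1 / √(lam * s) := by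
  positivity

lemma waterlevel_sq {lam s : ℝ} (hlam : 0 < lam) (hs : 0 < s) :
    (1 / √(lam * s)) ^ 2 = 1 / (lam * s) := by
  rw [div_pow, Real.sq_sqrt (by positivity), one_pow]

/-- A maximizer of the Lagrangian is given by water-filling. -/
lemma waterfilling (hS : IsNoiseSpectrum S) {lam : ℝ} (hlam : 0 < lam) (h : IsAdmissible A F)
    (hmax : ∀ A', IsAdmissible A' F →
      relaxedLagrangian lam S A' F ≤ relaxedLagrangian lam S A F) :
    ∀ᵐ θ ∂μ, A θ = max ‖F θ‖ (1 / √(lam * S θ)) := by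
  -- W θ is the unconstrained maximiser over a > 0 of 2 log a − lam S(θ) a². The constraint a ≥ ‖F
  -- θ‖ moves the maximiser to max ‖F θ‖ (W θ).
  set W : AngleCircle → ℝ := fun θ => 1 / √(lam * S θ) with hW
  have hWpos : ∀ θ, 0 < W θ := fun θ => waterlevel_pos hlam (hS.pos θ)
  have hWc : Continuous W := by
    refine continuous_const.div (continuous_const.mul hS.continuous).sqrt fun θ => ?_
    have := hS.pos θ
    positivity
  have hA' : IsAdmissible (fun θ => max ‖F θ‖ (W θ)) F := by
    have hmem : MemLp (fun θ => max ‖F θ‖ (W θ)) 2 μ := h.memLp_fun.norm.sup (hWc.memLp_circle 2)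
    have hpos : ∀ᵐ θ ∂μ, 0 < max ‖F θ‖ (W θ) :=
      ae_of_all _ fun θ => lt_max_of_lt_right (hWpos θ)
    refine ⟨hmem, h.memLp_fun, hpos, ae_of_all _ fun θ => le_max_left _ _, ?_, ?_, h.hermitian,
      h.causal, h.mean⟩
    · refine integrable_log_of_le hmem hpos
        (hWc.log fun θ => (hWpos θ).ne').integrable_circle (ae_of_all _ fun θ => ?_)
      exact Real.log_le_log (hWpos θ) (le_max_right _ _)
    · filter_upwards [h.hermitian] with θ hθ
      simp only [hW]
      rw [hθ, hS.even, Complex.norm_conj]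
  have hgap : ∀ᵐ θ ∂μ, 0 ≤ (2 * Real.log (max ‖F θ‖ (W θ)) - lam * S θ * max ‖F θ‖ (W θ) ^ 2) -
      (2 * Real.log (A θ) - lam * S θ * A θ ^ 2) ∧
      ((2 * Real.log (max ‖F θ‖ (W θ)) - lam * S θ * max ‖F θ‖ (W θ) ^ 2) -
      (2 * Real.log (A θ) - lam * S θ * A θ ^ 2) = 0 → A θ = max ‖F θ‖ (W θ)) := by
    filter_upwards [h.pos, h.norm_le] with θ h1 h2
    refine log_sq_gap h1 (lt_max_of_lt_right (hWpos θ)) ?_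
    have hsq := waterlevel_sq hlam (hS.pos θ)
    have hls : 0 < lam * S θ := mul_pos hlam (hS.pos θ)
    rcases le_total ‖F θ‖ (W θ) with h3 | h3
    · rw [max_eq_right h3, hW]
      simp only
      rw [hsq, one_div_one_div, sub_self, mul_zero]
    · rw [max_eq_left h3]
      have h4 : 1 / (lam * S θ) ≤ ‖F θ‖ ^ 2 := by
        rw [← hsq]
        exact pow_le_pow_left₀ (hWpos θ).le h3 2
      have h5 : 1 / ‖F θ‖ ^ 2 ≤ lam * S θ := by
        rw [one_div_le (lt_of_lt_of_le (by positivity) h4) hls]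
        exact h4
      have h6 : ‖F θ‖ ^ 2 ≤ A θ ^ 2 := pow_le_pow_left₀ (norm_nonneg _) h2 2
      exact mul_nonneg_of_nonpos_of_nonpos (by linarith) (by linarith)
  have hle := hmax _ hA'
  rw [relaxedLagrangian_eq hS.continuous lam hA', relaxedLagrangian_eq hS.continuous lam h,
    ← sub_nonpos, ← integral_sub (integrable_lagrangian hS.continuous lam hA')
    (integrable_lagrangian hS.continuous lam h)] at hle
  have hnn : 0 ≤ᵐ[μ] fun θ =>
      2 * Real.log (max ‖F θ‖ (W θ)) - lam * ((max ‖F θ‖ (W θ) ^ 2 - 2 * (F θ).re + 1) * S θ) -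
      (2 * Real.log (A θ) - lam * ((A θ ^ 2 - 2 * (F θ).re + 1) * S θ)) := by
    filter_upwards [hgap] with θ hθ
    refine hθ.1.trans (le_of_eq ?_)
    ring
  have hz := (integral_eq_zero_iff_of_nonneg_ae hnn
    ((integrable_lagrangian hS.continuous lam hA').sub
    (integrable_lagrangian hS.continuous lam h))).1
    (le_antisymm hle (integral_nonneg_of_ae hnn))
  filter_upwards [hgap, hz] with θ h1 h2
  refine h1.2 ?_
  rw [Pi.zero_apply] at h2
  rw [← h2]
  ring

lemma log_one_add_ge {x : ℝ} (hx : -(1 / 2) ≤ x) : x - 2 * x ^ 2 ≤ Real.log (1 + x) := by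
  have h0 : 0 < 1 + x := by linarith
  refine le_trans ?_ (Real.one_sub_inv_le_log_of_pos h0)
  rw [← sub_nonneg]
  have : 1 - (1 + x)⁻¹ - (x - 2 * x ^ 2) = x ^ 2 * (1 + 2 * x) / (1 + x) := by
    field_simp; ring
  rw [this]
  exact div_nonneg (mul_nonneg (sq_nonneg _) (by linarith)) h0.le

lemma eq_zero_of_forall_mul_le_sq {L C c : ℝ} (hc : 0 < c)
    (h : ∀ t : ℝ, |t| ≤ c → t * L ≤ C * t ^ 2) : L = 0 := by
  have h1 : ∀ t : ℝ, 0 < t → t ≤ c → |L| ≤ C * t := by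
    intro t ht htc
    have h2 := h t (by rwa [abs_of_pos ht])
    have h3 := h (-t) (by rwa [abs_neg, abs_of_pos ht])
    rw [abs_le]
    constructor <;> nlinarith
  have h2 : Tendsto (fun t : ℝ => C * t) (𝓝[>] 0) (𝓝 0) := by
    have : Tendsto (fun t : ℝ => C * t) (𝓝 0) (𝓝 (C * 0)) := tendsto_id.const_mul C
    rw [mul_zero] at this
    exact this.mono_left nhdsWithin_le_nhds
  have h3 : |L| ≤ 0 := by
    refine ge_of_tendsto h2 ?_
    filter_upwards [Ioc_mem_nhdsGT hc] with t ht using h1 t ht.1 ht.2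
  exact abs_eq_zero.1 (le_antisymm h3 (abs_nonneg _))

/-- The first-order condition of the relaxed problem: the strictly causal part of the gradient
vanishes. -/
lemma stationarity (hS : IsNoiseSpectrum S) {lam : ℝ} (h : IsAdmissible A F)
    {c : ℝ} (hc : 0 < c) (hAc : ∀ᵐ θ ∂μ, c ≤ A θ)
    (hmax : ∀ A' F', IsAdmissible A' F' →
      relaxedLagrangian lam S A' F' ≤ relaxedLagrangian lam S A F) (n : ℤ) (hn : 0 < n) :
    fourierCoeff (fun θ => ((lam * S θ - 1 / A θ ^ 2 : ℝ) : ℂ) * F θ - ((lam * S θ : ℝ) : ℂ)) n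
      = 0 := by
  set Y : AngleCircle → ℂ :=
    fun θ => ((lam * S θ - 1 / A θ ^ 2 : ℝ) : ℂ) * F θ - ((lam * S θ : ℝ) : ℂ) with hY
  have hlSc : Continuous fun θ => ((lam * S θ : ℝ) : ℂ) :=
    Complex.continuous_ofReal.comp (continuous_const.mul hS.continuous)
  have hinv : MemLp (fun θ => ((1 / A θ ^ 2 : ℝ) : ℂ)) ∞ μ := by
    refine memLp_top_of_bound (C := 1 / c ^ 2) ?_ ?_
    · exact ((h.memLp_env.aestronglyMeasurable.aemeasurable.pow_const 2).const_div
        1).complex_ofReal.aestronglyMeasurable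
    · filter_upwards [hAc] with θ hθ
      rw [Complex.norm_real, Real.norm_of_nonneg (by positivity)]
      gcongr
  have hYmem : MemLp Y 2 μ := by
    have h1 : MemLp (fun θ => ((lam * S θ : ℝ) : ℂ) * F θ) 2 μ :=
      memLp_continuous_mul hlSc h.memLp_fun
    have h2 : MemLp (fun θ => ((1 / A θ ^ 2 : ℝ) : ℂ) * F θ) 2 μ := h.memLp_fun.mul hinv
    refine ((h1.sub h2).sub (hlSc.memLp_circle 2)).ae_eq (ae_of_all _ fun θ => ?_)
    simp only [hY, Pi.sub_apply]
    push_cast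
    ring
  have hYint : Integrable Y μ := hYmem.integrable (by norm_num)
  have hYherm : IsHermitianFun Y := by
    filter_upwards [h.even, h.hermitian] with θ h1 h2
    simp only [hY]
    rw [h1, h2, hS.even]
    simp
  have hre : (fourierCoeff Y n).re = ∫ θ, (conj (Y θ) * unitPoint θ ^ n).re ∂μ := by
    rw [fourierCoeff_eq]
    have h1 := integral_re (integrable_zpow_mul hYint (-n))
    simp only [RCLike.re_eq_complex_re] at h1
    rw [← h1]
    congr 1 with θ
    rw [← Complex.conj_re, map_mul, map_zpow₀, conj_unitPoint, inv_zpow, zpow_neg, inv_inv,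
      mul_comm]
  have hYz : Integrable (fun θ => (conj (Y θ) * unitPoint θ ^ n).re) μ := by
    have h1 := (integrable_zpow_mul hYint (-n)).re
    refine h1.congr (ae_of_all _ fun θ => ?_)
    simp only [RCLike.re_eq_complex_re]
    rw [← Complex.conj_re, map_mul, map_zpow₀, conj_unitPoint, inv_zpow, zpow_neg, inv_inv,
      mul_comm]
  -- The Lagrangian has derivative −2 Re Ŷ(n) along F + t e^{inθ}. The remainder collects twice
  -- (3|t|/c)² from the logarithm and the t² S term of the power.
  have hmain : ∀ t : ℝ, |t| ≤ c / 8 → t * (-2 * (fourierCoeff Y n).re) ≤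
      (18 / c ^ 2 + |lam| * ∫ θ, S θ ∂μ) * t ^ 2 := by
    intro t ht
    have htc : |t| ≤ c / 8 := ht
    set Ft : AngleCircle → ℂ := fun θ => F θ + (t : ℂ) * unitPoint θ ^ n with hFt
    set d : AngleCircle → ℝ := fun θ => 2 * t * (conj (F θ) * unitPoint θ ^ n).re + t ^ 2 with hd
    have hnormFt : ∀ θ, ‖Ft θ‖ ^ 2 = ‖F θ‖ ^ 2 + d θ := by
      intro θ
      have h1 : ‖(t : ℂ) * unitPoint θ ^ n‖ ^ 2 = t ^ 2 := by
        rw [norm_mul, norm_zpow, norm_unitPoint, one_zpow, mul_one, Complex.norm_real,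
          Real.norm_eq_abs, sq_abs]
      have h2 := norm_add_sq_real (F θ) ((t : ℂ) * unitPoint θ ^ n)
      simp only [hFt, hd]
      rw [h2, h1, Complex.inner]
      have h3 : (conj (F θ) * ((t : ℂ) * unitPoint θ ^ n)).re =
          t * (conj (F θ) * unitPoint θ ^ n).re := by
        rw [mul_left_comm, Complex.re_ofReal_mul]
      have h4 : (t : ℂ) * unitPoint θ ^ n * conj (F θ) =
        conj (F θ) * ((t : ℂ) * unitPoint θ ^ n) := by ring
      simp only [h4, h3]
      ring
    -- A² is changed by the same amount as |F|², so the envelope constraint is preserved for both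
    -- signs of t whether or not it is active.
    set At : AngleCircle → ℝ := fun θ => √(A θ ^ 2 + d θ) with hAt
    have hdabs : ∀ᵐ θ ∂μ, |d θ| ≤ 3 * |t| / c * A θ ^ 2 ∧ c ≤ A θ := by
      filter_upwards [h.norm_le, hAc] with θ h1 h2
      refine ⟨?_, h2⟩
      have h3 : |(conj (F θ) * unitPoint θ ^ n).re| ≤ A θ := by
        refine (Complex.abs_re_le_norm _).trans ?_
        rw [norm_mul, norm_zpow, norm_unitPoint, one_zpow, mul_one, Complex.norm_conj]
        exact h1
      have h4 : |d θ| ≤ 2 * |t| * A θ + |t| ^ 2 := by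
        refine (abs_add_le _ _).trans ?_
        rw [abs_mul, abs_mul, abs_two, abs_pow]
        gcongr
      have h0 := abs_nonneg t
      have h5 : |t| ≤ A θ := by linarith
      have h6 : A θ ≤ A θ ^ 2 / c := by
        rw [le_div_iff₀ hc]; nlinarith
      calc |d θ| ≤ 2 * |t| * A θ + |t| ^ 2 := h4
        _ ≤ 3 * |t| * A θ := by nlinarith
        _ ≤ 3 * |t| * (A θ ^ 2 / c) := by gcongr
        _ = 3 * |t| / c * A θ ^ 2 := by ring
    have hratio : ∀ᵐ θ ∂μ, |d θ / A θ ^ 2| ≤ 3 * |t| / c ∧ c ≤ A θ := by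
      filter_upwards [hdabs] with θ h1
      refine ⟨?_, h1.2⟩
      have : 0 < A θ ^ 2 := pow_pos (lt_of_lt_of_le hc h1.2) 2
      rw [abs_div, abs_of_pos this, div_le_iff₀ this]
      exact h1.1
    -- The restriction |t| ≤ c/8 keeps the relative change d/A² within the range of
    -- `log_one_add_ge`.
    have ht2 : 3 * |t| / c ≤ 1 / 2 := by
      rw [div_le_iff₀ hc]; linarith
    have hpos2 : ∀ᵐ θ ∂μ, 0 < A θ ^ 2 + d θ ∧ 0 < A θ ∧
        A θ ^ 2 + d θ = A θ ^ 2 * (1 + d θ / A θ ^ 2) ∧ A θ ^ 2 / 2 ≤ A θ ^ 2 + d θ := by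
      filter_upwards [hratio] with θ h1
      have h2 : 0 < A θ := lt_of_lt_of_le hc h1.2
      have h3 : A θ ^ 2 + d θ = A θ ^ 2 * (1 + d θ / A θ ^ 2) := by field_simp
      have h4 := neg_abs_le (d θ / A θ ^ 2)
      have h5 : 1 / 2 ≤ 1 + d θ / A θ ^ 2 := by linarith [h1.1]
      have h6 : A θ ^ 2 / 2 ≤ A θ ^ 2 + d θ := by
        rw [h3]
        have : 0 < A θ ^ 2 := by positivity
        nlinarith
      exact ⟨lt_of_lt_of_le (half_pos (pow_pos h2 2)) h6, h2, h3, h6⟩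
    have hAtsq : ∀ᵐ θ ∂μ, At θ ^ 2 = A θ ^ 2 + d θ := by
      filter_upwards [hpos2] with θ h1
      exact Real.sq_sqrt h1.1.le
    have hFtmem : MemLp Ft 2 μ :=
      h.memLp_fun.add (((continuous_unitPoint_zpow n).memLp_circle 2).const_mul (t : ℂ))
    have hdint : Integrable d μ := by
      have h1 : Integrable (fun θ => ‖Ft θ‖ ^ 2 - ‖F θ‖ ^ 2) μ :=
        hFtmem.norm.integrable_sq.sub h.memLp_fun.norm.integrable_sq
      refine h1.congr (ae_of_all _ fun θ => ?_)
      simp only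
      rw [hnormFt]; ring
    have hAtmeas : AEStronglyMeasurable At μ :=
      (((h.memLp_env.aestronglyMeasurable.aemeasurable.pow_const 2).add
        hdint.aemeasurable).sqrt).aestronglyMeasurable
    have hAtmem : MemLp At 2 μ := by
      rw [memLp_two_iff_integrable_sq hAtmeas]
      refine (h.memLp_env.integrable_sq.add hdint).congr ?_
      filter_upwards [hAtsq] with θ h1
      rw [h1, Pi.add_apply]
    have hAtpos : ∀ᵐ θ ∂μ, 0 < At θ := by
      filter_upwards [hpos2] with θ h1
      exact Real.sqrt_pos.2 h1.1
    have hadm : IsAdmissible At Ft := by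
      refine ⟨hAtmem, hFtmem, hAtpos, ?_, ?_, ?_, ?_, ?_, ?_⟩
      · filter_upwards [h.norm_le, h.pos] with θ h1 h2
        refine Real.le_sqrt_of_sq_le ?_
        rw [hnormFt]
        gcongr
      · refine integrable_log_of_le hAtmem hAtpos (integrable_const (Real.log (c / 2))) ?_
        filter_upwards [hpos2, hAc] with θ h1 h2
        refine Real.log_le_log (by positivity) (Real.le_sqrt_of_sq_le ?_)
        nlinarith [h1.2.2.2]
      · filter_upwards [h.even, h.hermitian] with θ h1 h2
        simp only [hAt, hd]
        rw [h1, h2, unitPoint_neg]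
        congr 4
        rw [← Complex.conj_re, map_mul, map_zpow₀, Complex.conj_conj, Complex.conj_conj]
      · filter_upwards [h.hermitian] with θ h2
        simp only [hFt]
        rw [h2, unitPoint_neg]
        simp
      · intro m hm
        rw [hFt, fourierCoeff_add_fun (h.memLp_fun.integrable (by norm_num))
          ((continuous_unitPoint_zpow n).integrable_circle.const_mul _), fourierCoeff.const_mul,
          fourierCoeff_zpow, h.causal m hm, if_neg (by omega)]
        simp
      · rw [hFt, fourierCoeff_add_fun (h.memLp_fun.integrable (by norm_num))
          ((continuous_unitPoint_zpow n).integrable_circle.const_mul _), fourierCoeff.const_mul,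
          fourierCoeff_zpow, h.mean, if_neg (by omega)]
        simp
    have hle := hmax _ _ hadm
    rw [relaxedLagrangian_eq hS.continuous lam hadm, relaxedLagrangian_eq hS.continuous lam h,
      ← sub_nonpos, ← integral_sub (integrable_lagrangian hS.continuous lam hadm)
      (integrable_lagrangian hS.continuous lam h)] at hle
    have hSint := hS.continuous.integrable_circle
    have hlow : ∫ θ, (t * (-2 * (conj (Y θ) * unitPoint θ ^ n).re) -
        (18 / c ^ 2 * t ^ 2 + |lam| * t ^ 2 * S θ)) ∂μ ≤ 0 := by
      refine le_trans ?_ hle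
      refine integral_mono_ae ((((hYz.const_mul (-2)).const_mul t)).sub
        ((integrable_const _).add (hSint.const_mul _)))
        ((integrable_lagrangian hS.continuous lam hadm).sub
        (integrable_lagrangian hS.continuous lam h)) ?_
      filter_upwards [hratio, hpos2, hAtsq] with θ h1 h2 h3
      have hlog : 2 * Real.log (At θ) = 2 * Real.log (A θ) + Real.log (1 + d θ / A θ ^ 2) := by
        have h4 : 2 * Real.log (At θ) = Real.log (At θ ^ 2) := by rw [Real.log_pow]; norm_num
        have h5 : 2 * Real.log (A θ) = Real.log (A θ ^ 2) := by rw [Real.log_pow]; norm_num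
        have h6 : (1 + d θ / A θ ^ 2) ≠ 0 := by
          intro h7
          have := h2.1
          rw [h2.2.2.1, h7, mul_zero] at this
          exact lt_irrefl _ this
        have h7 := h2.2.1
        rw [h4, h5, h3, h2.2.2.1, Real.log_mul (by positivity) h6]
      have hlog2 : d θ / A θ ^ 2 - 18 / c ^ 2 * t ^ 2 ≤ Real.log (1 + d θ / A θ ^ 2) := by
        have h4 := neg_abs_le (d θ / A θ ^ 2)
        refine le_trans ?_ (log_one_add_ge (by linarith [h1.1]))
        have h5 : (d θ / A θ ^ 2) ^ 2 ≤ (3 * |t| / c) ^ 2 := by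
          rw [← sq_abs (d θ / A θ ^ 2)]
          exact pow_le_pow_left₀ (abs_nonneg _) h1.1 2
        have h6 : (3 * |t| / c) ^ 2 = 9 / c ^ 2 * t ^ 2 := by
          rw [div_pow, mul_pow, sq_abs]; ring
        have h7 : 18 / c ^ 2 * t ^ 2 = 2 * (9 / c ^ 2 * t ^ 2) := by ring
        rw [h7, ← h6]
        linarith
      have hYre : (conj (Y θ) * unitPoint θ ^ n).re =
          (lam * S θ - 1 / A θ ^ 2) * (conj (F θ) * unitPoint θ ^ n).re -
            lam * S θ * (unitPoint θ ^ n).re := by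
        simp only [hY, map_sub, map_mul, Complex.conj_ofReal]
        rw [sub_mul, mul_assoc, Complex.sub_re, Complex.re_ofReal_mul, Complex.re_ofReal_mul]
      have hFtre : (Ft θ).re = (F θ).re + t * (unitPoint θ ^ n).re := by
        simp only [hFt]
        rw [Complex.add_re, Complex.re_ofReal_mul]
      rw [hlog, h3, hYre, hFtre]
      have hSp := (hS.pos θ).le
      have h8 : lam * (t ^ 2 * S θ) ≤ |lam| * (t ^ 2 * S θ) :=
        mul_le_mul_of_nonneg_right (le_abs_self lam) (mul_nonneg (sq_nonneg t) hSp)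
      have h9 : 0 ≤ t ^ 2 / A θ ^ 2 := by positivity
      have h10 : d θ / A θ ^ 2 = 1 / A θ ^ 2 * (2 * t * (conj (F θ) * unitPoint θ ^ n).re) +
          t ^ 2 / A θ ^ 2 := by simp only [hd]; ring
      rw [h10] at hlog2 ⊢
      simp only [hd] at *
      linarith
    have e1 : Integrable (fun θ => t * (-2 * (conj (Y θ) * unitPoint θ ^ n).re)) μ :=
      (hYz.const_mul (-2)).const_mul t
    have e2 : Integrable (fun θ => 18 / c ^ 2 * t ^ 2 + |lam| * t ^ 2 * S θ) μ :=
      (integrable_const _).add (hSint.const_mul _)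
    rw [integral_sub e1 e2, integral_add (integrable_const _)
      (hSint.const_mul _), integral_const_mul, integral_const_mul, ← hre] at hlow
    have e3 : ∫ θ, |lam| * t ^ 2 * S θ ∂μ = |lam| * t ^ 2 * ∫ θ, S θ ∂μ := integral_const_mul _ _
    rw [e3] at hlow
    simp only [integral_const, probReal_univ, smul_eq_mul, one_mul] at hlow
    linarith
  have h1 := eq_zero_of_forall_mul_le_sq (by positivity : 0 < c / 8) hmain
  -- Real perturbations see only the real part; the imaginary part vanishes by Hermitian symmetry.
  refine Complex.ext (by simpa using h1) (hYherm.hasRealCoeffs n)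

end Optimum

/-! ### The Fejér–Riesz factorization -/

lemma reverse_reverse_of_coeff_zero_ne {p : ℝ[X]} (h : p.coeff 0 ≠ 0) :
    p.reverse.natDegree = p.natDegree ∧ p.reverse.reverse = p := by
  have h1 : p.reverse.natDegree = p.natDegree := by
    rw [reverse_natDegree, natTrailingDegree_eq_zero.2 (Or.inr h), Nat.sub_zero]
  refine ⟨h1, ?_⟩
  rw [reverse, h1, reverse, reflect_reflect]

lemma aeval_reflect_inv {p : ℝ[X]} {N : ℕ} (hp : p.natDegree ≤ N) {z : ℂ} (hz : z ≠ 0) :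
    aeval z (reflect N p) = z ^ N * aeval z⁻¹ p := by
  let _ : Invertible z⁻¹ := invertibleOfNonzero (inv_ne_zero hz)
  have h := eval₂_reflect_mul_pow (algebraMap ℝ ℂ) z⁻¹ N p hp
  rw [invOf_eq_inv, inv_inv] at h
  rw [aeval_def, aeval_def, ← h, inv_pow]
  field_simp

lemma conj_aeval (p : ℝ[X]) (z : ℂ) : conj (aeval z p) = aeval (conj z) p :=
  (aeval_conj p z).symm

lemma aeval_reflect_of_norm_eq_one {p : ℝ[X]} {N : ℕ} (hp : p.natDegree ≤ N) {z : ℂ}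
    (hz : ‖z‖ = 1) : aeval z (reflect N p) = z ^ N * conj (aeval z p) := by
  have hz0 : z ≠ 0 := by rintro rfl; simp at hz
  have : z⁻¹ = conj z := by rw [Complex.inv_def, Complex.normSq_eq_norm_sq, hz]; simp
  rw [aeval_reflect_inv hp hz0, conj_aeval, this]

/-- An irreducible real polynomial that divides its reverse has a root on the unit circle. -/
lemma exists_root_norm_one_of_dvd_reverse {q : ℝ[X]} (hq : Irreducible q) (h0 : q.coeff 0 ≠ 0)
    (hdvd : q ∣ q.reverse) : ∃ z : ℂ, ‖z‖ = 1 ∧ aeval z q = 0 := by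
  have hdeg : 0 < q.natDegree := hq.natDegree_pos
  obtain ⟨a, ha⟩ : ∃ a : ℂ, aeval a q = 0 :=
    IsAlgClosed.exists_aeval_eq_zero ℂ q (by
      rw [degree_eq_natDegree hq.ne_zero]; exact_mod_cast hdeg.ne')
  by_contra! hno
  have ha0 : a ≠ 0 := by
    rintro rfl
    rw [← coeff_zero_eq_aeval_zero'] at ha
    exact h0 (by simpa using ha)
  have hinv : aeval a⁻¹ q = 0 := by
    obtain ⟨w, hw⟩ := hdvd
    have h1 : aeval a q.reverse = 0 := by rw [hw, map_mul, ha, zero_mul]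
    rw [reverse, aeval_reflect_inv le_rfl ha0] at h1
    exact (mul_eq_zero.1 h1).resolve_left (pow_ne_zero _ ha0)
  have hconj : aeval (conj a) q = 0 := by rw [← conj_aeval, ha, map_zero]
  have hnorm : ‖a‖ ≠ 1 := fun h => hno a h ha
  -- A root a brings conj a and a⁻¹ with it. If a is real, q is linear and a⁻¹ = a; otherwise, off
  -- the circle, these are three distinct roots of a real irreducible polynomial, whose degree is at
  -- most 2.
  by_cases hreal : conj a = a
  · obtain ⟨r, rfl⟩ := Complex.conj_eq_iff_real.1 hreal
    have hr : ∀ s : ℝ, aeval (s : ℂ) q = 0 → q.eval s = 0 := fun s hs => by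
      have h1 : aeval (algebraMap ℝ ℂ s) q = 0 := hs
      rw [aeval_algebraMap_apply] at h1
      simpa using h1
    have h1 := hr r ha
    have h2 := hr r⁻¹ (by push_cast; exact hinv)
    have hr0 : r ≠ 0 := by rintro rfl; simp at ha0
    obtain ⟨c, hc⟩ := (dvd_iff_isRoot.2 h1)
    rcases hq.isUnit_or_isUnit hc with h3 | h3
    · exact not_isUnit_X_sub_C r h3
    · obtain ⟨b, hb, rfl⟩ := isUnit_iff.1 h3
      rw [hc, eval_mul, eval_C] at h2
      have h4 := (mul_eq_zero.1 h2).resolve_right hb.ne_zero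
      simp only [eval_sub, eval_X, eval_C] at h4
      have h5 : r * r = 1 := by
        have : r⁻¹ = r := by linarith
        nth_rw 1 [← this]
        exact inv_mul_cancel₀ hr0
      refine hnorm ?_
      rw [Complex.norm_real, Real.norm_eq_abs, ← sq_eq_sq₀ (abs_nonneg r) zero_le_one, sq_abs]
      linarith
  · have hne1 : a⁻¹ ≠ a := by
      intro h
      have h1 : a * a = 1 := by nth_rw 1 [← h]; exact inv_mul_cancel₀ ha0
      have h2 : ‖a‖ * ‖a‖ = 1 := by rw [← norm_mul, h1, norm_one]
      exact hnorm (by nlinarith [norm_nonneg a])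
    have hne2 : a⁻¹ ≠ conj a := by
      intro h
      have h1 : ‖a‖⁻¹ = ‖a‖ := by rw [← norm_inv, h, Complex.norm_conj]
      have h2 : ‖a‖ * ‖a‖ = 1 := by
        nth_rw 1 [← h1]; exact inv_mul_cancel₀ (norm_ne_zero_iff.2 ha0)
      exact hnorm (by nlinarith [norm_nonneg a])
    have hsub : ({a, conj a, a⁻¹} : Finset ℂ) ⊆ (q.map (algebraMap ℝ ℂ)).roots.toFinset := by
      intro z hz
      have hq0 : q.map (algebraMap ℝ ℂ) ≠ 0 := by
        rw [Ne, Polynomial.map_eq_zero]; exact hq.ne_zero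
      rw [Multiset.mem_toFinset, mem_roots hq0, IsRoot, eval_map_algebraMap]
      simp only [Finset.mem_insert, Finset.mem_singleton] at hz
      rcases hz with rfl | rfl | rfl
      exacts [ha, hconj, hinv]
    have hcard : ({a, conj a, a⁻¹} : Finset ℂ).card = 3 := by
      rw [Finset.card_eq_three]
      exact ⟨a, conj a, a⁻¹, Ne.symm hreal, hne1.symm, hne2.symm, rfl⟩
    have h1 := (Finset.card_le_card hsub).trans
      ((Multiset.toFinset_card_le _).trans (card_roots' _))
    rw [hcard, natDegree_map] at h1
    have := hq.natDegree_le_two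
    omega

/-- An irreducible factor q of t divides t.reverse = q.reverse * s.reverse. It cannot divide its own
reverse, since t has no zero on the circle, so it divides s.reverse. Thus q * q.reverse splits off
t, the cofactor is again self-reciprocal, and induction on the degree stays over ℝ. -/
lemma exists_eq_mul_reverse_of_reverse_eq (n : ℕ) : ∀ t : ℝ[X], t.natDegree = n →
    t.reverse = t → t.coeff 0 ≠ 0 → (∀ z : ℂ, ‖z‖ = 1 → aeval z t ≠ 0) →
    ∃ (c : ℝ) (R : ℝ[X]), t = C c * (R * R.reverse) ∧ R.coeff 0 ≠ 0 := by
  induction n using Nat.strong_induction_on with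
  | _ n ih =>
    intro t htn hrev h0 hcirc
    rcases Nat.eq_zero_or_pos n with rfl | hn
    · refine ⟨t.coeff 0, 1, ?_, by simp⟩
      rw [show (1 : ℝ[X]) = C 1 from C_1.symm, reverse_C, C_1, mul_one, mul_one]
      exact eq_C_of_natDegree_eq_zero htn
    · have ht0 : t ≠ 0 := by rintro rfl; simp at h0
      have hnu : ¬ IsUnit t := fun h => by
        have := natDegree_eq_zero_of_isUnit h
        omega
      obtain ⟨q, hq, s, hs⟩ := WfDvdMonoid.exists_irreducible_factor hnu ht0
      have hqs : q.coeff 0 * s.coeff 0 ≠ 0 := by rwa [← mul_coeff_zero, ← hs]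
      have hq0 := left_ne_zero_of_mul hqs
      have hs0 := right_ne_zero_of_mul hqs
      have hndvd : ¬ q ∣ q.reverse := fun h => by
        obtain ⟨z, hz1, hz2⟩ := exists_root_norm_one_of_dvd_reverse hq hq0 h
        exact hcirc z hz1 (by rw [hs, map_mul, hz2, zero_mul])
      have hqd : q ∣ q.reverse * s.reverse := by
        rw [← reverse_mul_of_domain, ← hs, hrev]
        exact ⟨s, hs⟩
      obtain ⟨w, hw⟩ := (hq.prime.dvd_or_dvd hqd).resolve_left hndvd
      have hs2 : s = q.reverse * w.reverse := by
        rw [← (reverse_reverse_of_coeff_zero_ne hs0).2, hw, reverse_mul_of_domain]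
      have hw0 : w ≠ 0 := by
        rintro rfl
        rw [reverse_zero, mul_zero] at hs2
        simp [hs2] at hs0
      have ht' : t = q * q.reverse * w.reverse := by rw [hs, hs2, mul_assoc]
      have hw'0 : w.reverse.coeff 0 ≠ 0 := by
        rw [coeff_zero_reverse]; exact leadingCoeff_ne_zero.2 hw0
      have hqr0 : q.reverse ≠ 0 := by rw [Ne, reverse_eq_zero]; exact hq.ne_zero
      have hwrev : w.reverse.reverse = w.reverse := by
        have h1 : t.reverse = q.reverse * q * w.reverse.reverse := by
          rw [ht', reverse_mul_of_domain, reverse_mul_of_domain,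
            (reverse_reverse_of_coeff_zero_ne hq0).2]
        rw [hrev, ht', mul_comm q.reverse q] at h1
        exact (mul_left_cancel₀ (mul_ne_zero hq.ne_zero hqr0) h1).symm
      have hdeg : w.reverse.natDegree < n := by
        have h1 : t.natDegree = q.natDegree + q.reverse.natDegree + w.reverse.natDegree := by
          rw [ht', natDegree_mul (mul_ne_zero hq.ne_zero hqr0) (by rintro h; simp [h] at hw'0),
            natDegree_mul hq.ne_zero hqr0]
        have := hq.natDegree_pos
        omega
      obtain ⟨c, R, hR, hR0⟩ := ih _ hdeg w.reverse rfl hwrev hw'0 fun z hz h => by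
        exact hcirc z hz (by rw [ht', map_mul, h, mul_zero])
      refine ⟨c, q * R, ?_, ?_⟩
      · rw [ht', hR, reverse_mul_of_domain]; ring
      · rw [mul_coeff_zero]; exact mul_ne_zero hq0 hR0

/-- The **Fejér–Riesz factorization** of a self-reciprocal real polynomial without zeros on the
unit circle. -/
theorem fejer_riesz (k : ℕ) : ∀ t : ℝ[X], t.natDegree ≤ 2 * k → reflect (2 * k) t = t →
    (∀ z : ℂ, ‖z‖ = 1 → aeval z t ≠ 0) →
    ∃ (σ : ℝ) (R : ℝ[X]), 0 < σ ∧ R.coeff 0 = 1 ∧ R.natDegree ≤ k ∧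
      ∀ z : ℂ, ‖z‖ = 1 → ‖aeval z t‖ = σ ^ 2 * ‖aeval z R‖ ^ 2 := by
  induction k with
  | zero =>
    intro t hdeg _ hcirc
    obtain ⟨c, rfl⟩ : ∃ c, t = C c := ⟨_, eq_C_of_natDegree_le_zero (by simpa using hdeg)⟩
    have h1 := hcirc 1 (by simp)
    simp only [aeval_C, Complex.coe_algebraMap] at h1 ⊢
    refine ⟨√|c|, 1, Real.sqrt_pos.2 (abs_pos.2 (by exact_mod_cast h1)), by simp, by simp,
      fun z _ => ?_⟩
    rw [Real.sq_sqrt (abs_nonneg _)]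
    simp
  | succ k ih =>
    intro t hdeg hrefl hcirc
    have hcoeff : ∀ i, i ≤ 2 * (k + 1) → t.coeff (2 * (k + 1) - i) = t.coeff i := fun i hi => by
      conv_rhs => rw [← hrefl, coeff_reflect, revAt_le hi]
    -- If the constant coefficient vanishes, so does the one of index 2(k + 1) by symmetry; removing
    -- a factor X lowers the centre of symmetry by one.
    by_cases h0 : t.coeff 0 = 0
    · obtain ⟨s, hs⟩ := X_dvd_iff.2 h0
      have htop : t.coeff (2 * (k + 1)) = 0 := by rw [← h0, ← hcoeff 0 (Nat.zero_le _)]; rfl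
      have hsc : ∀ i, s.coeff i = t.coeff (i + 1) := fun i => by rw [hs, coeff_X_mul]
      have hsdeg : s.natDegree ≤ 2 * k := by
        rw [natDegree_le_iff_coeff_eq_zero]
        intro i hi
        rw [hsc]
        rcases Nat.lt_or_ge (i + 1) (2 * (k + 1)) with h1 | h1
        · omega
        · rcases h1.eq_or_lt with h2 | h2
          · rw [← h2]; exact htop
          · exact coeff_eq_zero_of_natDegree_lt (by omega)
      have hsrefl : reflect (2 * k) s = s := by
        ext i
        rw [coeff_reflect]
        rcases le_or_gt i (2 * k) with hi | hi
        · rw [revAt_le hi, hsc, hsc, ← hcoeff (i + 1) (by omega)]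
          congr 1
          omega
        · rw [revAt_eq_self_of_lt hi]
      obtain ⟨σ, R, h1, h2, h3, h4⟩ := ih s hsdeg hsrefl fun z hz h =>
        hcirc z hz (by rw [hs, map_mul, h, mul_zero])
      refine ⟨σ, R, h1, h2, h3.trans (Nat.le_succ k), fun z hz => ?_⟩
      rw [hs, map_mul, norm_mul, aeval_X, hz, one_mul, h4 z hz]
    · have htop : t.coeff (2 * (k + 1)) ≠ 0 := by
        have := hcoeff 0 (Nat.zero_le _)
        rw [Nat.sub_zero] at this
        rwa [this]
      have hnat : t.natDegree = 2 * (k + 1) := le_antisymm hdeg (le_natDegree_of_ne_zero htop)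
      have hrev : t.reverse = t := by rw [reverse, hnat, hrefl]
      obtain ⟨c, R, hR, hR0⟩ := exists_eq_mul_reverse_of_reverse_eq _ t rfl hrev h0 hcirc
      have hRn0 : R ≠ 0 := by rintro rfl; simp at hR0
      have hc0 : c ≠ 0 := by
        rintro rfl
        rw [C_0, zero_mul] at hR
        simp [hR] at h0
      have hRdeg : R.natDegree ≤ k + 1 := by
        have h1 : t.natDegree = R.natDegree + R.natDegree := by
          rw [hR, natDegree_C_mul hc0, natDegree_mul hRn0 (by rwa [Ne, reverse_eq_zero]),
            (reverse_reverse_of_coeff_zero_ne hR0).1]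
        omega
      -- Only moduli are compared, so the sign of c is immaterial, and σ absorbs the normalisation
      -- of R.
      refine ⟨√|c| * |R.coeff 0|, C (R.coeff 0)⁻¹ * R, ?_, ?_, ?_, fun z hz => ?_⟩
      · exact mul_pos (Real.sqrt_pos.2 (abs_pos.2 hc0)) (abs_pos.2 hR0)
      · rw [coeff_C_mul, inv_mul_cancel₀ hR0]
      · exact (natDegree_C_mul_le _ _).trans hRdeg
      · have h1 : ‖aeval z R.reverse‖ = ‖aeval z R‖ := by
          rw [reverse, aeval_reflect_of_norm_eq_one le_rfl hz, norm_mul, norm_pow, hz, one_pow,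
            one_mul, Complex.norm_conj]
        conv_lhs => rw [hR]
        simp only [map_mul, aeval_C, Complex.coe_algebraMap, norm_mul, Complex.norm_real, h1,
          mul_pow, Real.sq_sqrt (abs_nonneg c), norm_inv, Real.norm_eq_abs]
        have : |R.coeff 0| ≠ 0 := abs_ne_zero.2 hR0
        field_simp

/-! ### Causal functions with rational equations have rapidly decaying coefficients -/

/-- Geometric decay of a sequence. -/
def HasGeometricDecay (g : ℕ → ℂ) : Prop :=
  ∃ C ρ : ℝ, 0 ≤ C ∧ 0 < ρ ∧ ρ < 1 ∧ ∀ n, ‖g n‖ ≤ C * ρ ^ n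

lemma HasGeometricDecay.summable {g : ℕ → ℂ} (h : HasGeometricDecay g) : Summable g := by
  obtain ⟨C, ρ, _, hρ0, hρ1, hle⟩ := h
  exact Summable.of_norm_bounded ((summable_geometric_of_lt_one hρ0.le hρ1).mul_left C) hle

lemma hasGeometricDecay_of_eventually_zero {g : ℕ → ℂ} {N : ℕ} (h : ∀ n, N < n → g n = 0) :
    HasGeometricDecay g := by
  refine ⟨∑ i ∈ Finset.range (N + 1), ‖g i‖ * 2 ^ i, 1 / 2,
    Finset.sum_nonneg fun i _ => by positivity, by norm_num, by norm_num, fun n => ?_⟩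
  rcases Nat.lt_or_ge N n with hn | hn
  · rw [h n hn, norm_zero]
    exact mul_nonneg (Finset.sum_nonneg fun i _ => by positivity) (by positivity)
  · have h1 : ‖g n‖ * 2 ^ n ≤ ∑ i ∈ Finset.range (N + 1), ‖g i‖ * 2 ^ i :=
      Finset.single_le_sum (f := fun i => ‖g i‖ * 2 ^ i) (fun i _ => by positivity)
        (Finset.mem_range.2 (by omega))
    rw [one_div, inv_pow, ← div_eq_mul_inv, le_div_iff₀ (by positivity)]
    exact h1

/-- If `(z - a) g` has geometrically decaying coefficients and `g n → 0`, so does `g`. -/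
lemma HasGeometricDecay.of_mul_sub {g h : ℕ → ℂ} {a : ℂ} (hg : Tendsto g atTop (𝓝 0))
    (hrec : ∀ n, h (n + 1) = g n - a * g (n + 1)) (hh : HasGeometricDecay h) :
    HasGeometricDecay g := by
  obtain ⟨C, ρ, hC, hρ0, hρ1, hle⟩ := hh
  rcases le_or_gt ‖a‖ 1 with ha | ha
  -- For |a| ≤ 1 the recursion is solved backwards from infinity, where g tends to 0.
  · refine ⟨C / (1 - ρ), ρ, div_nonneg hC (by linarith), hρ0, hρ1, fun n => ?_⟩
    have hstep : ∀ m, ‖g n‖ ≤ ‖g (n + m)‖ + ∑ i ∈ Finset.range m, C * ρ ^ (n + i) := by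
      intro m
      induction m with
      | zero => simp
      | succ m ih =>
        have h1 : g (n + m) = h (n + m + 1) + a * g (n + m + 1) := by rw [hrec]; ring
        have h2 : ‖g (n + m)‖ ≤ C * ρ ^ (n + m) + ‖g (n + (m + 1))‖ := by
          rw [h1]
          refine (norm_add_le _ _).trans (add_le_add ?_ ?_)
          · refine (hle _).trans (mul_le_mul_of_nonneg_left ?_ hC)
            exact pow_le_pow_of_le_one hρ0.le hρ1.le (Nat.le_succ _)
          · rw [norm_mul]
            exact mul_le_of_le_one_left (norm_nonneg _) ha
        rw [Finset.sum_range_succ]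
        linarith
    have hsum : ∀ m, ∑ i ∈ Finset.range m, C * ρ ^ (n + i) ≤ C / (1 - ρ) * ρ ^ n := by
      intro m
      have h1 : ∑ i ∈ Finset.range m, C * ρ ^ (n + i) =
          C * ρ ^ n * ∑ i ∈ Finset.range m, ρ ^ i := by
        rw [Finset.mul_sum]
        exact Finset.sum_congr rfl fun i _ => by rw [pow_add]; ring
      have h2 : ∑ i ∈ Finset.range m, ρ ^ i ≤ (1 - ρ)⁻¹ := by
        rw [← tsum_geometric_of_lt_one hρ0.le hρ1]
        exact (summable_geometric_of_lt_one hρ0.le hρ1).sum_le_tsum _ fun i _ => by positivity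
      rw [h1]
      calc C * ρ ^ n * ∑ i ∈ Finset.range m, ρ ^ i ≤ C * ρ ^ n * (1 - ρ)⁻¹ := by gcongr
        _ = C / (1 - ρ) * ρ ^ n := by ring
    have hlim : Tendsto (fun m => ‖g (n + m)‖ + C / (1 - ρ) * ρ ^ n) atTop
        (𝓝 (0 + C / (1 - ρ) * ρ ^ n)) := by
      have h1 := (hg.comp (tendsto_add_atTop_nat n)).norm
      rw [norm_zero] at h1
      refine (h1.congr fun m => ?_).add_const _
      simp [add_comm]
    rw [zero_add] at hlim
    exact ge_of_tendsto' hlim fun m => (hstep m).trans (by linarith [hsum m])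
  -- For |a| > 1 the recursion is solved forwards, at a rate r strictly between max(ρ, 1/|a|) and 1.
  -- The constant D is chosen so that C r ≤ D (r|a| − 1) closes the induction.
  · have ha0 : 0 < ‖a‖ := by linarith
    have hinv : ‖a‖⁻¹ < 1 := inv_lt_one_of_one_lt₀ ha
    obtain ⟨r, hr1, hr2⟩ := exists_between (max_lt hρ1 hinv)
    have hrρ : ρ < r := (le_max_left _ _).trans_lt hr1
    have hra : ‖a‖⁻¹ < r := (le_max_right _ _).trans_lt hr1
    have hr0 : 0 < r := hρ0.trans hrρ
    have hra' : 1 < r * ‖a‖ := by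
      rw [inv_lt_iff_one_lt_mul₀ ha0] at hra; exact hra
    set D := max ‖g 0‖ (C * r / (r * ‖a‖ - 1)) with hD
    have hD0 : 0 ≤ D := (norm_nonneg _).trans (le_max_left _ _)
    refine ⟨D, r, hD0, hr0, hr2, fun n => ?_⟩
    induction n with
    | zero => rw [pow_zero, mul_one]; exact le_max_left _ _
    | succ n ih =>
      have h1 : a * g (n + 1) = g n - h (n + 1) := by rw [hrec]; ring
      have h2 : ‖a‖ * ‖g (n + 1)‖ ≤ D * r ^ n + C * r ^ (n + 1) := by
        rw [← norm_mul, h1]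
        refine (norm_sub_le _ _).trans (add_le_add ih ((hle _).trans ?_))
        gcongr
      have h3 : C * r ≤ D * (r * ‖a‖ - 1) := by
        rw [← div_le_iff₀ (by linarith)]
        exact le_max_right _ _
      have h4 : D * r ^ n + C * r ^ (n + 1) ≤ ‖a‖ * (D * r ^ (n + 1)) := by
        have := mul_le_mul_of_nonneg_right h3 (pow_nonneg hr0.le n)
        rw [pow_succ]
        nlinarith
      exact le_of_mul_le_mul_left (h2.trans h4) ha0

lemma tendsto_fourierCoeff_nat {f : AngleCircle → ℂ} (hf : MemLp f 2 μ) :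
    Tendsto (fun n : ℕ => fourierCoeff f n) atTop (𝓝 0) := by
  have h1 := (hasSum_sq_fourierCoeff hf.toLp).summable
  rw [fourierCoeff_congr_ae hf.coeFn_toLp] at h1
  have h2 := (h1.comp_injective (Nat.cast_injective (R := ℤ))).tendsto_atTop_zero
  have h3 := (Real.continuous_sqrt.tendsto _).comp h2
  rw [Real.sqrt_zero] at h3
  refine tendsto_zero_iff_norm_tendsto_zero.2 (h3.congr fun n => ?_)
  simp [Real.sqrt_sq]

/-- A causal square integrable solution `f` of `v f = h`, with `v` a nonzero polynomial and `h` with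
geometrically decaying coefficients, has geometrically decaying coefficients. -/
lemma hasGeometricDecay_of_eval_mul (d : ℕ) : ∀ (v : ℂ[X]) (f : AngleCircle → ℂ),
    v.natDegree = d → v ≠ 0 → MemLp f 2 μ → (∀ n : ℤ, n < 0 → fourierCoeff f n = 0) →
    HasGeometricDecay (fun n : ℕ => fourierCoeff (fun θ => v.eval (unitPoint θ) * f θ) n) →
    HasGeometricDecay (fun n : ℕ => fourierCoeff f n) := by
  induction d with
  | zero =>
    intro v f hd hv hf _ hdec
    obtain ⟨c, rfl⟩ : ∃ c, v = C c := ⟨_, eq_C_of_natDegree_eq_zero hd⟩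
    have hc : c ≠ 0 := by rintro rfl; simp at hv
    obtain ⟨D, ρ, h1, h2, h3, h4⟩ := hdec
    refine ⟨‖c‖⁻¹ * D, ρ, by positivity, h2, h3, fun n => ?_⟩
    have h5 := h4 n
    simp only [eval_C] at h5
    rw [fourierCoeff.const_mul, norm_mul] at h5
    have h6 : 0 < ‖c‖ := norm_pos_iff.2 hc
    rw [mul_assoc, ← div_eq_inv_mul, le_div_iff₀ h6, mul_comm]
    exact h5
  | succ d ih =>
    intro v f hd hv hf hcausal hdec
    -- One root is peeled off at a time. Its position is arbitrary, even on the unit circle, because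
    -- square summability makes the coefficients of f tend to 0.
    obtain ⟨a, ha⟩ : ∃ a, v.IsRoot a := IsAlgClosed.exists_root v (by
      rw [degree_eq_natDegree hv, hd]; exact_mod_cast Nat.succ_ne_zero d)
    obtain ⟨w, rfl⟩ := dvd_iff_isRoot.2 ha
    have hw : w ≠ 0 := right_ne_zero_of_mul hv
    have hwd : w.natDegree = d := by
      rw [natDegree_mul (X_sub_C_ne_zero a) hw, natDegree_X_sub_C] at hd
      omega
    have hfi : Integrable f μ := hf.integrable (by norm_num)
    obtain ⟨l, hl⟩ : ∃ l : ℂ[X], l = X - C a := ⟨_, rfl⟩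
    rw [← hl] at hdec
    have hcoeff : ∀ n : ℤ, fourierCoeff (fun θ => l.eval (unitPoint θ) * f θ) n =
        fourierCoeff f (n - 1) - a * fourierCoeff f n := by
      intro n
      have h1 : (fun θ => l.eval (unitPoint θ) * f θ) =
          fun θ => unitPoint θ ^ (1 : ℤ) * f θ - a * f θ := by
        ext θ; simp [hl, sub_mul]
      rw [h1, fourierCoeff_sub_fun (integrable_zpow_mul hfi 1) (hfi.const_mul a),
        fourierCoeff_zpow_mul, fourierCoeff.const_mul]
    have h1 := ih w (fun θ => l.eval (unitPoint θ) * f θ) hwd hw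
      (memLp_continuous_mul (continuous_eval_unitPoint l) hf) (fun n hn => by
        rw [hcoeff, hcausal n hn, hcausal (n - 1) (by omega)]; simp) (by
        have h2 : (fun θ => w.eval (unitPoint θ) * (l.eval (unitPoint θ) * f θ)) =
            fun θ => (l * w).eval (unitPoint θ) * f θ := by
          funext θ
          rw [eval_mul]
          ring
        rw [h2]
        exact hdec)
    refine HasGeometricDecay.of_mul_sub (a := a) (tendsto_fourierCoeff_nat hf) (fun n => ?_) h1
    rw [hcoeff]
    push_cast
    rw [add_sub_cancel_right]

/-! ### Rational spectra -/

lemma exists_unitPoint_eq {z : ℂ} (hz : ‖z‖ = 1) : ∃ θ, unitPoint θ = z := by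
  refine ⟨(Complex.arg z : ℝ), ?_⟩
  rw [unitPoint_coe, circleMap]
  have := Complex.norm_mul_exp_arg_mul_I z
  rw [hz] at this
  simpa using this

lemma IsStable.ne_zero_of_norm_eq_one {P : ℝ[X]} (hP : IsStable P) (θ : AngleCircle) :
    aeval (unitPoint θ) P ≠ 0 := fun h => by
  have := hP _ h
  rw [norm_unitPoint] at this
  exact lt_irrefl _ this

lemma continuous_aeval_unitPoint (P : ℝ[X]) : Continuous fun θ => aeval (unitPoint θ) P :=
  (Polynomial.continuous_aeval P).comp continuous_unitPoint

lemma rationalSpectrum_eq (P Q : ℝ[X]) (θ : AngleCircle) : rationalSpectrum P Q θ =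
    ‖aeval (unitPoint θ) P‖ ^ 2 / ‖aeval (unitPoint θ) Q‖ ^ 2 := by
  rw [rationalSpectrum, norm_div, div_pow]

lemma isNoiseSpectrum_rationalSpectrum {P Q : ℝ[X]} (hP : IsStable P) (hQ : IsStable Q) :
    IsNoiseSpectrum (rationalSpectrum P Q) where
  continuous := ((continuous_aeval_unitPoint P).div (continuous_aeval_unitPoint Q)
    hQ.ne_zero_of_norm_eq_one).norm.pow 2
  pos θ := pow_pos (norm_pos_iff.2 (div_ne_zero (hP.ne_zero_of_norm_eq_one θ)
    (hQ.ne_zero_of_norm_eq_one θ))) 2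
  even θ := by
    rw [rationalSpectrum_eq, rationalSpectrum_eq, unitPoint_neg, ← conj_aeval, ← conj_aeval,
      Complex.norm_conj, Complex.norm_conj]

/-- On the circle conj P(z) is z^(-k) times the reflection of P. This turns identities between
squared moduli into polynomial ones. -/
lemma aeval_mul_reflect {P : ℝ[X]} {k : ℕ} (hP : P.natDegree ≤ k) (θ : AngleCircle) :
    aeval (unitPoint θ) (P * reflect k P) =
      unitPoint θ ^ k * ((‖aeval (unitPoint θ) P‖ ^ 2 : ℝ) : ℂ) := by
  rw [map_mul, aeval_reflect_of_norm_eq_one hP (norm_unitPoint θ), mul_left_comm, Complex.mul_conj,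
    Complex.normSq_eq_norm_sq]

lemma natDegree_mul_reflect_le {P : ℝ[X]} {k : ℕ} (hP : P.natDegree ≤ k) :
    (P * reflect k P).natDegree ≤ 2 * k := by
  refine natDegree_mul_le.trans ?_
  have := (natDegree_reflect_le (N := k) (p := P)).trans (max_le le_rfl hP)
  omega

lemma fourierCoeff_aeval_mul_eq_zero (v : ℝ[X]) {D : ℕ} (hv : v.natDegree ≤ D)
    {f : AngleCircle → ℂ} (hf : Integrable f μ) {N : ℤ} (h : ∀ n, N < n → fourierCoeff f n = 0)
    (n : ℤ) (hn : N + D < n) : fourierCoeff (fun θ => aeval (unitPoint θ) v * f θ) n = 0 := by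
  have h1 : (fun θ => aeval (unitPoint θ) v * f θ) =
      fun θ => (v.map (algebraMap ℝ ℂ)).eval (unitPoint θ) * f θ := by
    ext θ; rw [eval_map_algebraMap]
  rw [h1, fourierCoeff_eval_mul _ hf]
  refine Finset.sum_eq_zero fun i hi => ?_
  rw [natDegree_map, Finset.mem_range] at hi
  rw [h _ (by omega), mul_zero]

/-- |Q|² is a trigonometric polynomial of degree at most k, so it raises the top of a spectrum by at
most k. -/
lemma fourierCoeff_normSq_mul_eq_zero {Q : ℝ[X]} {k : ℕ} (hQ : Q.natDegree ≤ k)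
    {f : AngleCircle → ℂ} (hf : Integrable f μ) {N : ℤ} (h : ∀ n, N < n → fourierCoeff f n = 0)
    (n : ℤ) (hn : N + k < n) :
    fourierCoeff (fun θ => ((‖aeval (unitPoint θ) Q‖ ^ 2 : ℝ) : ℂ) * f θ) n = 0 := by
  have h1 := fourierCoeff_aeval_mul_eq_zero _ (natDegree_mul_reflect_le hQ) hf h (n + k)
    (by push_cast; omega)
  have h2 : (fun θ => aeval (unitPoint θ) (Q * reflect k Q) * f θ) =
      fun θ => unitPoint θ ^ (k : ℤ) * (((‖aeval (unitPoint θ) Q‖ ^ 2 : ℝ) : ℂ) * f θ) := by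
    ext θ; rw [aeval_mul_reflect hQ, zpow_natCast]; ring
  rwa [h2, fourierCoeff_zpow_mul, add_sub_cancel_right] at h1

lemma fourierCoeff_conj (f : AngleCircle → ℂ) (n : ℤ) :
    fourierCoeff (fun θ => conj (f θ)) n = conj (fourierCoeff f (-n)) := by
  rw [fourierCoeff_eq, fourierCoeff_eq, ← integral_conj]
  congr 1 with θ
  rw [map_mul, map_zpow₀, conj_unitPoint, inv_zpow', neg_neg]

lemma fourierCoeff_neg_of_real (f : AngleCircle → ℝ) (n : ℤ) :
    fourierCoeff (fun θ => (f θ : ℂ)) (-n) = conj (fourierCoeff (fun θ => (f θ : ℂ)) n) := by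
  have := fourierCoeff_conj (fun θ => (f θ : ℂ)) (-n)
  simpa using this

/-- A continuous noise spectrum whose Fourier coefficients of positive index vanish is constant. -/
lemma IsNoiseSpectrum.eq_const {S : AngleCircle → ℝ} (hS : IsNoiseSpectrum S)
    (h : ∀ n : ℤ, 0 < n → fourierCoeff (fun θ => (S θ : ℂ)) n = 0) : ∃ s, ∀ θ, S θ = s := by
  have hc : Continuous fun θ => (S θ : ℂ) := Complex.continuous_ofReal.comp hS.continuous
  have h1 := ae_eq_eval_of_fourierCoeff hc.integrable_circle 0 (fun n hn => by
    rw [← neg_neg n, fourierCoeff_neg_of_real, h (-n) (by omega), map_zero]) (fun n hn => by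
    exact h n (by simpa using hn))
  have h2 := (hc.ae_eq_iff_eq μ (continuous_eval_unitPoint _)).1 h1
  refine ⟨(fourierCoeff (fun θ => (S θ : ℂ)) 0).re, fun θ => ?_⟩
  have h3 := congrFun h2 θ
  simp only [zero_add, Finset.range_one, Finset.sum_singleton, Nat.cast_zero, pow_zero, mul_one,
    eval_C] at h3
  rw [← h3, Complex.ofReal_re]

/-- A real even integrable function with spectrum in `[-k, k]` is a self-reciprocal polynomial up
to a monomial factor. -/
lemma exists_trig_polynomial {T : AngleCircle → ℝ} (hT : Integrable T μ)
    (heven : ∀ᵐ θ ∂μ, T (-θ) = T θ) (k : ℕ)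
    (h : ∀ n : ℤ, (k : ℤ) < n → fourierCoeff (fun θ => (T θ : ℂ)) n = 0) :
    ∃ t : ℝ[X], t.natDegree ≤ 2 * k ∧ reflect (2 * k) t = t ∧
      ∀ᵐ θ ∂μ, unitPoint θ ^ k * (T θ : ℂ) = aeval (unitPoint θ) t := by
  set c : ℤ → ℂ := fun n => fourierCoeff (fun θ => (T θ : ℂ)) n with hc
  have hherm : IsHermitianFun fun θ => (T θ : ℂ) := by
    filter_upwards [heven] with θ hθ
    rw [hθ, Complex.conj_ofReal]
  have hreal : ∀ n, ((c n).re : ℂ) = c n := fun n =>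
    Complex.ext (by simp) (by simpa using (hherm.hasRealCoeffs n).symm)
  have hsymm : ∀ n, c (-n) = c n := fun n => by
    simp only [hc]
    rw [fourierCoeff_neg_of_real, Complex.conj_eq_iff_im.2 (hherm.hasRealCoeffs n)]
  have hTc : Integrable (fun θ => (T θ : ℂ)) μ := hT.ofReal
  have h1 := ae_eq_eval_of_fourierCoeff (integrable_zpow_mul hTc k) (2 * k) (fun n hn => by
    rw [fourierCoeff_zpow_mul]
    have : c (n - k) = 0 := by
      rw [← hsymm]
      exact h _ (by omega)
    exact this) (fun n hn => by
    rw [fourierCoeff_zpow_mul]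
    exact h _ (by push_cast at hn; omega))
  set t : ℝ[X] := ∑ i ∈ Finset.range (2 * k + 1), C (c ((i : ℤ) - k)).re * X ^ i with ht
  have htc : ∀ i, t.coeff i = if i ≤ 2 * k then (c ((i : ℤ) - k)).re else 0 := fun i => by
    simp only [ht, finsetSum_coeff, coeff_C_mul, coeff_X_pow, mul_ite, mul_one, mul_zero]
    rw [Finset.sum_ite_eq]
    simp
  refine ⟨t, ?_, ?_, ?_⟩
  · rw [natDegree_le_iff_coeff_eq_zero]
    intro i hi
    rw [htc, if_neg (by omega)]
  · ext i
    rw [coeff_reflect]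
    rcases le_or_gt i (2 * k) with hi | hi
    · rw [revAt_le hi, htc, htc, if_pos (by omega), if_pos hi, ← hsymm]
      congr 2
      push_cast [hi]
      ring
    · rw [revAt_eq_self_of_lt hi]
  · filter_upwards [h1] with θ hθ
    rw [zpow_natCast] at hθ
    rw [hθ, ht]
    simp only [eval_finsetSum, eval_mul, eval_C, eval_pow, eval_X, map_sum, map_mul, map_pow,
      aeval_X, aeval_C, Complex.coe_algebraMap, fourierCoeff_zpow_mul]
    exact Finset.sum_congr rfl fun i _ => by rw [hreal]

/-! ### Tightness of the relaxation and the rational output spectrum -/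

section Structure

variable {k : ℕ} {P Q : ℝ[X]} {lam : ℝ} {A : AngleCircle → ℝ} {F : AngleCircle → ℂ}

/-- The solution of the relaxed problem for a nonconstant rational noise spectrum: the envelope is
attained, the output spectrum is rational of the same order, and the Fourier coefficients decay
geometrically. -/
theorem optimum_structure (hPQ : IsARMAFactor k P Q)
    (hnc : ¬ ∃ s, ∀ θ, rationalSpectrum P Q θ = s) (hlam : 0 < lam) (h : IsAdmissible A F)
    (hwater : ∀ᵐ θ ∂μ, A θ = max ‖F θ‖ (1 / √(lam * rationalSpectrum P Q θ)))
    (hstat : ∀ n : ℤ, 0 < n → fourierCoeff (fun θ =>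
      ((lam * rationalSpectrum P Q θ - 1 / A θ ^ 2 : ℝ) : ℂ) * F θ -
        ((lam * rationalSpectrum P Q θ : ℝ) : ℂ)) n = 0) :
    (∀ᵐ θ ∂μ, A θ = ‖F θ‖) ∧ HasGeometricDecay (fun n : ℕ => fourierCoeff F n) ∧
      ∃ (σ : ℝ) (R : ℝ[X]), 0 < σ ∧ R.coeff 0 = 1 ∧ R.natDegree ≤ k ∧
        ∀ᵐ θ ∂μ, ‖F θ‖ ^ 2 * rationalSpectrum P Q θ = σ ^ 2 * rationalSpectrum R Q θ := by
  have hS := isNoiseSpectrum_rationalSpectrum hPQ.stable_num hPQ.stable_den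
  set S := rationalSpectrum P Q with hSdef
  set p : AngleCircle → ℝ := fun θ => ‖aeval (unitPoint θ) P‖ ^ 2 with hp
  set q : AngleCircle → ℝ := fun θ => ‖aeval (unitPoint θ) Q‖ ^ 2 with hq
  have hp0 : ∀ θ, 0 < p θ := fun θ =>
    pow_pos (norm_pos_iff.2 (hPQ.stable_num.ne_zero_of_norm_eq_one θ)) 2
  have hq0 : ∀ θ, 0 < q θ := fun θ =>
    pow_pos (norm_pos_iff.2 (hPQ.stable_den.ne_zero_of_norm_eq_one θ)) 2
  have hpc : Continuous p := (continuous_aeval_unitPoint P).norm.pow 2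
  have hqc : Continuous q := (continuous_aeval_unitPoint Q).norm.pow 2
  have hqS : ∀ θ, q θ * S θ = p θ := fun θ => by
    rw [hSdef, rationalSpectrum_eq]
    exact mul_div_cancel₀ _ (hq0 θ).ne'
  obtain ⟨s₀, s₁, hs₀, hs₁, hsb⟩ := hS.exists_bounds
  have hlS : ∀ θ, 0 < lam * S θ := fun θ => mul_pos hlam (hS.pos θ)
  have hA1 : ∀ᵐ θ ∂μ, 1 / (lam * S θ) ≤ A θ ^ 2 ∧ 0 < A θ := by
    filter_upwards [hwater, h.pos] with θ h1 h2
    refine ⟨?_, h2⟩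
    rw [← waterlevel_sq hlam (hS.pos θ)]
    refine pow_le_pow_left₀ (waterlevel_pos hlam (hS.pos θ)).le ?_ 2
    rw [h1]
    exact le_max_right _ _
  set Z : AngleCircle → ℂ := fun θ => ((lam * S θ - 1 / A θ ^ 2 : ℝ) : ℂ) * F θ with hZ
  have hZmem : MemLp Z 2 μ := by
    refine MemLp.of_le_mul (c := lam * s₁) h.memLp_fun ?_ ?_
    · refine AEStronglyMeasurable.mul ?_ h.memLp_fun.aestronglyMeasurable
      exact ((hS.continuous.measurable.aemeasurable.const_mul lam).sub
        ((h.memLp_env.aestronglyMeasurable.aemeasurable.pow_const 2).const_div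
        1)).complex_ofReal.aestronglyMeasurable
    · filter_upwards [hA1] with θ h1
      have h2 : 1 / A θ ^ 2 ≤ lam * S θ := by
        rw [one_div_le (pow_pos h1.2 2) (hlS θ)]
        exact h1.1
      have h3 : 0 ≤ 1 / A θ ^ 2 := by positivity
      rw [norm_mul, Complex.norm_real, Real.norm_of_nonneg (by linarith)]
      refine mul_le_mul_of_nonneg_right ?_ (norm_nonneg _)
      have := mul_le_mul_of_nonneg_left (hsb θ).2 hlam.le
      linarith
  have hSc : Continuous fun θ => ((lam * S θ : ℝ) : ℂ) :=
    Complex.continuous_ofReal.comp (continuous_const.mul hS.continuous)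
  have hqcc : Continuous fun θ => ((q θ : ℝ) : ℂ) := Complex.continuous_ofReal.comp hqc
  have hZint : Integrable Z μ := hZmem.integrable (by norm_num)
  have hYint : Integrable (fun θ => Z θ - ((lam * S θ : ℝ) : ℂ)) μ :=
    hZint.sub hSc.integrable_circle
  -- Multiplying by |Q|² clears the denominator of S: M = q (Z − lam S) + lam p, where the first
  -- term is controlled by stationarity and the second has degree at most k.
  set M : AngleCircle → ℂ := fun θ => (q θ : ℂ) * Z θ with hM
  have hMmem : MemLp M 2 μ := memLp_continuous_mul hqcc hZmem
  have hMint : Integrable M μ := hMmem.integrable (by norm_num)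
  have hone : ∀ n : ℤ, 0 < n → fourierCoeff (fun _ : AngleCircle => (1 : ℂ)) n = 0 :=
    fun n hn => by rw [fourierCoeff_one, if_neg hn.ne']
  have hqcoeff : ∀ n : ℤ, (k : ℤ) < n → fourierCoeff (fun θ => (q θ : ℂ)) n = 0 := fun n hn => by
    have := fourierCoeff_normSq_mul_eq_zero hPQ.natDegree_den_le (integrable_const (1 : ℂ)) hone n
      (by omega)
    simpa [hq] using this
  have hMcoeff : ∀ n : ℤ, (k : ℤ) < n → fourierCoeff M n = 0 := fun n hn => by
    have h1 := fourierCoeff_normSq_mul_eq_zero hPQ.natDegree_den_le hYint hstat n (by omega)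
    have h2 := fourierCoeff_normSq_mul_eq_zero hPQ.natDegree_num_le (integrable_const (1 : ℂ))
      hone n (by omega)
    have h3 : M = fun θ => (q θ : ℂ) * (Z θ - ((lam * S θ : ℝ) : ℂ)) +
        (lam : ℂ) * ((p θ : ℂ) * 1) := by
      ext θ
      simp only [hM]
      rw [← hqS θ]
      push_cast
      ring
    have hpcc : Continuous fun θ => (p θ : ℂ) * 1 :=
      (Complex.continuous_ofReal.comp hpc).mul continuous_const
    rw [h3, fourierCoeff_add_fun (integrable_continuous_mul hqcc hYint)
      (hpcc.integrable_circle.const_mul _), fourierCoeff.const_mul, h1, h2]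
    simp
  -- If M vanished, stationarity would leave S with no coefficient of positive index, hence
  -- constant.
  have hMne : ¬ M =ᵐ[μ] 0 := fun hM0 => by
    refine hnc (hS.eq_const fun n hn => ?_)
    have h1 : (fun θ => Z θ - ((lam * S θ : ℝ) : ℂ)) =ᵐ[μ] fun θ => (-lam : ℂ) * (S θ : ℂ) := by
      filter_upwards [hM0] with θ hθ
      have h2 : Z θ = 0 := (mul_eq_zero.1 hθ).resolve_left (by exact_mod_cast (hq0 θ).ne')
      rw [h2]
      push_cast
      ring
    have h2 := hstat n hn
    rw [fourierCoeff_congr_ae h1, fourierCoeff.const_mul] at h2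
    refine (mul_eq_zero.1 h2).resolve_left ?_
    rw [neg_eq_zero]
    exact_mod_cast hlam.ne'
  have hMae : ∀ᵐ θ ∂μ, M θ ≠ 0 := by
    have h1 := ae_ne_zero_of_spectrum_bddBelow (f := fun θ => conj (M θ)) (N := -k)
      hMmem.star (fun n hn => by
        rw [fourierCoeff_conj, hMcoeff (-n) (by omega), map_zero]) fun h2 => hMne (by
        filter_upwards [h2] with θ hθ
        simpa using hθ)
    filter_upwards [h1] with θ hθ h2
    exact hθ (by rw [h2, map_zero])
  -- At the water level lam S = 1/A², so M = 0 there; this happens only on a null set.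
  have hAF : ∀ᵐ θ ∂μ, A θ = ‖F θ‖ := by
    filter_upwards [hMae, hwater] with θ h1 h2
    rcases max_choice ‖F θ‖ (1 / √(lam * S θ)) with h3 | h3
    · rw [h2, h3]
    · refine absurd ?_ h1
      simp only [hM, hZ]
      rw [h2, h3, waterlevel_sq hlam (hS.pos θ), one_div_one_div, sub_self]
      simp
  set T : AngleCircle → ℝ := fun θ => A θ ^ 2 * p θ with hT
  have hTint : Integrable T μ := integrable_mul_continuous_real hpc h.memLp_env.integrable_sq
  have hTeven : ∀ᵐ θ ∂μ, T (-θ) = T θ := by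
    filter_upwards [h.even] with θ hθ
    simp only [hT, hp]
    rw [hθ, unitPoint_neg, ← conj_aeval, Complex.norm_conj]
  -- Multiply M by conj F and use |F|² = A², which holds now that the envelope is attained.
  have hTM : ∀ᵐ θ ∂μ, (T θ : ℂ) = (lam : ℂ)⁻¹ * (conj (F θ) * M θ + (q θ : ℂ)) := by
    filter_upwards [hAF, hA1] with θ h1 h2
    have h3 : conj (F θ) * F θ = ((A θ ^ 2 : ℝ) : ℂ) := by
      rw [mul_comm, Complex.mul_conj, Complex.normSq_eq_norm_sq, h1]
    have h4 : conj (F θ) * M θ = ((q θ * (lam * S θ - 1 / A θ ^ 2) * A θ ^ 2 : ℝ) : ℂ) := by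
      simp only [hM, hZ]
      push_cast at h3 ⊢
      rw [← h3]
      ring
    have h5 : q θ * (lam * S θ - 1 / A θ ^ 2) * A θ ^ 2 = lam * (A θ ^ 2 * p θ) - q θ := by
      rw [← hqS θ]
      have := h2.2.ne'
      field_simp
    rw [h4, h5]
    have h6 : (lam : ℂ) ≠ 0 := by exact_mod_cast hlam.ne'
    simp only [hT]
    push_cast
    field_simp
    ring
  have hFMint : Integrable (fun θ => conj (F θ) * M θ) μ :=
    MemLp.integrable_mul h.memLp_fun.star hMmem
  -- conj F has spectrum in (−∞, 0] and M in (−∞, k], so their product has no coefficient of index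
  -- above k.
  have hTcoeff : ∀ n : ℤ, (k : ℤ) < n → fourierCoeff (fun θ => (T θ : ℂ)) n = 0 := fun n hn => by
    have h1 : fourierCoeff (fun θ => conj (F θ) * M θ) n = 0 := by
      rw [fourierCoeff_eq]
      have h2 := integral_conj_mul_eq_zero (g := fun θ => unitPoint θ ^ (-n) * M θ) h.memLp_fun
        (memLp_continuous_mul (continuous_unitPoint_zpow (-n)) hMmem) fun m => by
          rw [fourierCoeff_zpow_mul]
          rcases lt_or_ge m 0 with hm | hm
          · exact Or.inl (h.causal m hm)
          · exact Or.inr (hMcoeff _ (by omega))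
      rw [← h2]
      congr 1 with θ
      ring
    rw [fourierCoeff_congr_ae hTM, fourierCoeff.const_mul,
      fourierCoeff_add_fun hFMint hqcc.integrable_circle, h1, hqcoeff n hn]
    simp
  obtain ⟨t, htdeg, htrefl, htT⟩ := exists_trig_polynomial hTint hTeven k hTcoeff
  have hTnorm : ∀ᵐ θ ∂μ, T θ = ‖aeval (unitPoint θ) t‖ := by
    filter_upwards [htT] with θ h1
    rw [← h1, norm_mul, norm_pow, norm_unitPoint, one_pow, one_mul, Complex.norm_real,
      Real.norm_of_nonneg (mul_nonneg (sq_nonneg _) (hp0 θ).le)]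
  have hTlow : ∀ᵐ θ ∂μ, q θ / lam ≤ T θ := by
    filter_upwards [hA1] with θ h1
    have h2 : q θ / lam = 1 / (lam * S θ) * p θ := by
      rw [← hqS θ]
      have := (hS.pos θ).ne'
      field_simp
    rw [h2]
    exact mul_le_mul_of_nonneg_right h1.1 (hp0 θ).le
  -- The water level bounds T below almost everywhere; continuity extends this bound to |t| at every
  -- point, which excludes zeros on the circle.
  have htlow : ∀ θ, q θ / lam ≤ ‖aeval (unitPoint θ) t‖ := by
    have h1 : (fun θ => max (q θ / lam - ‖aeval (unitPoint θ) t‖) 0) =ᵐ[μ] fun _ => 0 := by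
      filter_upwards [hTnorm, hTlow] with θ h1 h2
      rw [← h1]
      exact max_eq_right (by linarith)
    have h2 := (Continuous.ae_eq_iff_eq μ (((hqc.div_const lam).sub
      (continuous_aeval_unitPoint t).norm).max continuous_const) continuous_const).1 h1
    intro θ
    have h3 : q θ / lam - ‖aeval (unitPoint θ) t‖ ≤ 0 :=
      (le_max_left _ _).trans (congrFun h2 θ).le
    linarith
  have htne : ∀ z : ℂ, ‖z‖ = 1 → aeval z t ≠ 0 := fun z hz h1 => by
    obtain ⟨θ, rfl⟩ := exists_unitPoint_eq hz
    have h2 := htlow θ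
    rw [h1, norm_zero] at h2
    have := div_pos (hq0 θ) hlam
    linarith
  obtain ⟨σ, R, hσ, hR0, hRdeg, hR⟩ := fejer_riesz k t htdeg htrefl htne
  refine ⟨hAF, ?_, σ, R, hσ, hR0, hRdeg, ?_⟩
  -- From p (lam T − q) = T q (lam S − 1/A²): multiplied by F, the right side becomes T M. In v F =
  -- z^k t M the three factors contribute k, 2k and k to the top index, whence 4k.
  · set v : ℝ[X] := P * reflect k P * (C lam * t - Q * reflect k Q) with hv
    have hTl : ∀ᵐ θ ∂μ, aeval (unitPoint θ) v * F θ =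
        unitPoint θ ^ (k : ℤ) * (aeval (unitPoint θ) t * M θ) := by
      filter_upwards [htT, hA1] with θ h1 h2
      rw [hv, map_mul (aeval (unitPoint θ)) (P * reflect k P), map_sub,
        map_mul (aeval (unitPoint θ)) (C lam), aeval_C, aeval_mul_reflect hPQ.natDegree_num_le,
        aeval_mul_reflect hPQ.natDegree_den_le, ← h1, Complex.coe_algebraMap, zpow_natCast]
      have h3 : ((p θ * (lam * T θ - q θ) : ℝ) : ℂ) =
          ((T θ * q θ * (lam * S θ - 1 / A θ ^ 2) : ℝ) : ℂ) := by
        congr 1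
        simp only [hT]
        rw [← hqS θ]
        have := h2.2.ne'
        field_simp
      have h4 : (p θ : ℂ) * ((lam : ℂ) * (T θ : ℂ) - (q θ : ℂ)) =
          (T θ : ℂ) * (q θ : ℂ) * ((lam * S θ - 1 / A θ ^ 2 : ℝ) : ℂ) := by
        exact_mod_cast h3
      have h5 : ((‖aeval (unitPoint θ) P‖ ^ 2 : ℝ) : ℂ) = (p θ : ℂ) := rfl
      have h6 : ((‖aeval (unitPoint θ) Q‖ ^ 2 : ℝ) : ℂ) = (q θ : ℂ) := rfl
      simp only [hM, hZ]
      rw [h5, h6]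
      linear_combination unitPoint θ ^ k * unitPoint θ ^ k * F θ * h4
    have hcoeff : ∀ n : ℕ, 4 * k < n →
        fourierCoeff (fun θ => aeval (unitPoint θ) v * F θ) n = 0 := fun n hn => by
      rw [fourierCoeff_congr_ae hTl, fourierCoeff_zpow_mul]
      exact fourierCoeff_aeval_mul_eq_zero t htdeg hMint hMcoeff _ (by push_cast; omega)
    have hP0 : P ≠ 0 := by
      rintro rfl
      have := hPQ.coeff_zero_num
      simp at this
    have hv0 : v ≠ 0 := fun hv0 => by
      rcases mul_eq_zero.1 hv0 with h1 | h1
      · rcases mul_eq_zero.1 h1 with h2 | h2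
        · exact hP0 h2
        · exact hP0 (reflect_eq_zero_iff.1 h2)
      · refine hMne ?_
        filter_upwards [htT, hA1] with θ h2 h3
        have h4 : aeval (unitPoint θ) (C lam * t - Q * reflect k Q) = 0 := by rw [h1, map_zero]
        rw [map_sub, map_mul, aeval_C, aeval_mul_reflect hPQ.natDegree_den_le, ← h2,
          Complex.coe_algebraMap, mul_left_comm, ← mul_sub] at h4
        have h5 := (mul_eq_zero.1 h4).resolve_left (pow_ne_zero _ (unitPoint_ne_zero θ))
        have h6 : lam * T θ - q θ = 0 := by exact_mod_cast h5
        have h7 : lam * S θ - 1 / A θ ^ 2 = 0 := by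
          have h8 : lam * T θ - q θ = q θ * A θ ^ 2 * (lam * S θ - 1 / A θ ^ 2) := by
            simp only [hT]
            rw [← hqS θ]
            have := h3.2.ne'
            field_simp
          rw [h8] at h6
          exact (mul_eq_zero.1 h6).resolve_left (mul_pos (hq0 θ) (pow_pos h3.2 2)).ne'
        simp only [hM, hZ]
        rw [h7]
        simp
    refine hasGeometricDecay_of_eval_mul _ (v.map (algebraMap ℝ ℂ)) F rfl ?_ h.memLp_fun h.causal ?_
    · rwa [Ne, Polynomial.map_eq_zero]
    · refine hasGeometricDecay_of_eventually_zero (N := 4 * k) fun n hn => ?_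
      simp only [eval_map_algebraMap]
      exact hcoeff n hn
  · filter_upwards [hAF, hTnorm] with θ h1 h2
    rw [← h1, hSdef, rationalSpectrum_eq, rationalSpectrum_eq, ← mul_div_assoc, ← mul_div_assoc,
      ← hR _ (norm_unitPoint θ), ← h2]

end Structure

/-! ### Absolutely convergent causal series -/

/-- The function `∑ gₙ e^{inθ}` on the circle. -/
noncomputable def causalSeries (g : ℕ → ℂ) (θ : AngleCircle) : ℂ := ∑' i, g i * unitPoint θ ^ i

section CausalSeries

variable {g : ℕ → ℂ}

lemma norm_causalSeries_term (g : ℕ → ℂ) (θ : AngleCircle) (i : ℕ) :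
    ‖g i * unitPoint θ ^ i‖ = ‖g i‖ := by
  rw [norm_mul, norm_pow, norm_unitPoint, one_pow, mul_one]

lemma summable_causalSeries (hg : Summable g) (θ : AngleCircle) :
    Summable fun i => g i * unitPoint θ ^ i :=
  Summable.of_norm (by simpa only [norm_causalSeries_term] using hg.norm)

lemma continuous_causalSeries (hg : Summable g) : Continuous (causalSeries g) :=
  continuous_tsum (fun i => continuous_const.mul (continuous_unitPoint.pow i)) hg.norm
    fun i θ => (norm_causalSeries_term g θ i).le

lemma fourierCoeff_causalSeries (hg : Summable g) (n : ℤ) :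
    fourierCoeff (causalSeries g) n = if 0 ≤ n then g n.toNat else 0 := by
  have hterm : ∀ i : ℕ, ∫ θ, unitPoint θ ^ (-n) * (g i * unitPoint θ ^ i) ∂μ =
      if n = i then g i else 0 := fun i => by
    rw [← fourierCoeff_eq (fun θ => g i * unitPoint θ ^ i), fourierCoeff.const_mul]
    have := fourierCoeff_zpow i n
    simp only [zpow_natCast] at this
    rw [this]
    simp
  have h1 := hasSum_integral_of_summable_integral_norm
    (F := fun (i : ℕ) (θ : AngleCircle) => unitPoint θ ^ (-n) * (g i * unitPoint θ ^ i))
    (fun i => Continuous.integrable_circle ((continuous_unitPoint_zpow (-n)).mul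
      (continuous_const.mul (continuous_unitPoint.pow i)))) (by
      simpa using hg.norm)
  simp only [hterm, tsum_mul_left] at h1
  rw [fourierCoeff_eq]
  refine h1.unique ?_ |>.trans rfl
  split_ifs with hn
  · obtain ⟨m, rfl⟩ := Int.eq_ofNat_of_zero_le hn
    simp only [Nat.cast_inj, Int.toNat_natCast]
    have h2 : (fun i => if m = i then g i else 0) = fun i => if i = m then g m else 0 := by
      funext i
      by_cases h : m = i
      · simp [h]
      · simp [h, Ne.symm h]
    rw [h2]
    exact hasSum_ite_eq m (g m)
  · have h2 : (fun i : ℕ => if n = i then g i else 0) = fun _ => 0 := by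
      funext i
      rw [if_neg]
      omega
    rw [h2]
    exact hasSum_zero

lemma norm_causalSeries_sub_le (hg : Summable g) (N : ℕ) (θ : AngleCircle) :
    ‖∑ i ∈ Finset.range N, g i * unitPoint θ ^ i - causalSeries g θ‖ ≤ ∑' i, ‖g (i + N)‖ := by
  have h1 := (summable_causalSeries hg θ).sum_add_tsum_nat_add N
  have h2 : ∑ i ∈ Finset.range N, g i * unitPoint θ ^ i - causalSeries g θ =
      -∑' i, g (i + N) * unitPoint θ ^ (i + N) := by
    rw [causalSeries, ← h1]
    ring
  have h3 : Summable fun i => ‖g (i + N) * unitPoint θ ^ (i + N)‖ := by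
    simpa only [norm_causalSeries_term] using (summable_nat_add_iff N).2 hg.norm
  rw [h2, norm_neg]
  refine (norm_tsum_le_tsum_norm h3).trans (le_of_eq ?_)
  simp only [norm_causalSeries_term]

lemma ae_eq_causalSeries {f : AngleCircle → ℂ} (hf : Integrable f μ)
    (h : ∀ n : ℤ, n < 0 → fourierCoeff f n = 0)
    (hs : Summable fun n : ℕ => fourierCoeff f n) :
    f =ᵐ[μ] causalSeries fun n : ℕ => fourierCoeff f n := by
  refine ae_eq_of_fourierCoeff hf (continuous_causalSeries hs).integrable_circle fun n => ?_
  rw [fourierCoeff_causalSeries hs]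
  split_ifs with hn
  · rw [Int.toNat_of_nonneg hn]
  · exact h n (by omega)

end CausalSeries

/-! ### Filters and their rates -/

lemma half_log_sq (x : ℝ) : (1 / 2 : ℝ) * Real.log (x ^ 2) = Real.log x := by
  rw [Real.log_pow]
  push_cast
  ring

lemma feedbackRate_eq (B : AngleCircle → ℂ) : feedbackRate B = relaxedRate fun θ => ‖1 + B θ‖ := by
  simp only [feedbackRate, relaxedRate, half_log_sq]

/-- Expanding |F − 1|² with F = 1 + B: the relaxed power is exact when A = |F|. -/
lemma inputPower_eq (S : AngleCircle → ℝ) (B : AngleCircle → ℂ) :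
    inputPower S B = relaxedPower S (fun θ => ‖1 + B θ‖) (fun θ => 1 + B θ) := by
  simp only [inputPower, relaxedPower]
  congr 1 with θ
  congr 1
  rw [← Complex.normSq_eq_norm_sq, ← Complex.normSq_eq_norm_sq, Complex.normSq_apply,
    Complex.normSq_apply]
  simp only [Complex.add_re, Complex.add_im, Complex.one_re, Complex.one_im]
  ring

lemma fourierCoeff_one_add {B : AngleCircle → ℂ} (hB : Integrable B μ) (n : ℤ) :
    fourierCoeff (fun θ => 1 + B θ) n = (if n = 0 then 1 else 0) + fourierCoeff B n := by
  rw [fourierCoeff_add_fun (integrable_const _) hB, fourierCoeff_one]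

/-- Jensen's inequality supplies the integrable logarithm, so every feasible filter is a competitor
in the relaxed problem. -/
lemma IsFeasible.isAdmissible {S : AngleCircle → ℝ} {power : ℝ} {B : AngleCircle → ℂ}
    (h : IsFeasible 2 S power B) : IsAdmissible (fun θ => ‖1 + B θ‖) (fun θ => 1 + B θ) := by
  have hB : MemLp B 2 μ := h.memHardy.1
  have hBi : Integrable B μ := hB.integrable (by norm_num)
  have hF : MemLp (fun θ => 1 + B θ) 2 μ :=
    (memLp_const (1 : ℂ)).add hB
  have hcausal : ∀ n : ℤ, n < 0 → fourierCoeff (fun θ => 1 + B θ) n = 0 := fun n hn => by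
    rw [fourierCoeff_one_add hBi, if_neg hn.ne, h.strictlyCausal n hn.le, add_zero]
  have hmean : fourierCoeff (fun θ => 1 + B θ) 0 = 1 := by
    rw [fourierCoeff_one_add hBi, if_pos rfl, h.strictlyCausal 0 le_rfl, add_zero]
  obtain ⟨hpos, hlog, -⟩ := jensen_hardy hF hcausal hmean
  have hherm : IsHermitianFun fun θ => 1 + B θ := by
    filter_upwards [h.realCoeffs.isHermitianFun hBi] with θ hθ
    rw [hθ, map_add, map_one]
  have heven : ∀ᵐ θ ∂μ, ‖1 + B (-θ)‖ = ‖1 + B θ‖ := by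
    filter_upwards [hherm] with θ hθ
    rw [hθ, Complex.norm_conj]
  exact
    { memLp_env := hF.norm
      memLp_fun := hF
      pos := hpos
      norm_le := ae_of_all _ fun θ => le_rfl
      log_integrable := hlog
      even := heven
      hermitian := hherm
      causal := hcausal
      mean := hmean }

lemma IsFeasible.relaxedPower_le {S : AngleCircle → ℝ} {power : ℝ} {B : AngleCircle → ℂ}
    (h : IsFeasible 2 S power B) :
    relaxedPower S (fun θ => ‖1 + B θ‖) (fun θ => 1 + B θ) ≤ power := by
  rw [← inputPower_eq]
  exact h.power_le

lemma polyFilter_eq_eval (b : ℝ[X]) :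
    polyFilter b = fun θ => (b.map (algebraMap ℝ ℂ)).eval (unitPoint θ) := by
  ext θ
  rw [polyFilter, eval_map_algebraMap]

lemma isFeasible_polyFilter {S : AngleCircle → ℝ} {power : ℝ} {b : ℝ[X]} (hb : b.coeff 0 = 0)
    (hp : inputPower S (polyFilter b) ≤ power) : IsFeasible 2 S power (polyFilter b) := by
  have hc : ∀ n : ℤ, fourierCoeff (polyFilter b) n =
      if 0 ≤ n then ((b.coeff n.toNat : ℝ) : ℂ) else 0 := fun n => by
    rw [polyFilter_eq_eval, fourierCoeff_eval, coeff_map]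
    rfl
  refine ⟨⟨(continuous_aeval_unitPoint b).memLp_circle 2, fun n hn => ?_⟩, fun n hn => ?_,
    fun n => ?_, hp⟩
  · rw [hc, if_neg (by omega)]
  · rw [hc]
    split_ifs with h
    · have : n.toNat = 0 := by omega
      rw [this, hb, Complex.ofReal_zero]
    · rfl
  · rw [hc]
    split_ifs <;> simp

/-! ### Approximation by polynomial filters -/

section Approximation

variable {S : AngleCircle → ℝ} {r : ℕ → ℝ} {power δ : ℝ}

lemma isFeasible_causalSeries (hr : Summable r) (hr0 : r 0 = 1)
    (hp : inputPower S (fun θ => causalSeries (fun i => (r i : ℂ)) θ - 1) ≤ power) :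
    IsFeasible ∞ S power (fun θ => causalSeries (fun i => (r i : ℂ)) θ - 1) := by
  have hg : Summable fun i => (r i : ℂ) := by exact_mod_cast hr
  have hcont := continuous_causalSeries hg
  have hc : ∀ n : ℤ, fourierCoeff (fun θ => causalSeries (fun i => (r i : ℂ)) θ - 1) n =
      (if 0 ≤ n then ((r n.toNat : ℝ) : ℂ) else 0) - if n = 0 then 1 else 0 := fun n => by
    rw [fourierCoeff_sub_fun hcont.integrable_circle (integrable_const _),
      fourierCoeff_causalSeries hg, fourierCoeff_one]
  refine ⟨⟨(hcont.sub continuous_const).memLp_circle ∞, fun n hn => ?_⟩, fun n hn => ?_,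
    fun n => ?_, hp⟩
  · rw [hc, if_neg (by omega), if_neg (by omega), sub_zero]
  · rw [hc]
    rcases hn.eq_or_lt with rfl | h
    · simp [hr0]
    · rw [if_neg (by omega), if_neg (by omega), sub_zero]
  · rw [hc]
    split_ifs <;> simp

lemma abs_log_le_of_mem_Icc {a b x : ℝ} (ha : 0 < a) (hax : a ≤ x) (hxb : x ≤ b) :
    |Real.log x| ≤ |Real.log a| + |Real.log b| := by
  have h1 := Real.log_le_log ha hax
  have h2 := Real.log_le_log (ha.trans_le hax) hxb
  rw [abs_le]
  constructor
  · linarith [neg_abs_le (Real.log a), abs_nonneg (Real.log b)]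
  · linarith [le_abs_self (Real.log b), abs_nonneg (Real.log a)]

/-- A continuous filter given by an absolutely convergent series, with `1 + B` bounded away from
zero, is a limit of polynomial filters that meet the same power constraint. -/
lemma feedbackRate_causalSeries_le (hS : IsNoiseSpectrum S) (hpower : 0 < power)
    (hr : Summable r) (hr0 : r 0 = 1) (hδ : 0 < δ)
    (hlow : ∀ᵐ θ ∂μ, δ ≤ ‖causalSeries (fun i => (r i : ℂ)) θ‖)
    (hp : inputPower S (fun θ => causalSeries (fun i => (r i : ℂ)) θ - 1) ≤ power) {u : ℝ}
    (hu : u ∈ upperBounds (polynomialRates S power)) :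
    feedbackRate (fun θ => causalSeries (fun i => (r i : ℂ)) θ - 1) ≤ u := by
  have hg : Summable fun i => (r i : ℂ) := by exact_mod_cast hr
  set G := causalSeries fun i => (r i : ℂ) with hG
  have hGc : Continuous G := continuous_causalSeries hg
  obtain ⟨s₀, s₁, hs₀, hs₁, hsb⟩ := hS.exists_bounds
  set ε : ℕ → ℝ := fun N => ∑' i, ‖(r (i + (N + 1)) : ℂ)‖ with hε
  have hε0 : Tendsto ε atTop (𝓝 0) :=
    (tendsto_sum_nat_add fun i => ‖(r i : ℂ)‖).comp (tendsto_add_atTop_nat 1)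
  set b : ℕ → ℝ[X] := fun N => ∑ i ∈ Finset.range N, C (r (i + 1)) * X ^ (i + 1) with hb
  have hb0 : ∀ N, (b N).coeff 0 = 0 := fun N => by
    simp [hb, finsetSum_coeff, coeff_X_pow]
  have hBN : ∀ N θ, polyFilter (b N) θ =
      ∑ i ∈ Finset.range (N + 1), (r i : ℂ) * unitPoint θ ^ i - 1 := fun N θ => by
    rw [Finset.sum_range_succ', hr0]
    simp [hb, polyFilter]
  have hclose : ∀ N θ, ‖polyFilter (b N) θ - (G θ - 1)‖ ≤ ε N := fun N θ => by
    have h1 := norm_causalSeries_sub_le hg (N + 1) θ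
    rw [hBN]
    convert h1 using 2
    ring
  set K := ∑' i, ‖(r i : ℂ)‖ + 1 with hK
  have hK0 : 0 ≤ K := add_nonneg (tsum_nonneg fun i => norm_nonneg _) zero_le_one
  have hbd : ∀ N θ, ‖polyFilter (b N) θ‖ ≤ K := fun N θ => by
    rw [hBN]
    refine (norm_sub_le _ _).trans ?_
    rw [norm_one]
    refine add_le_add_left ((norm_sum_le _ _).trans ?_) 1
    have h2 : ∀ i, ‖(r i : ℂ) * unitPoint θ ^ i‖ = ‖(r i : ℂ)‖ :=
      norm_causalSeries_term (fun i => (r i : ℂ)) θ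
    simp only [h2]
    exact hg.norm.sum_le_tsum _ fun i _ => norm_nonneg _
  have hptw : ∀ θ, Tendsto (fun N => polyFilter (b N) θ) atTop (𝓝 (G θ - 1)) := fun θ => by
    rw [tendsto_iff_norm_sub_tendsto_zero]
    exact squeeze_zero (fun N => norm_nonneg _) (fun N => hclose N θ) hε0
  have hpc : ∀ N, Continuous (polyFilter (b N)) := fun N => continuous_aeval_unitPoint (b N)
  set w : ℕ → ℝ := fun N => inputPower S (polyFilter (b N)) with hw
  have hwlim : Tendsto w atTop (𝓝 (inputPower S fun θ => G θ - 1)) := by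
    refine tendsto_integral_of_dominated_convergence (fun _ => K ^ 2 * s₁) (fun N => ?_)
      (integrable_const _) (fun N => ae_of_all _ fun θ => ?_) (ae_of_all _ fun θ => ?_)
    · exact (((hpc N).norm.pow 2).mul hS.continuous).aestronglyMeasurable
    · rw [Real.norm_of_nonneg (mul_nonneg (sq_nonneg _) (hS.pos θ).le)]
      have h1 := hbd N θ
      have h2 := (hsb θ).2
      have h3 := (hS.pos θ).le
      gcongr
    · exact (((hptw θ).norm.pow 2).mul_const _)
  -- Truncations may overshoot the power; the factor s N restores the constraint and tends to 1.
  set s : ℕ → ℝ := fun N => √(power / max power (w N)) with hs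
  have hmax : ∀ N, 0 < max power (w N) := fun N => lt_max_of_lt_left hpower
  have hssq : ∀ N, s N ^ 2 = power / max power (w N) := fun N =>
    Real.sq_sqrt (div_nonneg hpower.le (hmax N).le)
  have hslim : Tendsto s atTop (𝓝 1) := by
    have h1 : Tendsto (fun N => max power (w N)) atTop (𝓝 power) := by
      have := (tendsto_const_nhds (x := power)).max hwlim
      rwa [max_eq_left hp] at this
    have h2 := (Real.continuous_sqrt.tendsto _).comp
      ((tendsto_const_nhds (x := power)).div h1 hpower.ne')
    rw [div_self hpower.ne', Real.sqrt_one] at h2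
    exact h2
  have hspow : ∀ N, inputPower S (polyFilter (C (s N) * b N)) ≤ power := fun N => by
    have h1 : inputPower S (polyFilter (C (s N) * b N)) = s N ^ 2 * w N := by
      simp only [hw, inputPower]
      rw [← integral_const_mul]
      congr 1 with θ
      simp only [polyFilter, map_mul, aeval_C, norm_mul, Complex.coe_algebraMap, Complex.norm_real,
        mul_pow, Real.norm_eq_abs, sq_abs]
      ring
    rw [h1, hssq, div_mul_eq_mul_div, div_le_iff₀ (hmax N)]
    exact mul_le_mul_of_nonneg_left (le_max_right _ _) hpower.le
  have hrate : ∀ N, feedbackRate (polyFilter (C (s N) * b N)) ≤ u := fun N =>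
    hu ⟨C (s N) * b N, by rw [coeff_C_mul, hb0, mul_zero], hspow N, rfl⟩
  refine le_of_tendsto' (x := atTop) (f := fun N => feedbackRate (polyFilter (C (s N) * b N)))
    ?_ hrate
  have hpf : ∀ N θ, polyFilter (C (s N) * b N) θ = (s N : ℂ) * polyFilter (b N) θ := fun N θ => by
    simp only [polyFilter, map_mul, aeval_C, Complex.coe_algebraMap]
  have herr : ∀ N θ, ‖1 + polyFilter (C (s N) * b N) θ - G θ‖ ≤ ε N + |s N - 1| * K := by
    intro N θ
    have h1 : 1 + polyFilter (C (s N) * b N) θ - G θ =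
        (polyFilter (b N) θ - (G θ - 1)) + ((s N - 1 : ℝ) : ℂ) * polyFilter (b N) θ := by
      rw [hpf]
      push_cast
      ring
    rw [h1]
    refine (norm_add_le _ _).trans (add_le_add (hclose N θ) ?_)
    rw [norm_mul, Complex.norm_real, Real.norm_eq_abs]
    exact mul_le_mul_of_nonneg_left (hbd N θ) (abs_nonneg _)
  have herrlim : Tendsto (fun N => ε N + |s N - 1| * K) atTop (𝓝 0) := by
    have h1 := ((hslim.sub_const 1).abs.mul_const K)
    simp only [sub_self, abs_zero, zero_mul] at h1
    simpa using hε0.add h1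
  -- The errors are uniform in θ, so eventually |1 + B_N| lies between δ/2 and D + δ/2 and the
  -- logarithms are uniformly bounded.
  obtain ⟨D, hD⟩ := isCompact_univ.exists_bound_of_continuousOn hGc.continuousOn
  simp only [feedbackRate, half_log_sq]
  refine tendsto_integral_filter_of_dominated_convergence
    (fun _ => |Real.log (δ / 2)| + |Real.log (D + δ / 2)|) ?_ ?_ (integrable_const _) ?_
  · refine Eventually.of_forall fun N => ?_
    have h1 : Measurable fun θ => ‖1 + polyFilter (C (s N) * b N) θ‖ :=
      (continuous_const.add (continuous_aeval_unitPoint (C (s N) * b N))).norm.measurable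
    exact h1.log.aestronglyMeasurable
  · filter_upwards [herrlim.eventually_lt_const (half_pos hδ)] with N hN
    filter_upwards [hlow] with θ hθ
    have h1 := (herr N θ).trans hN.le
    have h2 := abs_norm_sub_norm_le (1 + polyFilter (C (s N) * b N) θ) (G θ)
    have h3 := abs_le.1 (h2.trans h1)
    refine abs_log_le_of_mem_Icc (half_pos hδ) (by linarith [h3.1]) ?_
    linarith [h3.2, hD θ (Set.mem_univ θ)]
  · filter_upwards [hlow] with θ hθ
    have h1 : Tendsto (fun N => 1 + polyFilter (C (s N) * b N) θ) atTop (𝓝 (G θ)) := by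
      rw [tendsto_iff_norm_sub_tendsto_zero]
      exact squeeze_zero (fun N => norm_nonneg _) (fun N => herr N θ) herrlim
    have h2 : ‖1 + (G θ - 1)‖ = ‖G θ‖ := by congr 1; ring
    rw [h2]
    exact (Real.continuousAt_log (hδ.trans_le hθ).ne').tendsto.comp h1.norm

end Approximation

/-! ### Attainment of the feedback capacity -/

lemma IsFeasible.of_top {S : AngleCircle → ℝ} {power : ℝ} {B : AngleCircle → ℂ}
    (h : IsFeasible ∞ S power B) : IsFeasible 2 S power B :=
  ⟨⟨h.memHardy.1.mono_exponent le_top, h.memHardy.2⟩, h.strictlyCausal, h.realCoeffs, h.power_le⟩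

lemma IsFeasible.integrable_log {S : AngleCircle → ℝ} {power : ℝ} {B : AngleCircle → ℂ}
    (h : IsFeasible 2 S power B) : Integrable (fun θ => Real.log (‖1 + B θ‖ ^ 2)) μ := by
  refine (h.isAdmissible.log_integrable.const_mul 2).congr (ae_of_all _ fun θ => ?_)
  simp only
  rw [Real.log_pow]
  norm_num

lemma mem_upperBounds_polynomialRates {S : AngleCircle → ℝ} {power c : ℝ}
    (h : ∀ B, IsFeasible 2 S power B → feedbackRate B ≤ c) :
    c ∈ upperBounds (polynomialRates S power) := by
  rintro _ ⟨b, hb0, hb, rfl⟩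
  exact h _ (isFeasible_polyFilter hb0 hb)

/-- The filter `B` attains the feedback capacity, and the output spectrum is rational. -/
def IsCapacityAttaining (k : ℕ) (P Q : ℝ[X]) (power : ℝ) (B : AngleCircle → ℂ) : Prop :=
  IsFeasible ∞ (rationalSpectrum P Q) power B ∧
    IsLUB (polynomialRates (rationalSpectrum P Q) power) (feedbackRate B) ∧
    (∀ B', IsFeasible 2 (rationalSpectrum P Q) power B' → feedbackRate B' ≤ feedbackRate B) ∧
    ∃ (σ : ℝ) (R : ℝ[X]), 0 < σ ∧ R.coeff 0 = 1 ∧ R.natDegree ≤ k ∧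
      ∀ᵐ θ ∂μ, outputSpectrum (rationalSpectrum P Q) B θ = σ ^ 2 * rationalSpectrum R Q θ

lemma isCapacityAttaining_causalSeries {k : ℕ} {P Q : ℝ[X]} {power δ : ℝ} {r : ℕ → ℝ}
    (hS : IsNoiseSpectrum (rationalSpectrum P Q)) (hpower : 0 < power)
    (hr : Summable r) (hr0 : r 0 = 1) (hδ : 0 < δ)
    (hlow : ∀ᵐ θ ∂μ, δ ≤ ‖causalSeries (fun i => (r i : ℂ)) θ‖)
    (hp : inputPower (rationalSpectrum P Q)
      (fun θ => causalSeries (fun i => (r i : ℂ)) θ - 1) ≤ power)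
    (hub : ∀ B', IsFeasible 2 (rationalSpectrum P Q) power B' →
      feedbackRate B' ≤ feedbackRate fun θ => causalSeries (fun i => (r i : ℂ)) θ - 1)
    (hout : ∃ (σ : ℝ) (R : ℝ[X]), 0 < σ ∧ R.coeff 0 = 1 ∧ R.natDegree ≤ k ∧
      ∀ᵐ θ ∂μ, ‖causalSeries (fun i => (r i : ℂ)) θ‖ ^ 2 * rationalSpectrum P Q θ =
        σ ^ 2 * rationalSpectrum R Q θ) :
    IsCapacityAttaining k P Q power fun θ => causalSeries (fun i => (r i : ℂ)) θ - 1 := by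
  refine ⟨isFeasible_causalSeries hr hr0 hp, ⟨mem_upperBounds_polynomialRates hub, fun u hu =>
    feedbackRate_causalSeries_le hS hpower hr hr0 hδ hlow hp hu⟩, hub, ?_⟩
  obtain ⟨σ, R, h1, h2, h3, h4⟩ := hout
  refine ⟨σ, R, h1, h2, h3, ?_⟩
  filter_upwards [h4] with θ hθ
  rw [← hθ, outputSpectrum, add_sub_cancel]

/-- As S > 0, zero power forces B = 0 almost everywhere, and the output spectrum is that of the
noise. -/
lemma isCapacityAttaining_zero {k : ℕ} {P Q : ℝ[X]} (hPQ : IsARMAFactor k P Q) :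
    IsCapacityAttaining k P Q 0 fun _ => 0 := by
  have hS := isNoiseSpectrum_rationalSpectrum hPQ.stable_num hPQ.stable_den
  have hcoeff : ∀ n : ℤ, fourierCoeff (fun _ : AngleCircle => (0 : ℂ)) n = 0 := fun n => by
    simp [fourierCoeff_eq]
  have hrate0 : feedbackRate (fun _ => 0) = 0 := by simp [feedbackRate]
  have hub : ∀ B', IsFeasible 2 (rationalSpectrum P Q) 0 B' →
      feedbackRate B' ≤ feedbackRate fun _ => 0 := fun B' h => by
    have hnn : 0 ≤ᵐ[μ] fun θ => ‖B' θ‖ ^ 2 * rationalSpectrum P Q θ :=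
      ae_of_all _ fun θ => mul_nonneg (sq_nonneg _) (hS.pos θ).le
    have hz := (integral_eq_zero_iff_of_nonneg_ae hnn (integrable_mul_continuous_real hS.continuous
      h.memHardy.1.norm.integrable_sq)).1 (le_antisymm h.power_le (integral_nonneg_of_ae hnn))
    have h0 : B' =ᵐ[μ] fun _ => 0 := by
      filter_upwards [hz] with θ hθ
      have h1 := (mul_eq_zero.1 hθ).resolve_right (hS.pos θ).ne'
      simpa using h1
    rw [feedbackRate_eq, feedbackRate_eq]
    refine (relaxedRate_congr ?_).le
    filter_upwards [h0] with θ hθ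
    rw [hθ]
  refine ⟨⟨⟨memLp_const 0, fun n _ => hcoeff n⟩, fun n _ => hcoeff n, fun n => ?_, ?_⟩,
    ⟨mem_upperBounds_polynomialRates hub, fun u hu => hu ⟨0, by simp, ?_, ?_⟩⟩, hub, 1, P,
    one_pos, hPQ.coeff_zero_num, hPQ.natDegree_num_le, ae_of_all _ fun θ => ?_⟩
  · rw [hcoeff, Complex.zero_im]
  · simp [inputPower]
  · simp [inputPower, polyFilter]
  · congr 1
    ext θ
    simp [polyFilter]
  · simp [outputSpectrum]

/-- White noise: the optimal filter is given by a Blaschke factor. -/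
lemma exists_isCapacityAttaining_of_const {k : ℕ} {P Q : ℝ[X]} (hPQ : IsARMAFactor k P Q)
    {power s : ℝ} (hpower : 0 < power) (hs : ∀ θ, rationalSpectrum P Q θ = s) :
    ∃ B, IsCapacityAttaining k P Q power B := by
  have hS := isNoiseSpectrum_rationalSpectrum hPQ.stable_num hPQ.stable_den
  have hs0 : 0 < s := by rw [← hs 0]; exact hS.pos 0
  -- A filter with |1 + B| = σ has power s(σ² − 1), which this choice makes equal to `power`.
  set σ := √(1 + power / s) with hσ
  have hσsq : σ ^ 2 = 1 + power / s := Real.sq_sqrt (by positivity)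
  have hσ1 : 1 < σ := by
    have : 0 < power / s := by positivity
    rw [hσ, Real.lt_sqrt zero_le_one]
    linarith
  have hσ0 : 0 < σ := by linarith
  -- Taylor coefficients of (1 + σz)/(1 + z/σ), which is σ times a Blaschke factor and so has
  -- modulus σ on the circle.
  set r : ℕ → ℝ := fun i => if i = 0 then 1 else (1 - σ ^ 2) * (-σ⁻¹) ^ i with hr
  have hinv : |(-σ⁻¹)| < 1 := by
    rw [abs_neg, abs_of_pos (inv_pos.2 hσ0)]
    exact inv_lt_one_of_one_lt₀ hσ1
  have hrec : ∀ i, r (i + 1) + σ⁻¹ * r i = if i = 0 then σ else 0 := by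
    intro i
    rcases Nat.eq_zero_or_pos i with rfl | hi
    · simp only [hr, if_pos, zero_add, one_ne_zero, if_false, pow_one]
      field_simp
      ring
    · simp only [hr, if_neg (Nat.succ_ne_zero i), if_neg hi.ne']
      rw [pow_succ]
      ring
  have hrsum : Summable r := by
    have h1 : Summable fun i => (1 - σ ^ 2) * (-σ⁻¹) ^ i :=
      (summable_geometric_of_abs_lt_one hinv).mul_left _
    refine (summable_nat_add_iff 1).1 (((summable_nat_add_iff 1).2 h1).congr fun i => ?_)
    simp [hr]
  have hg : Summable fun i => (r i : ℂ) := by exact_mod_cast hrsum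
  set G := causalSeries fun i => (r i : ℂ) with hG
  have hGeq : ∀ θ, (1 + (σ⁻¹ : ℝ) * unitPoint θ) * G θ = 1 + σ * unitPoint θ := by
    intro θ
    have h1 := summable_causalSeries hg θ
    have h2 : G θ = 1 + ∑' i, (r (i + 1) : ℂ) * unitPoint θ ^ (i + 1) := by
      rw [hG, causalSeries, h1.tsum_eq_zero_add]
      simp [hr]
    have h3 : G θ = ∑' i, (r i : ℂ) * unitPoint θ ^ i := rfl
    have h4 : (∑' i, (r (i + 1) : ℂ) * unitPoint θ ^ (i + 1)) +
        ((σ⁻¹ : ℝ) : ℂ) * unitPoint θ * ∑' i, (r i : ℂ) * unitPoint θ ^ i =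
        σ * unitPoint θ := by
      rw [← tsum_mul_left, ← Summable.tsum_add ((summable_nat_add_iff 1).2 h1) (h1.mul_left _)]
      have h5 : (fun i => (r (i + 1) : ℂ) * unitPoint θ ^ (i + 1) +
          ((σ⁻¹ : ℝ) : ℂ) * unitPoint θ * ((r i : ℂ) * unitPoint θ ^ i)) =
          fun i => if i = 0 then (σ : ℂ) * unitPoint θ else 0 := by
        funext i
        have h6 : ((r (i + 1) + σ⁻¹ * r i : ℝ) : ℂ) = ((if i = 0 then σ else 0 : ℝ) : ℂ) := by
          rw [hrec]
        push_cast at h6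
        have h7 : (r (i + 1) : ℂ) * unitPoint θ ^ (i + 1) +
          ((σ⁻¹ : ℝ) : ℂ) * unitPoint θ * ((r i : ℂ) * unitPoint θ ^ i) =
          ((r (i + 1) : ℂ) + (σ : ℂ)⁻¹ * (r i : ℂ)) * unitPoint θ ^ (i + 1) := by
          push_cast
          ring
        rw [h7, h6]
        split_ifs with h0
        · rw [h0, zero_add, pow_one]
        · rw [Complex.ofReal_zero, zero_mul]
      rw [h5, tsum_ite_eq]
    rw [add_mul, one_mul]
    nth_rw 1 [h2]
    rw [add_assoc]
    congr 1
  have hGnorm : ∀ θ, ‖G θ‖ = σ := by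
    intro θ
    have h1 : ‖1 + (σ : ℂ) * unitPoint θ‖ = σ * ‖1 + ((σ⁻¹ : ℝ) : ℂ) * unitPoint θ‖ := by
      have h2 : 1 + (σ : ℂ) * unitPoint θ =
          σ * unitPoint θ * conj (1 + ((σ⁻¹ : ℝ) : ℂ) * unitPoint θ) := by
        rw [map_add, map_mul, map_one, Complex.conj_ofReal, conj_unitPoint]
        have := unitPoint_ne_zero θ
        have h3 : (σ : ℂ) ≠ 0 := by exact_mod_cast hσ0.ne'
        push_cast
        field_simp
        ring
      rw [h2, norm_mul, norm_mul, norm_unitPoint, Complex.norm_conj, Complex.norm_real,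
        Real.norm_of_nonneg hσ0.le, mul_one]
    have h2 : 0 < ‖1 + ((σ⁻¹ : ℝ) : ℂ) * unitPoint θ‖ := by
      rw [norm_pos_iff]
      intro h3
      have h4 : ((σ⁻¹ : ℝ) : ℂ) * unitPoint θ = -1 := by linear_combination h3
      have h5 : ‖((σ⁻¹ : ℝ) : ℂ) * unitPoint θ‖ = 1 := by rw [h4, norm_neg, norm_one]
      rw [norm_mul, norm_unitPoint, mul_one, Complex.norm_real, Real.norm_eq_abs, ← abs_neg] at h5
      linarith
    have h3 := congrArg norm (hGeq θ)
    rw [norm_mul, h1, mul_comm] at h3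
    exact mul_right_cancel₀ h2.ne' h3
  have hGc : Continuous G := continuous_causalSeries hg
  have hadd : ∀ θ, 1 + (G θ - 1) = G θ := fun θ => by ring
  have hrate : feedbackRate (fun θ => G θ - 1) = Real.log σ := by
    rw [feedbackRate_eq]
    simp only [relaxedRate, hadd, hGnorm, integral_const, probReal_univ, smul_eq_mul, one_mul]
  -- For constant S the linear term sees only the mean of F, which is 1.
  have hpow : ∀ A F, IsAdmissible A F → relaxedPower (rationalSpectrum P Q) A F =
      ((∫ θ, A θ ^ 2 ∂μ) - 1) * s := fun A F h => by
    have hF1 : ∫ θ, (F θ).re ∂μ = 1 := by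
      have h1 := integral_re (h.memLp_fun.integrable (by norm_num : (1 : ℝ≥0∞) ≤ 2))
      have h2 := h.mean
      rw [fourierCoeff_eq] at h2
      simp only [neg_zero, zpow_zero, one_mul] at h2
      rw [h2] at h1
      simpa using h1
    have hA := h.memLp_env.integrable_sq
    have hF : Integrable (fun θ => 2 * (F θ).re) μ :=
      (h.memLp_fun.integrable (by norm_num)).re.const_mul 2
    have hF2 : ∫ θ, 2 * (F θ).re ∂μ = 2 := by rw [integral_const_mul, hF1, mul_one]
    have hAF : Integrable (fun θ => A θ ^ 2 - 2 * (F θ).re) μ := hA.sub hF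
    simp only [relaxedPower, hs]
    rw [integral_mul_const, integral_add hAF (integrable_const 1), integral_sub hA hF, hF2]
    simp only [integral_const, probReal_univ, smul_eq_mul, one_mul]
    ring
  have hfeas : ∀ c, inputPower (rationalSpectrum P Q) (fun θ => G θ - 1) ≤ c →
      IsFeasible 2 (rationalSpectrum P Q) c (fun θ => G θ - 1) := fun c hc =>
    (isFeasible_causalSeries hrsum (by simp [hr]) hc).of_top
  have hGpow : inputPower (rationalSpectrum P Q) (fun θ => G θ - 1) = power := by
    rw [inputPower_eq, hpow _ _ (hfeas _ le_rfl).isAdmissible]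
    simp only [hadd, hGnorm, integral_const, probReal_univ, smul_eq_mul, one_mul, hσsq]
    field_simp
    ring
  refine ⟨fun θ => G θ - 1, isCapacityAttaining_causalSeries hS hpower hrsum (by simp [hr]) hσ0
    (ae_of_all _ fun θ => (hGnorm θ).ge) hGpow.le (fun B' h => ?_)
    ⟨σ * √s, Q, by positivity, hPQ.coeff_zero_den, hPQ.natDegree_den_le, ae_of_all _ fun θ => ?_⟩⟩
  · have hadm := h.isAdmissible
    have h1 := h.relaxedPower_le
    rw [hpow _ _ hadm, ← le_div_iff₀ hs0] at h1
    rw [hrate, feedbackRate_eq]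
    have hi : Integrable (fun θ => 1 / (2 * σ ^ 2) * ‖1 + B' θ‖ ^ 2) μ :=
      hadm.memLp_env.integrable_sq.const_mul _
    -- The tangent to the logarithm at σ² bounds the rate by the mean square, which the power
    -- constraint keeps at most σ².
    have h2 : relaxedRate (fun θ => ‖1 + B' θ‖) ≤
        ∫ θ, (1 / (2 * σ ^ 2) * ‖1 + B' θ‖ ^ 2 + (Real.log σ - 1 / 2)) ∂μ := by
      refine integral_mono_ae hadm.log_integrable (hi.add (integrable_const _)) ?_
      filter_upwards [hadm.pos] with θ hθ
      have h3 := Real.log_le_sub_one_of_pos (x := ‖1 + B' θ‖ ^ 2 / σ ^ 2) (by positivity)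
      rw [Real.log_div (by positivity) (by positivity), Real.log_pow, Real.log_pow] at h3
      push_cast at h3
      have h4 : 1 / (2 * σ ^ 2) * ‖1 + B' θ‖ ^ 2 = ‖1 + B' θ‖ ^ 2 / σ ^ 2 / 2 := by
        field_simp
      rw [h4]
      linarith
    rw [integral_add hi (integrable_const _), integral_const_mul] at h2
    simp only [integral_const, probReal_univ, smul_eq_mul, one_mul] at h2
    have h5 : 1 / (2 * σ ^ 2) * ∫ θ, ‖1 + B' θ‖ ^ 2 ∂μ ≤ 1 / 2 := by
      have h6 : ∫ θ, ‖1 + B' θ‖ ^ 2 ∂μ ≤ σ ^ 2 := by rw [hσsq]; linarith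
      rw [one_div_mul_eq_div, div_le_div_iff₀ (by positivity) two_pos]
      linarith
    linarith
  · have h1 : rationalSpectrum Q Q θ = 1 := by
      rw [rationalSpectrum, div_self (hPQ.stable_den.ne_zero_of_norm_eq_one θ)]
      simp
    rw [h1, hs, mul_pow, Real.sq_sqrt hs0.le, ← hG, hGnorm, mul_one]

/-- The relaxation is tight here, so the F of the relaxed optimum, summed as its Fourier series, is
1 + B for an optimal filter B. -/
lemma exists_isCapacityAttaining_of_not_const {k : ℕ} {P Q : ℝ[X]} (hPQ : IsARMAFactor k P Q)
    {power : ℝ} (hpower : 0 < power) (hnc : ¬ ∃ s, ∀ θ, rationalSpectrum P Q θ = s) :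
    ∃ B, IsCapacityAttaining k P Q power B := by
  have hS := isNoiseSpectrum_rationalSpectrum hPQ.stable_num hPQ.stable_den
  obtain ⟨A, F, hadm, hpow, hopt⟩ := exists_relaxed_optimum hS hpower.le
  obtain ⟨lam, hlam, hmax⟩ := exists_lagrange_multiplier hS hpower hadm hpow hopt
  have hwater := waterfilling hS hlam hadm fun A' h' => hmax A' F h'
  obtain ⟨s₀, s₁, hs₀, hs₁, hsb⟩ := hS.exists_bounds
  -- The lowest water level. It bounds 1/A² for stationarity, and later |F| from below for the
  -- polynomial approximation.
  set c := 1 / √(lam * s₁) with hc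
  have hc0 : 0 < c := waterlevel_pos hlam hs₁
  have hAc : ∀ᵐ θ ∂μ, c ≤ A θ := by
    filter_upwards [hwater] with θ hθ
    rw [hθ]
    refine le_trans ?_ (le_max_right _ _)
    have h1 : 0 < lam * rationalSpectrum P Q θ := mul_pos hlam (hS.pos θ)
    refine one_div_le_one_div_of_le (Real.sqrt_pos.2 h1) (Real.sqrt_le_sqrt ?_)
    exact mul_le_mul_of_nonneg_left (hsb θ).2 hlam.le
  obtain ⟨hAF, hdecay, hout⟩ := optimum_structure hPQ hnc hlam hadm hwater
    (stationarity hS hadm hc0 hAc hmax)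
  have hFi : Integrable F μ := hadm.memLp_fun.integrable (by norm_num)
  set r : ℕ → ℝ := fun i => (fourierCoeff F i).re with hr
  have hrc : (fun i => (r i : ℂ)) = fun i : ℕ => fourierCoeff F i := by
    funext i
    exact Complex.ext (by simp [hr]) (by simpa using (hadm.hermitian.hasRealCoeffs i).symm)
  have hrsum : Summable r := (Complex.hasSum_re hdecay.summable.hasSum).summable
  have hr0 : r 0 = 1 := by simp [hr, hadm.mean]
  have hFG : F =ᵐ[μ] causalSeries fun i => (r i : ℂ) := by
    rw [hrc]
    exact ae_eq_causalSeries hFi hadm.causal hdecay.summable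
  have hAG : A =ᵐ[μ] fun θ => ‖1 + (causalSeries (fun i => (r i : ℂ)) θ - 1)‖ := by
    filter_upwards [hAF, hFG] with θ h1 h2
    rw [h1, h2, add_sub_cancel]
  have hFG' : F =ᵐ[μ] fun θ => 1 + (causalSeries (fun i => (r i : ℂ)) θ - 1) := by
    filter_upwards [hFG] with θ h2
    rw [h2, add_sub_cancel]
  refine ⟨_, isCapacityAttaining_causalSeries (δ := c) hS hpower hrsum hr0 hc0 ?_ ?_
    (fun B' h => ?_) ?_⟩
  · filter_upwards [hAc, hAG] with θ h1 h2
    rw [h2, add_sub_cancel] at h1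
    exact h1
  · rw [inputPower_eq, ← relaxedPower_congr hAG hFG']
    exact hpow
  · rw [feedbackRate_eq, feedbackRate_eq, ← relaxedRate_congr hAG]
    exact hopt _ _ h.isAdmissible h.relaxedPower_le
  · obtain ⟨σ, R, h1, h2, h3, h4⟩ := hout
    refine ⟨σ, R, h1, h2, h3, ?_⟩
    filter_upwards [h4, hFG] with θ h5 h6
    rw [← h5, h6]

end GaussianFeedback

theorem proposition7 (k : ℕ) (P Q : Polynomial ℝ) (hPQ : GaussianFeedback.IsARMAFactor k P Q)
    (power : ℝ) (hpower : 0 ≤ power) :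
    ∃ B : GaussianFeedback.AngleCircle → ℂ,
      GaussianFeedback.IsFeasible ⊤ (GaussianFeedback.rationalSpectrum P Q) power B ∧
      MeasureTheory.Integrable (fun θ => Real.log (‖1 + B θ‖ ^ 2)) AddCircle.haarAddCircle ∧
      IsLUB (GaussianFeedback.polynomialRates (GaussianFeedback.rationalSpectrum P Q) power)
        (GaussianFeedback.feedbackRate B) ∧
      (∀ B' : GaussianFeedback.AngleCircle → ℂ,
        GaussianFeedback.IsFeasible 2 (GaussianFeedback.rationalSpectrum P Q) power B' →
          GaussianFeedback.feedbackRate B' ≤ GaussianFeedback.feedbackRate B) ∧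
      ∃ (σ : ℝ) (R : Polynomial ℝ), 0 < σ ∧ R.coeff 0 = 1 ∧ R.natDegree ≤ k ∧
        ∀ᵐ θ ∂(AddCircle.haarAddCircle : MeasureTheory.Measure GaussianFeedback.AngleCircle),
          GaussianFeedback.outputSpectrum (GaussianFeedback.rationalSpectrum P Q) B θ =
            σ ^ 2 * GaussianFeedback.rationalSpectrum R Q θ := by
  obtain ⟨B, h1, h2, h3, h4⟩ : ∃ B, GaussianFeedback.IsCapacityAttaining k P Q power B := by
    rcases hpower.eq_or_lt with rfl | hpos
    · exact ⟨_, GaussianFeedback.isCapacityAttaining_zero hPQ⟩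
    by_cases hc : ∃ s, ∀ θ, GaussianFeedback.rationalSpectrum P Q θ = s
    · obtain ⟨s, hs⟩ := hc
      exact GaussianFeedback.exists_isCapacityAttaining_of_const hPQ hpos hs
    · exact GaussianFeedback.exists_isCapacityAttaining_of_not_const hPQ hpos hc
  exact ⟨B, h1, h1.of_top.integrable_log, h2, h3, h4⟩
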